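/- **Notions.** Coproducts are indexed by small sets; $\mathcal V$, $\mathcal W$ are locally small categories with coproducts. A *$\mathcal V$-graph* $X$ is a set $X_0$ with objects $X(a,b)\in\mathcal V$ for $a,b\in X_0$; a morphism is a function on objects with morphisms $X(a,b)\to Y(fa,fb)$. This gives the category $\mathcal G\mathcal V$. A *multitensor* (lax monoidal structure) $E$ on $\mathcal V$ consists of functors $E_n:\mathcal V^n\to\mathcal V$ ($n\ge 0$; $E_n(Z_1,\dots,Z_n)$ is also written $E_i Z_i$), and natural maps $u:Z\to E_1Z$ and $\sigma:E_iE_jZ_{ij}\to E_{ij}Z_{ij}$, satisfying the unit and associativity laws. A morphism of multitensors $\varepsilon:E\to F$ on $\mathcal V$ is a family of natural transformations $E_n\to F_n$ compatible with $u$ and $\sigma$. A *lax monoidal functor* $(H,\psi):(\mathcal V,E)\to(\mathcal W,F)$ is a functor $H:\mathcal V\to\mathcal W$ with natural maps $\psi:F_iHX_i\to HE_iX_i$ compatible with $u$ and $\sigma$. $E$ is *distributive* if each $E_n$ preserves coproducts in each variable. For $E$ distributive, $\Gamma E$ is the monad on $\mathcal G\mathcal V$ which is the identity on object sets, with $$\Gamma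 E(X)(a,b)=\coprod_{a=x_0,\dots,x_n=b}E_i\,X(x_{i-1},x_i)$$ (the coproduct over all $n\ge0$ and all sequences of objects from $a$ to $b$), and with unit and multiplication induced by $u$ and $\sigma$. A morphism $\varepsilon:E\to F$ induces a monad morphism $\Gamma\varepsilon:\Gamma E\to\Gamma F$. For $(H,\psi)$ between distributive lax monoidal categories, $\Gamma\psi:\Gamma F\circ\mathcal GH\Rightarrow\mathcal GH\circ\Gamma E$ is the identity on objects and on homs is the composite $$\coprod F_iHX(x_{i-1},x_i)\xrightarrow{\;\coprod\psi\;}\coprod HE_iX(x_{i-1},x_i)\longrightarrow H\coprod E_iX(x_{i-1},x_i).$$ For a class $\mathcal I$ of maps of a category, a map is a *trivial $\mathcal I$-fibration* if it has the right lifting property with respect to every map of $\mathcal I$; a natural transformation is one if all its components are. For a class $\mathcal I$ of maps of $\mathcal W$, $\mathcal I^+$ is the class of maps of $\mathcal G\mathcal W$ consisting of $\emptyset\to0$, where $0$ is the graph with one object and initial hom, and of $(i):(S)\to(B)$ for $i\in\mathcal I$, where $(S)$ has two objects $0,1$, with $(S)(0,1)=S$ and all other homs initial. $\mathcal W$ is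 *extensive* if $\prod_j\mathcal W/X_j\to\mathcal W/\coprod_jX_j$ is an equivalence for every family $(X_j)$, and $B\in\mathcal W$ is *connected* if $\mathcal W(B,-)$ preserves coproducts. For a coproduct preserving monad $T$ on a category with finite products that distribute over coproducts, $T^\times$ is the distributive multitensor $(Z_1,\dots,Z_n)\mapsto TZ_1\times\dots\times TZ_n$. Let $\mathcal T_{\le0}$ be the identity monad on $\mathbf{Set}$ and $\mathcal T_{\le n+1}=\Gamma(\mathcal T_{\le n}^\times)$, a monad on $\mathcal G^{n+1}\mathbf{Set}$; let $\mathcal T_{\le\infty}$ be the monad on the category of globular sets whose algebras are the strict $\omega$-categories. Identifying graphs enriched in globular sets with globular sets, one has $\Gamma(\mathcal T_{\le\infty}^\times)=\mathcal T_{\le\infty}$; put $\infty+1=\infty$. Let $\mathcal I_{\le0}=\{\emptyset\to1,\;1+1\to1\}$, $\mathcal I_{\le n+1}=(\mathcal I_{\le n})^+$, and let $\mathcal I_{\le\infty}$ be the set of inclusions $\partial k\hookrightarrow k$ ($k\ge0$) of the $k$-globe with its unique $k$-cell removed into the $k$-globe. A *$\mathcal T_{\le n+1}$-operad over $\mathbf{Set}$*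 is a monad morphism $\alpha:A\to\mathcal T_{\le n+1}$ that is a cartesian natural transformation and whose components are the identity on objects ($0$-cells), up to relabelling. A *$\mathcal T_{\le n}^\times$-multitensor* is a morphism of multitensors $\varepsilon:E\to\mathcal T_{\le n}^\times$ all of whose naturality squares are pullbacks. They *correspond* if $E$ is distributive and there is an isomorphism of monads $\Gamma E\cong A$ that identifies $\alpha$ with $\Gamma\varepsilon$. The operad $\alpha$ is *contractible* if it is a trivial $\mathcal I_{\le n+1}$-fibration, and the multitensor $\varepsilon$ is *contractible* if it is a trivial $\mathcal I_{\le n}$-fibration. **Proposition.** Let $(H,\psi):(\mathcal V,E)\to(\mathcal W,F)$ be a lax monoidal functor between distributive lax monoidal categories and $\mathcal I$ a class of maps in $\mathcal W$. Suppose that $\mathcal W$ is extensive, that $H$ preserves coproducts and that the codomains of the maps in $\mathcal I$ are connected. Then $\psi$ is a trivial $\mathcal I$-fibration if and only if $\Gamma\psi$ is a trivial $\mathcal I^+$-fibration. **Corollary.** Let $0\le n\le\infty$, let $\alpha:A\to\mathcal T_{\le n+1}$ be a $\mathcal T_{\le n+1}$-operad over $\mathbf{Set}$ and let $\varepsilon:E\to\mathcal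 T_{\le n}^\times$ be the corresponding $\mathcal T_{\le n}^\times$-multitensor. Then $\alpha$ is contractible if and only if $\varepsilon$ is contractible. -/

import Mathlib

open CategoryTheory CategoryTheory.Limits

universe v u u'

/-- The family `c` of morphisms with codomain `Z` is a coproduct cocone. -/
def IsCoprod {V : Type u} [Category.{v} V] {J : Type v} {A : J → V} {Z : V}
    (c : ∀ j, A j ⟶ Z) : Prop :=
  Nonempty (IsColimit (Cofan.mk Z c))

namespace IsCoprod

variable {V : Type u} [Category.{v} V] {J : Type v} {A : J → V} {Z : V} {c : ∀ j, A j ⟶ Z}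

lemma exists_desc (h : IsCoprod c) {W : V} (f : ∀ j, A j ⟶ W) : ∃ g : Z ⟶ W, ∀ j, c j ≫ g = f j :=
  ⟨Cofan.IsColimit.desc h.some f, fun j => Cofan.IsColimit.fac h.some f j⟩

lemma hom_ext (h : IsCoprod c) {W : V} {f g : Z ⟶ W} (e : ∀ j, c j ≫ f = c j ≫ g) : f = g :=
  Cofan.IsColimit.hom_ext h.some _ _ e

/-- The morphism out of a coproduct induced by a family. -/
noncomputable def desc (h : IsCoprod c) {W : V} (f : ∀ j, A j ⟶ W) : Z ⟶ W :=
  (h.exists_desc f).choose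

lemma fac (h : IsCoprod c) {W : V} (f : ∀ j, A j ⟶ W) (j : J) : c j ≫ h.desc f = f j :=
  (h.exists_desc f).choose_spec j

lemma of_existsUnique (H : ∀ (W : V) (f : ∀ j, A j ⟶ W), ∃ g : Z ⟶ W, ∀ j, c j ≫ g = f j)
    (H' : ∀ (W : V) (f g : Z ⟶ W), (∀ j, c j ≫ f = c j ≫ g) → f = g) : IsCoprod c :=
  ⟨Cofan.IsColimit.mk _ (fun s => (H _ s.inj).choose) (fun s => (H _ s.inj).choose_spec)
    (fun s _ hm => H' _ _ _ fun j => (hm j).trans ((H _ s.inj).choose_spec j).symm)⟩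

lemma sigma [HasCoproducts.{v} V] (A : J → V) : IsCoprod (fun j => Sigma.ι A j) :=
  ⟨coproductIsCoproduct A⟩

/-- Two coproducts of the same family are isomorphic. -/
lemma exists_iso (h : IsCoprod c) {Z' : V} {c' : ∀ j, A j ⟶ Z'} (h' : IsCoprod c') :
    ∃ e : Z ≅ Z', ∀ j, c j ≫ e.hom = c' j :=
  ⟨⟨h.desc c', h'.desc c, h.hom_ext fun j => by rw [← Category.assoc, h.fac, h'.fac, Category.comp_id],
    h'.hom_ext fun j => by rw [← Category.assoc, h'.fac, h.fac, Category.comp_id]⟩, h.fac c'⟩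

lemma comp_iso (h : IsCoprod c) {Z' : V} (e : Z ⟶ Z') [IsIso e] : IsCoprod (fun j => c j ≫ e) :=
  of_existsUnique (fun W f => ⟨inv e ≫ h.desc f, fun j => by simp [h.fac]⟩)
    (fun W f g H => by
      rw [← cancel_epi e]
      exact h.hom_ext fun j => by simpa using H j)

end IsCoprod

/-- A functor preserving (small) coproducts sends coproduct cocones to coproduct cocones. -/
lemma IsCoprod.map {V : Type u} [Category.{v} V] {W : Type u'} [Category.{v} W] {J : Type v}
    {A : J → V} {Z : V} {c : ∀ j, A j ⟶ Z} (h : IsCoprod c) (F : V ⥤ W)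
    [PreservesColimitsOfShape (Discrete J) F] : IsCoprod (fun j => F.map (c j)) :=
  ⟨isColimitCofanMkObjOfIsColimit F _ c h.some⟩

/-- A graph enriched in `V`: a set of objects and a family of objects of `V`. -/
structure VGraph (V : Type u) [Category.{v} V] : Type (max u (v + 1)) where
  Obj : Type v
  hom : Obj → Obj → V

namespace VGraph

section

variable {V : Type u} [Category.{v} V]

/-- A morphism of `V`-graphs. -/
structure Hom (X Y : VGraph V) : Type v where
  obj : X.Obj → Y.Obj
  map : ∀ a b, X.hom a b ⟶ Y.hom (obj a) (obj b)

/-- The category `𝒢V` of `V`-graphs. -/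
instance : Category.{v} (VGraph V) where
  Hom := Hom
  id X := ⟨id, fun _ _ => 𝟙 _⟩
  comp f g := ⟨g.obj ∘ f.obj, fun a b => f.map a b ≫ g.map _ _⟩
  id_comp f := by cases f; simp
  comp_id f := by cases f; simp
  assoc f g h := by simp [Function.comp_assoc]

@[simp] lemma id_obj (X : VGraph V) : Hom.obj (𝟙 X) = id := rfl
@[simp] lemma id_map (X : VGraph V) (a b : X.Obj) : Hom.map (𝟙 X) a b = 𝟙 _ := rfl
@[simp] lemma comp_obj {X Y Z : VGraph V} (f : X ⟶ Y) (g : Y ⟶ Z) :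
    Hom.obj (f ≫ g) = g.obj ∘ f.obj := rfl
@[simp] lemma comp_map {X Y Z : VGraph V} (f : X ⟶ Y) (g : Y ⟶ Z) (a b : X.Obj) :
    Hom.map (f ≫ g) a b = f.map a b ≫ g.map _ _ := rfl

/-- The transport morphism between homs with equal end points. -/
def cast (X : VGraph V) {a b a' b' : X.Obj} (ha : a = a') (hb : b = b') :
    X.hom a b ⟶ X.hom a' b' := eqToHom (by rw [ha, hb])

@[simp] lemma cast_rfl (X : VGraph V) {a b : X.Obj} (ha : a = a) (hb : b = b) :
    X.cast ha hb = 𝟙 _ := rfl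

lemma hom_ext {X Y : VGraph V} {f g : X ⟶ Y} (h : ∀ a, f.obj a = g.obj a)
    (h' : ∀ a b, f.map a b ≫ Y.cast (h a) (h b) = g.map a b) : f = g := by
  obtain ⟨f₀, f₁⟩ := f
  obtain ⟨g₀, g₁⟩ := g
  obtain rfl : f₀ = g₀ := funext h
  have : f₁ = g₁ := by
    funext a b
    simpa using h' a b
  rw [this]

lemma hom_ext' {X Y : VGraph V} {f₀ : X.Obj → Y.Obj}
    {f g : ∀ a b, X.hom a b ⟶ Y.hom (f₀ a) (f₀ b)}
    (h : ∀ a b, f a b = g a b) : (⟨f₀, f⟩ : X ⟶ Y) = ⟨f₀, g⟩ := by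
  rw [show f = g from funext fun a => funext fun b => h a b]

lemma map_congr {X Y : VGraph V} {f g : X ⟶ Y} (h : f = g) (a b : X.Obj) :
    f.map a b ≫ Y.cast (by rw [h]) (by rw [h]) = g.map a b := by
  subst h; simp

lemma cast_map {X Y : VGraph V} (f : X ⟶ Y) {a b a' b' : X.Obj} (ha : a = a') (hb : b = b') :
    X.cast ha hb ≫ f.map a' b' = f.map a b ≫ Y.cast (by rw [ha]) (by rw [hb]) := by
  subst ha hb; simp

@[simp] lemma cast_trans (X : VGraph V) {a b a' b' a'' b'' : X.Obj} (ha : a = a') (hb : b = b')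
    (ha' : a' = a'') (hb' : b' = b'') :
    X.cast ha hb ≫ X.cast ha' hb' = X.cast (ha.trans ha') (hb.trans hb') := by
  subst ha hb ha' hb'; simp

instance (X : VGraph V) {a b a' b' : X.Obj} (ha : a = a') (hb : b = b') :
    IsIso (X.cast ha hb) := by unfold cast; infer_instance

end

variable {V : Type u} [Category.{v} V] {W : Type u'} [Category.{v} W]

/-- The functor `𝒢H : 𝒢V ⥤ 𝒢W` which applies `H` to homs. -/
def mapFunctor (H : V ⥤ W) : VGraph V ⥤ VGraph W where
  obj X := ⟨X.Obj, fun a b => H.obj (X.hom a b)⟩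
  map f := ⟨f.obj, fun a b => H.map (f.map a b)⟩
  map_id X := hom_ext' fun a b => by simp
  map_comp f g := hom_ext' fun a b => by simp

end VGraph

/-! ### Sequences of sequences -/

/-- The position `(i, j)` of the `l`-th entry of a concatenation of `k` sequences of lengths
`n 0, …, n (k - 1)`: it is the `j`-th entry of the `i`-th sequence. -/
abbrev split {k : ℕ} {n : Fin k → ℕ} (l : Fin (∑ i, n i)) : (i : Fin k) × Fin (n i) :=
  finSigmaFinEquiv.symm l

/-- The position of the `j`-th entry of the `i`-th sequence in the concatenation. -/
abbrev join {k : ℕ} {n : Fin k → ℕ} (i : Fin k) (j : Fin (n i)) : Fin (∑ i, n i) :=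
  finSigmaFinEquiv ⟨i, j⟩

/-- The concatenation of a sequence of sequences. -/
abbrev flat {S : Type*} {k : ℕ} {n : Fin k → ℕ} (Z : ∀ i, Fin (n i) → S) : Fin (∑ i, n i) → S :=
  fun l => Z (split l).1 (split l).2

lemma split_join {k : ℕ} {n : Fin k → ℕ} (i : Fin k) (j : Fin (n i)) : split (join i j) = ⟨i, j⟩ :=
  Equiv.symm_apply_apply _ _

lemma join_split {k : ℕ} {n : Fin k → ℕ} (l : Fin (∑ i, n i)) :
    join (split l).1 (split l).2 = l :=
  Equiv.apply_symm_apply _ _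

/-- The position at which the `i`-th sequence starts in the concatenation. -/
def startPos {k : ℕ} (n : Fin k → ℕ) (i : ℕ) : ℕ :=
  ∑ i' : Fin k, if i'.val < i then n i' else 0

lemma startPos_succ {k : ℕ} (n : Fin k → ℕ) (i : Fin k) :
    startPos n (i.val + 1) = startPos n i.val + n i := by
  unfold startPos
  have : n i = ∑ i' : Fin k, if i' = i then n i' else 0 := by simp
  rw [this, ← Finset.sum_add_distrib]
  refine Finset.sum_congr rfl fun x _ => ?_
  by_cases h : x = i
  · subst h; simp
  · have : x.val ≠ i.val := fun h' => h (Fin.ext h')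
    by_cases h2 : x.val < i.val
    · simp [h2, h, Nat.lt_succ_of_lt h2]
    · have : ¬ x.val < i.val + 1 := by omega
      simp [h2, h, this]

lemma startPos_mono {k : ℕ} (n : Fin k → ℕ) {i i' : ℕ} (h : i ≤ i') :
    startPos n i ≤ startPos n i' := by
  unfold startPos
  refine Finset.sum_le_sum fun x _ => ?_
  by_cases h1 : x.val < i
  · simp [h1, lt_of_lt_of_le h1 h]
  · simp [h1]

lemma startPos_last {k : ℕ} (n : Fin k → ℕ) : startPos n k = ∑ i, n i := by
  simp [startPos]

lemma join_val {k : ℕ} {n : Fin k → ℕ} (i : Fin k) (j : Fin (n i)) :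
    (join i j).val = startPos n i.val + j.val := by
  rw [join, finSigmaFinEquiv_apply]
  congr 1
  unfold startPos
  rw [← Finset.sum_filter]
  refine Finset.sum_bij (fun x _ => Fin.castLE i.2.le x) ?_ ?_ ?_ ?_
  · intro x _
    simp only [Finset.mem_filter, Finset.mem_univ, true_and]
    exact x.2
  · intro a _ b _ h
    simpa [Fin.ext_iff] using h
  · intro b hb
    simp only [Finset.mem_filter, Finset.mem_univ, true_and] at hb
    exact ⟨⟨b.val, hb⟩, Finset.mem_univ _, rfl⟩
  · intros; rfl

lemma join_lt_join {k : ℕ} {n : Fin k → ℕ} {i i' : Fin k} {j : Fin (n i)} {j' : Fin (n i')}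
    (h : i < i' ∨ (i = i' ∧ j.val < j'.val)) : join i j < join i' j' := by
  rw [Fin.lt_def, join_val, join_val]
  rcases h with h | ⟨rfl, h⟩
  · have h1 := startPos_succ n i
    have h2 := startPos_mono n (show i.val + 1 ≤ i'.val from h)
    have := j.2
    omega
  · omega

lemma lt_iff_split {k : ℕ} {n : Fin k → ℕ} {l l' : Fin (∑ i, n i)} (h : l < l') :
    (split l).1 < (split l').1 ∨ ((split l).1 = (split l').1 ∧ (split l).2.val < (split l').2.val) := by
  by_contra hc
  push Not at hc
  obtain ⟨h1, h2⟩ := hc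
  have : l' ≤ l := by
    rw [← join_split l, ← join_split l']
    rcases h1.lt_or_eq with h1 | h1
    · exact (join_lt_join (Or.inl h1)).le
    · rcases (h2 h1.symm).lt_or_eq with h3 | h3
      · exact (join_lt_join (Or.inr ⟨h1, h3⟩)).le
      · rw [Fin.le_def, join_val, join_val, h3]
        exact Nat.add_le_add_right (startPos_mono n h1.le) _
  exact absurd h (not_lt.mpr this)

lemma strictMono_val {n m : ℕ} (h : n = m) (f : Fin n → Fin m) (hf : StrictMono f) (i : Fin n) :
    f i = Fin.cast h i := by
  subst h
  let e := hf.orderIsoOfSurjective f (Finite.surjective_of_injective hf.injective)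
  have := Fin.coe_orderIso_apply e i
  exact Fin.ext this

lemma sum_one_len (n : ℕ) : n = ∑ _i : Fin 1, n := by simp

lemma sum_len_one (n : ℕ) : n = ∑ _i : Fin n, 1 := by simp

lemma flat_one {S : Type*} {n : ℕ} (Z : Fin n → S) (i : Fin n) :
    Z i = flat (k := 1) (n := fun _ => n) (fun _ => Z) (Fin.cast (sum_one_len n) i) := by
  rw [← strictMono_val (sum_one_len n) (fun j => join (k := 1) (n := fun _ => n) 0 j)
    (fun a b h => join_lt_join (Or.inr ⟨rfl, h⟩)) i, flat, split_join]

lemma flat_ones {S : Type*} {n : ℕ} (Z : Fin n → S) (i : Fin n) :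
    Z i = flat (k := n) (n := fun _ => 1) (fun i _ => Z i) (Fin.cast (sum_len_one n) i) := by
  rw [← strictMono_val (sum_len_one n) (fun j => join (k := n) (n := fun _ => 1) j 0)
    (fun a b h => join_lt_join (Or.inl h)) i, flat, split_join]

lemma sum_split {k : ℕ} {n : Fin k → ℕ} (p : ∀ i, Fin (n i) → ℕ) :
    ∑ l : Fin (∑ i, n i), p (split l).1 (split l).2 = ∑ i, ∑ j, p i j := by
  rw [Equiv.sum_comp finSigmaFinEquiv.symm (fun x : (i : Fin k) × Fin (n i) => p x.1 x.2),
    Fintype.sum_sigma]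

lemma join_join_lt {k : ℕ} {n : Fin k → ℕ} {p : ∀ i, Fin (n i) → ℕ} {x y : (i : Fin k) × Fin (n i)}
    {s : Fin (p x.1 x.2)} {t : Fin (p y.1 y.2)}
    (h : x.1 < y.1 ∨ (x.1 = y.1 ∧ x.2.val < y.2.val) ∨ (x = y ∧ s.val < t.val)) :
    join (n := fun i => ∑ j, p i j) x.1 (join (n := p _) x.2 s) <
      join (n := fun i => ∑ j, p i j) y.1 (join (n := p _) y.2 t) := by
  obtain ⟨i, j⟩ := x
  obtain ⟨i', j'⟩ := y
  apply join_lt_join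
  rcases h with h | ⟨h, h'⟩ | ⟨h, h'⟩
  · exact Or.inl h
  · obtain rfl : i = i' := h
    exact Or.inr ⟨rfl, join_lt_join (Or.inl h')⟩
  · obtain ⟨rfl, h⟩ := Sigma.mk.inj h
    obtain rfl := eq_of_heq h
    exact Or.inr ⟨rfl, join_lt_join (Or.inr ⟨rfl, h'⟩)⟩

lemma split_split {k : ℕ} {n : Fin k → ℕ} (p : ∀ i, Fin (n i) → ℕ)
    (l : Fin (∑ l : Fin (∑ i, n i), p (split l).1 (split l).2)) :
    split (Fin.cast (sum_split p) l) =
      ⟨(split (split l).1).1, join (n := p _) (split (split l).1).2 (split l).2⟩ := by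
  rw [← strictMono_val (sum_split p) (fun l => join (n := fun i => ∑ j, p i j)
    (split (split l).1).1 (join (n := p _) (split (split l).1).2 (split l).2)), split_join]
  intro a b h
  apply join_join_lt
  rcases lt_iff_split h with h | ⟨h, h'⟩
  · exact (lt_iff_split h).imp_right Or.inl
  · exact Or.inr (Or.inr ⟨by rw [h], h'⟩)

lemma flat_flat {S : Type*} {k : ℕ} {n : Fin k → ℕ} {p : ∀ i, Fin (n i) → ℕ}
    (Z : ∀ i j, Fin (p i j) → S) (l : Fin (∑ l : Fin (∑ i, n i), p (split l).1 (split l).2)) :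
    flat (n := fun l => p (split l).1 (split l).2) (fun l => Z (split l).1 (split l).2) l =
      flat (fun i => flat (Z i)) (Fin.cast (sum_split p) l) := by
  rw [flat, flat, split_split, flat, split_join]

/-! ### Multitensors -/

section

variable {V : Type u} [Category.{v} V]

/-- For a family of functors of `n` variables, `n : ℕ`, the identification of the values at two
equal finite sequences. -/
def seqCast (F : ∀ n : ℕ, (Fin n → V) ⥤ V) {n m : ℕ} {Z : Fin n → V} {W : Fin m → V}
    (h : n = m) (h' : ∀ i, Z i = W (Fin.cast h i)) : (F n).obj Z ⟶ (F m).obj W :=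
  eqToHom (by subst h; exact congrArg _ (funext h'))

lemma seqCast_rfl (F : ∀ n : ℕ, (Fin n → V) ⥤ V) {n : ℕ} {Z : Fin n → V}
    (h : n = n) (h' : ∀ i, Z i = Z (Fin.cast h i)) : seqCast F h h' = 𝟙 _ := rfl

@[simp] lemma seqCast_trans (F : ∀ n : ℕ, (Fin n → V) ⥤ V) {n m l : ℕ} {Z : Fin n → V}
    {W : Fin m → V} {U : Fin l → V} (h : n = m) (h' : ∀ i, Z i = W (Fin.cast h i))
    (g : m = l) (g' : ∀ i, W i = U (Fin.cast g i)) :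
    seqCast F h h' ≫ seqCast F g g' =
      seqCast F (h.trans g) (fun i => (h' i).trans (g' _)) := by
  simp [seqCast]

instance (F : ∀ n : ℕ, (Fin n → V) ⥤ V) {n m : ℕ} {Z : Fin n → V} {W : Fin m → V}
    (h : n = m) (h' : ∀ i, Z i = W (Fin.cast h i)) : IsIso (seqCast F h h') := by
  unfold seqCast; infer_instance

/-- A multitensor on `V`, i.e. the structure of a lax monoidal category on `V`: tensor products
`E_{1 ≤ i ≤ n} Z_i` for all `n`, with unit `u_Z : Z ⟶ E_1 Z` and substitution
`σ : E_i E_j Z_{ij} ⟶ E_{ij} Z_{ij}`. The identifications `seqCast` are the equalities of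
iterated concatenations of sequences. -/
structure Multitensor (V : Type u) [Category.{v} V] where
  ten : ∀ n : ℕ, (Fin n → V) ⥤ V
  unit (Z : V) : Z ⟶ (ten 1).obj (fun _ => Z)
  sub {k : ℕ} {n : Fin k → ℕ} (Z : ∀ i, Fin (n i) → V) :
    (ten k).obj (fun i => (ten (n i)).obj (Z i)) ⟶ (ten (∑ i, n i)).obj (flat Z)
  unit_naturality {Z Z' : V} (f : Z ⟶ Z') : f ≫ unit Z' = unit Z ≫ (ten 1).map (fun _ => f)
  sub_naturality {k : ℕ} {n : Fin k → ℕ} {Z Z' : ∀ i, Fin (n i) → V} (f : ∀ i, Z i ⟶ Z' i) :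
    (ten k).map (fun i => (ten (n i)).map (f i)) ≫ sub Z' =
      sub Z ≫ (ten (∑ i, n i)).map (fun l => f (split l).1 (split l).2)
  unit_sub {n : ℕ} (Z : Fin n → V) :
    unit ((ten n).obj Z) ≫ sub (k := 1) (n := fun _ => n) (fun _ => Z) =
      seqCast ten (sum_one_len n) (flat_one Z)
  map_unit_sub {n : ℕ} (Z : Fin n → V) :
    (ten n).map (fun i => unit (Z i)) ≫ sub (n := fun _ => 1) (fun i _ => Z i) =
      seqCast ten (sum_len_one n) (flat_ones Z)
  sub_sub {k : ℕ} {n : Fin k → ℕ} {p : ∀ i, Fin (n i) → ℕ} (Z : ∀ i j, Fin (p i j) → V) :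
    sub (fun i j => (ten (p i j)).obj (Z i j)) ≫
        sub (n := fun l => p (split l).1 (split l).2) (fun l => Z (split l).1 (split l).2) ≫
        seqCast ten (sum_split p) (flat_flat Z) =
      (ten k).map (fun i => sub (Z i)) ≫ sub (fun i => flat (Z i))

namespace Multitensor

/-- A multitensor is distributive when its tensor products preserve coproducts in each variable:
a family of morphisms of sequences `c j : A j ⟶ Z`, which is a coproduct cocone in the `i`-th
variable and invertible in all other variables, is sent to a coproduct cocone. -/
def IsDistributive (E : Multitensor V) : Prop :=
  ∀ (n : ℕ) (i : Fin n) (J : Type v) (A : J → Fin n → V) (Z : Fin n → V) (c : ∀ j, A j ⟶ Z),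
    (∀ j i', i' ≠ i → IsIso (c j i')) → IsCoprod (fun j => c j i) →
      IsCoprod (fun j => (E.ten n).map (c j))

/-- A morphism of multitensors on `V`. -/
structure Hom (E F : Multitensor V) where
  app (n : ℕ) : E.ten n ⟶ F.ten n
  unit_app (Z : V) : E.unit Z ≫ (app 1).app _ = F.unit Z
  sub_app {k : ℕ} {n : Fin k → ℕ} (Z : ∀ i, Fin (n i) → V) :
    E.sub Z ≫ (app _).app (flat Z) =
      (E.ten k).map (fun i => (app (n i)).app (Z i)) ≫ (app k).app _ ≫ F.sub Z

/-- `ε : E ⟶ F` exhibits `E` as an `F`-multitensor: all naturality squares are pullbacks. -/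
def Hom.IsCartesian {E F : Multitensor V} (ε : Hom E F) : Prop :=
  ∀ n, NatTrans.Equifibered (ε.app n)

end Multitensor

/-- A lax monoidal functor between lax monoidal categories. -/
structure LaxMonFunctor {V : Type u} [Category.{v} V] {W : Type u'} [Category.{v} W]
    (E : Multitensor V) (F : Multitensor W) where
  functor : V ⥤ W
  coh {n : ℕ} (X : Fin n → V) :
    (F.ten n).obj (fun i => functor.obj (X i)) ⟶ functor.obj ((E.ten n).obj X)
  coh_naturality {n : ℕ} {X Y : Fin n → V} (f : X ⟶ Y) :
    (F.ten n).map (fun i => functor.map (f i)) ≫ coh Y = coh X ≫ functor.map ((E.ten n).map f)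
  unit_coh (X : V) : F.unit (functor.obj X) ≫ coh (fun _ => X) = functor.map (E.unit X)
  sub_coh {k : ℕ} {n : Fin k → ℕ} (X : ∀ i, Fin (n i) → V) :
    F.sub (fun i j => functor.obj (X i j)) ≫ coh (flat X) =
      (F.ten k).map (fun i => coh (X i)) ≫ coh (fun i => (E.ten (n i)).obj (X i)) ≫
        functor.map (E.sub X)

end

/-! ### Functors preserving coproducts in each variable -/

section

variable {V : Type u} [Category.{v} V]

/-- The functor `(Z_1, …, Z_k) ↦ (A, Z_1, …, Z_k)`. -/
def consFunctor (k : ℕ) (A : V) : (Fin k → V) ⥤ (Fin (k + 1) → V) where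
  obj Z := fun i => Fin.cases A Z i
  map f := fun i => Fin.cases (𝟙 A) f i
  map_id Z := by
    funext i
    refine Fin.cases ?_ (fun i => ?_) i <;> rfl
  map_comp f g := by
    funext i
    refine Fin.cases ?_ (fun i => ?_) i
    · exact (Category.comp_id _).symm
    · rfl

lemma isIso_seq {n : ℕ} {A Z : Fin n → V} (f : A ⟶ Z) (h : ∀ i, IsIso (f i)) : IsIso f :=
  ⟨⟨fun i => inv (f i), by funext i; simp, by funext i; simp⟩⟩

lemma isCoprod_multi (k : ℕ) (G : (Fin k → V) ⥤ V)
    (hG : ∀ (i : Fin k) (J : Type v) (A : J → Fin k → V) (Z : Fin k → V) (c : ∀ j, A j ⟶ Z),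
      (∀ j i', i' ≠ i → IsIso (c j i')) → IsCoprod (fun j => c j i) →
        IsCoprod (fun j => G.map (c j)))
    (J : Fin k → Type v) (A : ∀ i, J i → V) (Z : Fin k → V) (c : ∀ i j, A i j ⟶ Z i)
    (hc : ∀ i, IsCoprod (c i)) :
    IsCoprod (fun j : ∀ i, J i => G.map (X := fun i => A i (j i)) (Y := Z) fun i => c i (j i)) := by
  induction k with
  | zero =>
    have : ∀ j : ∀ i, J i, IsIso (G.map (X := fun i => A i (j i)) (Y := Z) fun i => c i (j i)) :=
      fun j => by
        have := isIso_seq (A := fun i => A i (j i)) (Z := Z) (fun i => c i (j i)) (fun i => i.elim0)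
        infer_instance
    let j₀ : ∀ i, J i := fun i => i.elim0
    refine IsCoprod.of_existsUnique (fun W f => ⟨inv (G.map (X := fun i => A i (j₀ i)) (Y := Z)
      fun i => c i (j₀ i)) ≫ f j₀, fun j => ?_⟩) (fun W f g H => ?_)
    · obtain rfl : j = j₀ := funext fun i => i.elim0
      simp
    · have := H j₀
      rwa [cancel_epi] at this
  | succ k ih =>
    let m (j₀ : J 0) : (consFunctor k (A 0 j₀)).obj (fun i => Z i.succ) ⟶ Z :=
      fun i => Fin.cases (c 0 j₀) (fun _ => 𝟙 _) i
    have h1 : IsCoprod (fun j₀ => G.map (m j₀)) := by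
      refine hG 0 (J 0) _ Z m (fun j i hi => ?_) (hc 0)
      obtain ⟨i, rfl⟩ := Fin.exists_succ_eq.mpr hi
      exact inferInstanceAs (IsIso (𝟙 (Z i.succ)))
    have h2 (j₀ : J 0) := ih (consFunctor k (A 0 j₀) ⋙ G) (fun i J' A' Z' c' h h' => by
        refine hG i.succ J' _ _ (fun j => (consFunctor k (A 0 j₀)).map (c' j)) ?_ h'
        intro j i'
        refine Fin.cases (fun _ => ?_) (fun i' hi => ?_) i'
        · exact inferInstanceAs (IsIso (𝟙 (A 0 j₀)))
        · exact h j i' (fun e => hi (by rw [e])))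
      (fun i => J i.succ) (fun i => A i.succ) (fun i => Z i.succ) (fun i => c i.succ)
      (fun i => hc i.succ)
    let t (j : ∀ i, J i) : (consFunctor k (A 0 (j 0))).obj (fun i => A i.succ (j i.succ)) ⟶
        fun i => A i (j i) := fun i => Fin.cases (𝟙 _) (fun _ => 𝟙 _) i
    have ht (j : ∀ i, J i) : (consFunctor k (A 0 (j 0))).map (fun i => c i.succ (j i.succ)) ≫
        m (j 0) = t j ≫ fun i => c i (j i) := by
      funext i
      refine Fin.cases ?_ (fun i => ?_) i
      · rfl
      · exact (Category.comp_id _).trans (Category.id_comp _).symm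
    have hti (j : ∀ i, J i) : IsIso (t j) := isIso_seq _ (fun i => by
      refine Fin.cases ?_ (fun i => ?_) i
      · exact inferInstanceAs (IsIso (𝟙 _))
      · exact inferInstanceAs (IsIso (𝟙 _)))
    refine IsCoprod.of_existsUnique (fun W f => ?_) (fun W f g H => ?_)
    · refine ⟨h1.desc fun j₀ => (h2 j₀).desc fun j' =>
        G.map (t (Fin.cons j₀ j')) ≫ f (Fin.cons j₀ j'), fun j => ?_⟩
      obtain ⟨j₀, j', rfl⟩ : ∃ (j₀ : J 0) (j' : ∀ i : Fin k, J i.succ), Fin.cons j₀ j' = j :=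
        ⟨_, _, Fin.cons_self_tail j⟩
      rw [← cancel_epi (G.map (t (Fin.cons j₀ j'))), ← Category.assoc, ← G.map_comp, ← ht,
        G.map_comp, Category.assoc, h1.fac]
      exact (h2 j₀).fac _ j'
    · refine h1.hom_ext fun j₀ => (h2 j₀).hom_ext fun j' => ?_
      let j : ∀ i, J i := Fin.cons j₀ j'
      have e := ht j
      have := congrArg (fun x => G.map (t j) ≫ x) (H j)
      simp only [← Category.assoc, ← G.map_comp, ← e] at this
      simp only [G.map_comp, Category.assoc] at this
      exact this

end

/-! ### Sequences of objects of a graph -/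

/-- A sequence `(x_0, …, x_n)` of elements of `S`, of length `n : ℕ`. -/
structure ObjSeq (S : Type v) : Type v where
  len : ℕ
  pt : Fin (len + 1) → S

namespace ObjSeq

variable {S : Type v} {S' : Type v}

lemma ext' {x y : ObjSeq S} (h : x.len = y.len)
    (h' : ∀ l : Fin x.len, x.pt l.castSucc = y.pt (Fin.cast h l).castSucc)
    (h'' : x.pt (Fin.last _) = y.pt (Fin.last _)) : x = y := by
  obtain ⟨n, x⟩ := x
  obtain ⟨m, y⟩ := y
  obtain rfl : n = m := h
  have : x = y := by
    funext l
    refine Fin.lastCases h'' (fun l => h' l) l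
  rw [this]

/-- The sequence `(a, b)`. -/
def single (a b : S) : ObjSeq S := ⟨1, fun i => if i.val = 0 then a else b⟩

/-- The image of a sequence under a function. -/
def map (f : S → S') (x : ObjSeq S) : ObjSeq S' := ⟨x.len, f ∘ x.pt⟩

/-- The sequence obtained from a sequence `x` and sequences `y i` from `x_i` to `x_{i+1}` by
running through all the `y i` successively, common end points being identified. -/
def concat (x : ObjSeq S) (y : Fin x.len → ObjSeq S) : ObjSeq S where
  len := ∑ i, (y i).len
  pt l := if h : l.val < ∑ i, (y i).len then
      flat (fun i (j : Fin (y i).len) => (y i).pt j.castSucc) ⟨l.val, h⟩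
    else x.pt (Fin.last _)

lemma concat_castSucc (x : ObjSeq S) (y : Fin x.len → ObjSeq S) (l : Fin (∑ i, (y i).len)) :
    (concat x y).pt l.castSucc = flat (fun i (j : Fin (y i).len) => (y i).pt j.castSucc) l := by
  have := l.2
  simp [concat]

lemma concat_last (x : ObjSeq S) (y : Fin x.len → ObjSeq S) :
    (concat x y).pt (Fin.last _) = x.pt (Fin.last _) := by
  simp [concat]

/-- The sequence `y i` goes from `x_i` to `x_{i+1}`. -/
def Fits (x : ObjSeq S) (y : Fin x.len → ObjSeq S) : Prop :=
  ∀ i, (y i).pt 0 = x.pt i.castSucc ∧ (y i).pt (Fin.last _) = x.pt i.succ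

lemma concat_start {x : ObjSeq S} {y : Fin x.len → ObjSeq S} (h : Fits x y) (d i : ℕ)
    (hd : i + d = x.len) (l : Fin ((∑ i, (y i).len) + 1))
    (hl : l.val = startPos (fun i => (y i).len) i) :
    (concat x y).pt l = x.pt ⟨i, by omega⟩ := by
  induction d generalizing i l with
  | zero =>
    obtain rfl : i = x.len := by omega
    rw [startPos_last] at hl
    obtain rfl : l = Fin.last _ := Fin.ext hl
    exact concat_last x y
  | succ d ih =>
    let i' : Fin x.len := ⟨i, by omega⟩
    have h1 := startPos_succ (fun i => (y i).len) i'
    by_cases h0 : (y i').len = 0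
    · rw [ih (i + 1) (by omega) l (by rw [hl]; simp only [i'] at h1 h0; omega)]
      refine (h i').2.symm.trans (Eq.trans ?_ (h i').1)
      congr 1
      exact Fin.ext (by simp [h0])
    · have h2 : l = (join (n := fun i => (y i).len) i' ⟨0, by omega⟩).castSucc :=
        Fin.ext (by rw [hl, Fin.val_castSucc, join_val]; rfl)
      rw [h2, concat_castSucc, flat, split_join]
      exact (h i').1

lemma concat_zero {x : ObjSeq S} {y : Fin x.len → ObjSeq S} (h : Fits x y) :
    (concat x y).pt 0 = x.pt 0 :=
  concat_start h x.len 0 (by omega) 0 (by simp [startPos])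

lemma concat_succ {x : ObjSeq S} {y : Fin x.len → ObjSeq S} (h : Fits x y)
    (l : Fin (∑ i, (y i).len)) :
    (concat x y).pt l.succ = flat (fun i (j : Fin (y i).len) => (y i).pt j.succ) l := by
  obtain ⟨i, j, rfl⟩ : ∃ i j, join i j = l := ⟨_, _, join_split l⟩
  rw [flat, split_join]
  have h1 := startPos_succ (fun i => (y i).len) i
  by_cases hj : j.val + 1 < (y i).len
  · have h2 : (join i j).succ = (join (n := fun i => (y i).len) i ⟨j.val + 1, hj⟩).castSucc :=
      Fin.ext (by rw [Fin.val_succ, Fin.val_castSucc, join_val, join_val]; rfl)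
    rw [h2, concat_castSucc, flat, split_join]
    rfl
  · have := j.2
    rw [concat_start h (x.len - (i.val + 1)) (i.val + 1) (by omega) _
      (by rw [Fin.val_succ, join_val]; omega)]
    refine (h i).2.symm.trans ?_
    congr 1
    exact Fin.ext (by simp; omega)

lemma concat_map (f : S → S') (x : ObjSeq S) (y : Fin x.len → ObjSeq S) :
    (concat x y).map f = concat (x.map f) (fun i => (y i).map f) := by
  refine ext' rfl (fun l => ?_) ?_
  · exact (congrArg f (concat_castSucc x y l)).trans
      (concat_castSucc (x.map f) (fun i => (y i).map f) l).symm
  · exact (congrArg f (concat_last x y)).trans (concat_last (x.map f) _).symm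

lemma concat_single (a b : S) (x : ObjSeq S) (h : x.pt (Fin.last _) = b) :
    x = concat (single a b) (fun _ => x) := by
  refine ext' (sum_one_len _) (fun l => ?_) ?_
  · exact (flat_one (fun j => x.pt j.castSucc) l).trans
      (concat_castSucc (single a b) (fun _ => x) _).symm
  · rw [concat_last, h]
    rfl

lemma concat_singles (x : ObjSeq S) :
    x = concat x (fun i => single (x.pt i.castSucc) (x.pt i.succ)) := by
  refine ext' (sum_len_one _) (fun l => ?_) (concat_last _ _).symm
  refine (flat_ones (fun j => x.pt j.castSucc) l).trans ?_
  refine Eq.trans ?_ (concat_castSucc x _ _).symm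
  simp [flat, single]
  rfl

lemma concat_concat (x : ObjSeq S) (y : Fin x.len → ObjSeq S)
    (z : ∀ i, Fin (y i).len → ObjSeq S) :
    concat (concat x y) (fun l => z (split l).1 (split l).2) =
      concat x (fun i => concat (y i) (z i)) := by
  refine ext' (sum_split fun i j => (z i j).len) (fun l => ?_) ?_
  · refine (concat_castSucc (concat x y) _ l).trans ?_
    refine (flat_flat (fun i j (s : Fin (z i j).len) => (z i j).pt s.castSucc) l).trans ?_
    refine Eq.trans ?_ (concat_castSucc x (fun i => concat (y i) (z i)) _).symm
    exact (concat_castSucc (y _) (z _) _).symm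
  · rw [concat_last, concat_last, concat_last]

end ObjSeq

/-- The sequences `(x_0, …, x_n)` of elements of `S` with `x_0 = a` and `x_n = b`. -/
def SeqFrom {S : Type v} (a b : S) : Type v :=
  {x : ObjSeq S // x.pt 0 = a ∧ x.pt (Fin.last _) = b}

namespace SeqFrom

variable {S : Type v} {S' : Type v} {a b : S}

def single (a b : S) : SeqFrom a b := ⟨ObjSeq.single a b, rfl, rfl⟩

def map (f : S → S') (x : SeqFrom a b) : SeqFrom (f a) (f b) :=
  ⟨x.1.map f, congrArg f x.2.1, congrArg f x.2.2⟩

def cast {a' b' : S} (ha : a = a') (hb : b = b') (x : SeqFrom a b) : SeqFrom a' b' :=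
  ⟨x.1, x.2.1.trans ha, x.2.2.trans hb⟩

lemma fits (x : ObjSeq S) (y : ∀ i : Fin x.len, SeqFrom (x.pt i.castSucc) (x.pt i.succ)) :
    x.Fits (fun i => (y i).1) := fun i => (y i).2

def concat (x : SeqFrom a b)
    (y : ∀ i : Fin x.1.len, SeqFrom (x.1.pt i.castSucc) (x.1.pt i.succ)) : SeqFrom a b :=
  ⟨x.1.concat (fun i => (y i).1), (ObjSeq.concat_zero (fits x.1 y)).trans x.2.1,
    (ObjSeq.concat_last _ _).trans x.2.2⟩

end SeqFrom

/-! ### The monad of a distributive multitensor -/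

section

variable {V : Type u} [Category.{v} V]

lemma seqCast_map (F : ∀ n : ℕ, (Fin n → V) ⥤ V) {n m : ℕ} {Z Z' : Fin n → V} {W W' : Fin m → V}
    (h : n = m) (h' : ∀ i, Z i = W (Fin.cast h i)) (h'' : ∀ i, Z' i = W' (Fin.cast h i))
    (g : Z ⟶ Z') (g' : W ⟶ W')
    (e : ∀ i, g i ≫ eqToHom (h'' i) = eqToHom (h' i) ≫ g' (Fin.cast h i)) :
    (F n).map g ≫ seqCast F h h'' = seqCast F h h' ≫ (F m).map g' := by
  subst h
  obtain rfl : Z = W := funext h'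
  obtain rfl : Z' = W' := funext h''
  obtain rfl : g = g' := funext fun i => by simpa using e i
  rw [seqCast_rfl, seqCast_rfl, Category.comp_id, Category.id_comp]

lemma Multitensor.map_seqCast_sub (E : Multitensor V) {k : ℕ} {n : Fin k → ℕ}
    {Z Z' : ∀ i, Fin (n i) → V} (h : ∀ i j, Z i j = Z' i j) :
    (E.ten k).map (fun i => seqCast E.ten (Z := Z i) (W := Z' i) rfl (h i)) ≫ E.sub Z' =
      E.sub Z ≫ seqCast E.ten rfl (fun _ => h _ _) := by
  obtain rfl : Z = Z' := funext fun i => funext (h i)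
  refine Eq.trans (congrArg (· ≫ _) ((E.ten k).map_id _)) ?_
  rw [Category.id_comp]
  exact (Category.comp_id _).symm

lemma Multitensor.IsDistributive.multi {E : Multitensor V} (hE : E.IsDistributive) {k : ℕ} {J : Fin k → Type v} {A : ∀ i, J i → V} {Z : Fin k → V}
    {c : ∀ i j, A i j ⟶ Z i} (hc : ∀ i, IsCoprod (c i)) :
    IsCoprod (fun j : ∀ i, J i => (E.ten k).map (X := fun i => A i (j i)) (Y := Z)
      fun i => c i (j i)) :=
  isCoprod_multi k (E.ten k) (hE k) J A Z c hc

namespace VGraph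

/-- The sequence `X(x_0, x_1), …, X(x_{n-1}, x_n)` of homs of a graph. -/
def homs (X : VGraph V) (x : ObjSeq X.Obj) : Fin x.len → V :=
  fun i => X.hom (x.pt i.castSucc) (x.pt i.succ)

def homsMap {X Y : VGraph V} (f : X ⟶ Y) (x : ObjSeq X.Obj) : X.homs x ⟶ Y.homs (x.map f.obj) :=
  fun i => f.map (x.pt i.castSucc) (x.pt i.succ)

lemma homs_single (X : VGraph V) (a b : X.Obj) (i : Fin 1) :
    X.hom a b = X.homs (ObjSeq.single a b) i := by
  obtain rfl := Subsingleton.elim i 0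
  rfl

lemma homs_concat (X : VGraph V) {x : ObjSeq X.Obj} {y : Fin x.len → ObjSeq X.Obj}
    (h : x.Fits y) (l : Fin (∑ i, (y i).len)) :
    flat (fun i => X.homs (y i)) l = X.homs (x.concat y) l := by
  exact (congrArg₂ X.hom (x.concat_castSucc y l) (ObjSeq.concat_succ h l)).symm

end VGraph

namespace Multitensor

variable [HasCoproducts.{v} V] (E : Multitensor V)

/-- The `V`-graph `ΓE(X)` with `ΓE(X)(a, b) = ∐_{a = x_0, …, x_n = b} E_i X(x_{i-1}, x_i)`. -/
noncomputable abbrev gammaObj (X : VGraph V) : VGraph V where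
  Obj := X.Obj
  hom a b := ∐ fun x : SeqFrom a b => (E.ten x.1.len).obj (X.homs x.1)

/-- The coproduct inclusions. -/
noncomputable def incl (X : VGraph V) {a b : X.Obj} (x : SeqFrom a b) :
    (E.ten x.1.len).obj (X.homs x.1) ⟶ (E.gammaObj X).hom a b :=
  Sigma.ι (fun x : SeqFrom a b => (E.ten x.1.len).obj (X.homs x.1)) x

lemma isCoprod_incl (X : VGraph V) (a b : X.Obj) :
    IsCoprod (fun x : SeqFrom a b => E.incl X x) :=
  IsCoprod.sigma _

variable {E} in
lemma gammaObj_hom_ext {X : VGraph V} {a b : X.Obj} {W : V} {f g : (E.gammaObj X).hom a b ⟶ W}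
    (h : ∀ x : SeqFrom a b, E.incl X x ≫ f = E.incl X x ≫ g) : f = g :=
  (E.isCoprod_incl X a b).hom_ext h

/-- The coproduct inclusion of the summand of `x`, when the sequence of homs is given as `Z`. -/
noncomputable def seqIncl (X : VGraph V) {n : ℕ} (Z : Fin n → V) {a b : X.Obj} (x : SeqFrom a b)
    (h : n = x.1.len) (h' : ∀ i, Z i = X.homs x.1 (Fin.cast h i)) :
    (E.ten n).obj Z ⟶ (E.gammaObj X).hom a b :=
  seqCast E.ten h h' ≫ E.incl X x

lemma seqIncl_self (X : VGraph V) {a b : X.Obj} (x : SeqFrom a b) :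
    E.seqIncl X (X.homs x.1) x rfl (fun _ => rfl) = E.incl X x :=
  Category.id_comp _

lemma seqCast_seqIncl (X : VGraph V) {n m : ℕ} {Z : Fin n → V} {Z' : Fin m → V} (g : n = m)
    (g' : ∀ i, Z i = Z' (Fin.cast g i)) {a b a' b' : X.Obj} (ha : a = a') (hb : b = b')
    (x : SeqFrom a b) (x' : SeqFrom a' b') (e : x.1 = x'.1)
    (h : n = x.1.len) (h' : ∀ i, Z i = X.homs x.1 (Fin.cast h i)) (k : m = x'.1.len)
    (k' : ∀ i, Z' i = X.homs x'.1 (Fin.cast k i)) :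
    seqCast E.ten g g' ≫ E.seqIncl X Z' x' k k' =
      E.seqIncl X Z x h h' ≫ (E.gammaObj X).cast ha hb := by
  subst g ha hb
  obtain rfl : x = x' := Subtype.ext e
  obtain rfl : Z = Z' := funext g'
  exact (Category.id_comp _).trans (Category.comp_id _).symm

/-- The functor `ΓE` on morphisms. -/
noncomputable def gammaMor {X Y : VGraph V} (f : X ⟶ Y) : E.gammaObj X ⟶ E.gammaObj Y :=
  ⟨f.obj, fun a b => Sigma.desc fun x : SeqFrom a b =>
    (E.ten x.1.len).map (VGraph.homsMap f x.1) ≫ E.incl Y (x.map f.obj)⟩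

lemma incl_map {X Y : VGraph V} (f : X ⟶ Y) {a b : X.Obj} (x : SeqFrom a b) :
    E.incl X x ≫ (E.gammaMor f).map a b =
      (E.ten x.1.len).map (VGraph.homsMap f x.1) ≫ E.incl Y (x.map f.obj) :=
  Sigma.ι_desc _ _

lemma map_seqIncl {X Y : VGraph V} (f : X ⟶ Y) {n : ℕ} {Z Z' : Fin n → V} (g : Z ⟶ Z')
    {a b : X.Obj} (x : SeqFrom a b) (y : SeqFrom (f.obj a) (f.obj b)) (e : y.1 = x.1.map f.obj)
    (h : n = x.1.len) (h' : ∀ i, Z i = X.homs x.1 (Fin.cast h i)) (k : n = y.1.len)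
    (k' : ∀ i, Z' i = Y.homs y.1 (Fin.cast k i))
    (k'' : ∀ i, Z' i = Y.homs (x.1.map f.obj) (Fin.cast h i))
    (hg : ∀ i, g i ≫ eqToHom (k'' i) =
      eqToHom (h' i) ≫ VGraph.homsMap f x.1 (Fin.cast h i)) :
    (E.ten n).map g ≫ E.seqIncl Y Z' y k k' =
      E.seqIncl X Z x h h' ≫ (E.gammaMor f).map a b := by
  subst h
  obtain rfl : y = x.map f.obj := Subtype.ext e
  obtain rfl : Z = X.homs x.1 := funext h'
  obtain rfl : Z' = Y.homs (x.1.map f.obj) := funext k''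
  obtain rfl : g = VGraph.homsMap f x.1 :=
    funext fun i => (Category.comp_id _).symm.trans ((hg i).trans (Category.id_comp _))
  rw [seqIncl_self, incl_map]
  exact congrArg (_ ≫ ·) (E.seqIncl_self Y (x.map f.obj))

/-- The functor `ΓE`. -/
noncomputable def gammaFunctor (E : Multitensor V) : VGraph V ⥤ VGraph V where
  obj := E.gammaObj
  map f := E.gammaMor f
  map_id X := by
    refine VGraph.hom_ext (fun _ => rfl) fun a b => (Category.comp_id _).trans ?_
    refine gammaObj_hom_ext (E := E) (X := X) (a := a) (b := b) fun x => ?_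
    exact (E.incl_map _ _).trans ((congrArg (· ≫ E.incl X x) ((E.ten _).map_id _)).trans
      ((Category.id_comp _).trans (Category.comp_id _).symm))
  map_comp {X Y Z} f g := by
    refine VGraph.hom_ext (fun _ => rfl) fun a b => (Category.comp_id _).trans ?_
    refine gammaObj_hom_ext (E := E) (X := X) (a := a) (b := b) fun x => ?_
    have h1 := E.incl_map (f ≫ g) x
    have h2 := E.incl_map f x
    have h3 := E.incl_map g (x.map f.obj)
    have h4 := (E.ten _).map_comp (VGraph.homsMap f x.1) (VGraph.homsMap g _)
    refine h1.trans ?_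
    refine Eq.trans ?_ (Category.assoc _ _ _)
    refine Eq.trans ?_ (congrArg (· ≫ _) h2.symm)
    refine Eq.trans ?_ (Category.assoc _ _ _).symm
    refine Eq.trans ?_ (congrArg (_ ≫ ·) h3.symm)
    refine Eq.trans ?_ (Category.assoc _ _ _)
    exact congrArg (· ≫ _) h4

/-- The unit of `ΓE`. -/
noncomputable def gammaUnit (E : Multitensor V) : 𝟭 (VGraph V) ⟶ E.gammaFunctor where
  app X := ⟨id, fun a b => E.unit (X.hom a b) ≫
    E.seqIncl X (fun _ => X.hom a b) (SeqFrom.single a b) rfl (X.homs_single a b)⟩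
  naturality X Y f := by
    refine VGraph.hom_ext (fun _ => rfl) fun a b => (Category.comp_id _).trans ?_
    refine (Category.assoc _ _ _).symm.trans ?_
    refine (congrArg (· ≫ _) (E.unit_naturality (f.map a b))).trans ?_
    refine (Category.assoc _ _ _).trans (Eq.trans ?_ (Category.assoc _ _ _).symm)
    refine congrArg (E.unit _ ≫ ·) ?_
    refine E.map_seqIncl f _ _ _ (congrArg (ObjSeq.mk 1) (funext fun i =>
      (apply_ite f.obj _ _ _).symm)) _ _ _ _ (fun i => ?_) fun i => ?_
    · obtain rfl := Subsingleton.elim i 0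
      rfl
    · obtain rfl := Subsingleton.elim i 0
      exact (Category.comp_id _).trans (Category.id_comp _).symm

/-- The multiplication of `ΓE`: on the summand of a doubly nested sequence of objects it is the
substitution of `E` followed by the inclusion of the summand of the concatenated sequence. -/
noncomputable def gammaMultMap (E : Multitensor V) (hE : E.IsDistributive) (X : VGraph V) :
    E.gammaObj (E.gammaObj X) ⟶ E.gammaObj X :=
  ⟨id, fun a b => Sigma.desc fun x : SeqFrom a b =>
    (hE.multi fun i : Fin x.1.len =>
      E.isCoprod_incl X (x.1.pt i.castSucc) (x.1.pt i.succ)).desc fun y =>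
        E.sub (fun i => X.homs (y i).1) ≫
          E.seqIncl X _ (x.concat y) rfl (X.homs_concat (SeqFrom.fits x.1 y))⟩

/-- The morphism `E_i k` for inclusions `k` of summands. -/
noncomputable def inclSeq (E : Multitensor V) (X : VGraph V) (x : ObjSeq X.Obj)
    (y : ∀ i : Fin x.len, SeqFrom (x.pt i.castSucc) (x.pt i.succ)) :
    (E.ten x.len).obj (fun i => (E.ten (y i).1.len).obj (X.homs (y i).1)) ⟶
      (E.ten x.len).obj ((E.gammaObj X).homs x) :=
  (E.ten x.len).map (Y := (E.gammaObj X).homs x) fun i => E.incl X (y i)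

lemma isCoprod_inclSeq (E : Multitensor V) (hE : E.IsDistributive) (X : VGraph V)
    (x : ObjSeq X.Obj) : IsCoprod (E.inclSeq X x) :=
  hE.multi fun i : Fin x.len => E.isCoprod_incl X (x.pt i.castSucc) (x.pt i.succ)

lemma inclSeq_mult (E : Multitensor V) (hE : E.IsDistributive) (X : VGraph V) {a b : X.Obj}
    (x : SeqFrom a b) (y : ∀ i : Fin x.1.len, SeqFrom (x.1.pt i.castSucc) (x.1.pt i.succ)) :
    E.inclSeq X x.1 y ≫ E.incl (E.gammaObj X) x ≫ (E.gammaMultMap hE X).map a b =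
      E.sub (fun i => X.homs (y i).1) ≫
        E.seqIncl X _ (x.concat y) rfl (X.homs_concat (SeqFrom.fits x.1 y)) :=
  (congrArg (E.inclSeq X x.1 y ≫ ·) (Sigma.ι_desc _ x)).trans
    (IsCoprod.fac (E.isCoprod_inclSeq hE X x.1) _ y)

end Multitensor

end

section

variable {V : Type u} [Category.{v} V] [HasCoproducts.{v} V]

namespace Multitensor

variable (E : Multitensor V)

lemma incl_cast (X : VGraph V) {a b a' b' : X.Obj} (ha : a = a') (hb : b = b')
    (x : SeqFrom a b) :
    E.incl X x ≫ (E.gammaObj X).cast ha hb = E.incl X (x.cast ha hb) := by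
  subst ha hb
  exact Category.comp_id _

variable {E} in
lemma gammaObj_hom_ext_two (hE : E.IsDistributive) {X : VGraph V} {a b : X.Obj} {W : V}
    {f g : (E.gammaObj (E.gammaObj X)).hom a b ⟶ W}
    (h : ∀ (x : SeqFrom a b) (y : ∀ i : Fin x.1.len, SeqFrom (x.1.pt i.castSucc) (x.1.pt i.succ)),
      E.inclSeq X x.1 y ≫ E.incl (E.gammaObj X) x ≫ f =
        E.inclSeq X x.1 y ≫ E.incl (E.gammaObj X) x ≫ g) : f = g :=
  gammaObj_hom_ext fun x => (E.isCoprod_inclSeq hE X x.1).hom_ext fun y => h x y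

lemma inclSeq_map {X Y : VGraph V} (f : X ⟶ Y) (x : ObjSeq X.Obj)
    (y : ∀ i : Fin x.len, SeqFrom (x.pt i.castSucc) (x.pt i.succ)) :
    E.inclSeq X x y ≫ (E.ten x.len).map (VGraph.homsMap (E.gammaMor f) x) =
      (E.ten x.len).map (fun i => (E.ten (y i).1.len).map (VGraph.homsMap f (y i).1)) ≫
        E.inclSeq Y (x.map f.obj) (fun i => (y i).map f.obj) := by
  refine ((E.ten _).map_comp _ _).symm.trans (Eq.trans ?_ ((E.ten _).map_comp _ _))
  exact congrArg (E.ten _).map (funext fun i => E.incl_map f (y i))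

lemma map_mult (hE : E.IsDistributive) (X : VGraph V) {a b : X.Obj} (x : SeqFrom a b)
    (y : ∀ i : Fin x.1.len, SeqFrom (x.1.pt i.castSucc) (x.1.pt i.succ))
    (Z : Fin x.1.len → V) (h : ∀ i, Z i = (E.gammaObj X).homs x.1 i)
    (g : ∀ i, (E.ten (y i).1.len).obj (X.homs (y i).1) ⟶ Z i)
    (hg : ∀ i, g i ≫ eqToHom (h i) = E.incl X (y i)) :
    (E.ten x.1.len).map g ≫ E.seqIncl (E.gammaObj X) Z x rfl h ≫ (E.gammaMultMap hE X).map a b =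
      E.sub (fun i => X.homs (y i).1) ≫
        E.seqIncl X _ (x.concat y) rfl (X.homs_concat (SeqFrom.fits x.1 y)) := by
  obtain rfl : Z = (E.gammaObj X).homs x.1 := funext h
  obtain rfl : g = fun i => E.incl X (y i) := funext fun i => (Category.comp_id _).symm.trans (hg i)
  rw [seqIncl_self]
  exact E.inclSeq_mult hE X x y

lemma map_seqIncl_mult (hE : E.IsDistributive) (X : VGraph V) {a b : X.Obj} (x : SeqFrom a b)
    (y : ∀ i : Fin x.1.len, SeqFrom (x.1.pt i.castSucc) (x.1.pt i.succ))
    (Z : ∀ i, Fin (y i).1.len → V) (h : ∀ i j, Z i j = X.homs (y i).1 j) :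
    (E.ten x.1.len).map (Y := (E.gammaObj X).homs x.1)
        (fun i => E.seqIncl X (Z i) (y i) rfl (h i)) ≫
        E.incl (E.gammaObj X) x ≫ (E.gammaMultMap hE X).map a b =
      E.sub Z ≫ E.seqIncl X _ (x.concat y) rfl (fun l => (h _ _).trans
        (X.homs_concat (SeqFrom.fits x.1 y) l)) := by
  obtain rfl : Z = fun i => X.homs (y i).1 := funext fun i => funext (h i)
  rw [← E.inclSeq_mult hE X x y]
  refine congrArg (· ≫ _) ?_
  exact congrArg (E.ten _).map (funext fun i => E.seqIncl_self X (y i))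

/-- The multiplication of `ΓE`. -/
noncomputable def gammaMult (hE : E.IsDistributive) :
    E.gammaFunctor ⋙ E.gammaFunctor ⟶ E.gammaFunctor where
  app := E.gammaMultMap hE
  naturality X Y f := by
    refine VGraph.hom_ext (fun _ => rfl) fun a b => (Category.comp_id _).trans ?_
    refine gammaObj_hom_ext_two hE (X := X) (a := a) (b := b) fun x y => ?_
    change E.inclSeq X x.1 y ≫ E.incl (E.gammaObj X) x ≫
        (E.gammaMor (E.gammaMor f)).map a b ≫ (E.gammaMultMap hE Y).map _ _ =
      E.inclSeq X x.1 y ≫ E.incl (E.gammaObj X) x ≫ (E.gammaMultMap hE X).map a b ≫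
        (E.gammaMor f).map a b
    have h1 := congrArg (E.inclSeq X x.1 y ≫ · ≫ (E.gammaMultMap hE Y).map _ _)
      (E.incl_map (E.gammaMor f) x)
    have h2 := congrArg (· ≫ E.incl (E.gammaObj Y) (x.map f.obj) ≫
      (E.gammaMultMap hE Y).map _ _) (E.inclSeq_map f x.1 y)
    have h3 := congrArg (· ≫ (E.gammaMor f).map a b) (E.inclSeq_mult hE X x y)
    have h4 := congrArg ((E.ten x.1.len).map (fun i => (E.ten (y i).1.len).map
      (VGraph.homsMap f (y i).1)) ≫ ·)
      (E.inclSeq_mult hE Y (x.map f.obj) (fun i => (y i).map f.obj))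
    have h5 := congrArg (· ≫ E.seqIncl Y _ ((x.map f.obj).concat fun i => (y i).map f.obj) rfl
      (Y.homs_concat (SeqFrom.fits (x.1.map f.obj) fun i => (y i).map f.obj)))
      (E.sub_naturality (fun i => VGraph.homsMap f (y i).1))
    have h6 := E.map_seqIncl f (Z := flat fun i => X.homs (y i).1)
      (Z' := flat fun i => Y.homs ((y i).map f.obj).1) (fun l => VGraph.homsMap f (y (split l).1).1 (split l).2)
      (x.concat y) ((x.map f.obj).concat fun i => (y i).map f.obj)
      (ObjSeq.concat_map f.obj x.1 _).symm rfl
      (X.homs_concat (SeqFrom.fits x.1 y)) rfl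
      (Y.homs_concat (SeqFrom.fits (x.1.map f.obj) fun i => (y i).map f.obj))
      (fun l => congrArg₂ (fun s t => Y.hom (f.obj s) (f.obj t))
        (ObjSeq.concat_castSucc x.1 _ l).symm (ObjSeq.concat_succ (SeqFrom.fits x.1 y) l).symm)
      (fun l => (VGraph.cast_map f (ObjSeq.concat_castSucc x.1 _ l).symm
        (ObjSeq.concat_succ (SeqFrom.fits x.1 y) l).symm).symm)
    have h7 := congrArg (E.sub (fun i => X.homs (y i).1) ≫ ·) h6
    refine (congrArg (_ ≫ ·) (Category.assoc _ _ _).symm).trans (h1.trans ?_)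
    refine (congrArg (_ ≫ ·) (Category.assoc _ _ _)).trans ?_
    refine (Category.assoc _ _ _).symm.trans (h2.trans ?_)
    refine (Category.assoc _ _ _).trans (h4.trans ?_)
    refine (Category.assoc _ _ _).symm.trans (h5.trans ?_)
    refine (Category.assoc _ _ _).trans (h7.trans ?_)
    refine (Category.assoc _ _ _).symm.trans (h3.symm.trans ?_)
    exact (Category.assoc _ _ _).trans (congrArg (_ ≫ ·) (Category.assoc _ _ _))

/-- The monad `ΓE` on `V`-graphs of a distributive multitensor `E` on `V`. -/
noncomputable def gamma (hE : E.IsDistributive) : Monad (VGraph V) where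
  toFunctor := E.gammaFunctor
  η := E.gammaUnit
  μ := E.gammaMult hE
  left_unit X := by
    refine VGraph.hom_ext (fun _ => rfl) fun a b => (Category.comp_id _).trans ?_
    refine gammaObj_hom_ext (E := E) (X := X) (a := a) (b := b) fun y => ?_
    refine Eq.trans ?_ (Category.comp_id _).symm
    let s : SeqFrom (S := X.Obj) a b := SeqFrom.single a b
    have hs (i : Fin 1) : a = s.1.pt i.castSucc ∧ b = s.1.pt i.succ := by
      obtain rfl := Subsingleton.elim i 0
      exact ⟨rfl, rfl⟩
    let y' : ∀ i : Fin s.1.len, SeqFrom (s.1.pt i.castSucc) (s.1.pt i.succ) :=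
      fun i => y.cast (hs i).1 (hs i).2
    have h1 := E.unit_naturality (E.incl X y)
    have h2 := E.map_mult hE X s y' (fun _ => (E.gammaObj X).hom a b)
      ((E.gammaObj X).homs_single a b) (fun _ => E.incl X y)
      (fun i => E.incl_cast X (hs i).1 (hs i).2 y)
    have h3 := E.unit_sub (X.homs y.1)
    have h4 := E.seqCast_seqIncl X (sum_one_len y.1.len) (flat_one (X.homs y.1)) rfl rfl y
      (s.concat y') (ObjSeq.concat_single a b y.1 y.2.2) rfl (fun _ => rfl) rfl
      (X.homs_concat (SeqFrom.fits s.1 y'))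
    replace h4 := h4.trans ((Category.comp_id _).trans (E.seqIncl_self X y))
    have h1' := congrArg (· ≫ E.seqIncl (E.gammaObj X) (fun _ => (E.gammaObj X).hom a b) s rfl
      ((E.gammaObj X).homs_single a b) ≫ (E.gammaMultMap hE X).map a b) h1
    have h2' := congrArg (E.unit ((E.ten y.1.len).obj (X.homs y.1)) ≫ ·) h2
    have h3' := congrArg (· ≫ E.seqIncl X _ (s.concat y') rfl
      (X.homs_concat (SeqFrom.fits s.1 y'))) h3
    refine (congrArg (E.incl X y ≫ ·) (Category.assoc _ _ _)).trans ?_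
    refine (Category.assoc _ _ _).symm.trans (h1'.trans ?_)
    refine (Category.assoc _ _ _).trans (h2'.trans ?_)
    exact (Category.assoc _ _ _).symm.trans (h3'.trans h4)
  right_unit X := by
    refine VGraph.hom_ext (fun _ => rfl) fun a b => (Category.comp_id _).trans ?_
    refine gammaObj_hom_ext (E := E) (X := X) (a := a) (b := b) fun x => ?_
    refine Eq.trans ?_ (Category.comp_id _).symm
    let y : ∀ i : Fin x.1.len, SeqFrom (x.1.pt i.castSucc) (x.1.pt i.succ) :=
      fun i => SeqFrom.single _ _
    have h1 := congrArg (· ≫ (E.gammaMultMap hE X).map a b) (E.incl_map (E.gammaUnit.app X) x)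
    have h2 := (E.ten x.1.len).map_comp (fun i => E.unit (X.homs x.1 i))
      (show _ ⟶ (E.gammaObj X).homs x.1 from
        fun i => E.seqIncl X (fun _ => X.homs x.1 i) (y i) rfl (X.homs_single _ _))
    have h2' := congrArg (· ≫ E.incl (E.gammaObj X) x ≫ (E.gammaMultMap hE X).map a b) h2
    have h3 := congrArg ((E.ten x.1.len).map (fun i => E.unit (X.homs x.1 i)) ≫ ·)
      (E.map_seqIncl_mult hE X x y (fun i _ => X.homs x.1 i) (fun i => X.homs_single _ _))
    have h4 := congrArg (· ≫ E.seqIncl X _ (x.concat y) rfl (fun l =>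
      (X.homs_single _ _ _).trans (X.homs_concat (SeqFrom.fits x.1 y) l)))
      (E.map_unit_sub (X.homs x.1))
    have h5 := E.seqCast_seqIncl X (sum_len_one x.1.len) (flat_ones (X.homs x.1)) rfl rfl x
      (x.concat y) (ObjSeq.concat_singles x.1) rfl (fun _ => rfl) rfl (fun l =>
      (X.homs_single _ _ _).trans (X.homs_concat (SeqFrom.fits x.1 y) l))
    replace h5 := h5.trans ((Category.comp_id _).trans (E.seqIncl_self X x))
    refine (Category.assoc _ _ _).symm.trans (h1.trans ?_)
    refine (Category.assoc _ _ _).trans (h2'.trans ?_)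
    refine (Category.assoc _ _ _).trans (h3.trans ?_)
    exact (Category.assoc _ _ _).symm.trans (h4.trans h5)
  assoc X := by
    refine VGraph.hom_ext (fun _ => rfl) fun a b => (Category.comp_id _).trans ?_
    refine gammaObj_hom_ext_two hE (X := E.gammaObj X) (a := a) (b := b) fun x y => ?_
    refine (hE.multi fun i => E.isCoprod_inclSeq hE X (y i).1).hom_ext fun z => ?_
    have hz (l : Fin (∑ i, (y i).1.len)) :
        (y (split l).1).1.pt (split l).2.castSucc = (x.concat y).1.pt l.castSucc ∧
        (y (split l).1).1.pt (split l).2.succ = (x.concat y).1.pt l.succ :=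
      ⟨(ObjSeq.concat_castSucc x.1 _ l).symm, (ObjSeq.concat_succ (SeqFrom.fits x.1 y) l).symm⟩
    let z' : ∀ l : Fin (x.concat y).1.len,
        SeqFrom (S := X.Obj) ((x.concat y).1.pt l.castSucc) ((x.concat y).1.pt l.succ) :=
      fun l => (z (split l).1 (split l).2).cast (hz l).1 (hz l).2
    let w : ∀ i : Fin x.1.len, SeqFrom (S := X.Obj) (x.1.pt i.castSucc) (x.1.pt i.succ) :=
      fun i => SeqFrom.concat (S := X.Obj) (y i) (z i)
    have l1 := congrArg ((E.ten x.1.len).map (fun i => E.inclSeq X (y i).1 (z i)) ≫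
      E.inclSeq (E.gammaObj X) x.1 y ≫ · ≫ (E.gammaMultMap hE X).map a b)
      (E.incl_map (E.gammaMultMap hE X) x)
    have l2 : (E.ten x.1.len).map (fun i => E.inclSeq X (y i).1 (z i)) ≫
        E.inclSeq (E.gammaObj X) x.1 y ≫
        (E.ten x.1.len).map (VGraph.homsMap (E.gammaMultMap hE X) x.1) =
      (E.ten x.1.len).map (fun i => E.sub (fun j => X.homs (z i j).1)) ≫
        (E.ten x.1.len).map (Y := (E.gammaObj X).homs x.1) (fun i => E.seqIncl X _ (w i) rfl
          (X.homs_concat (SeqFrom.fits (y i).1 (z i)))) := by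
      refine (congrArg (_ ≫ ·) ((E.ten _).map_comp _ _).symm).trans ?_
      refine ((E.ten _).map_comp _ _).symm.trans (Eq.trans ?_ ((E.ten _).map_comp _ _))
      exact congrArg (E.ten _).map (funext fun i => E.inclSeq_mult hE X (y i) (z i))
    have l2' := congrArg (· ≫ E.incl (E.gammaObj X) x ≫ (E.gammaMultMap hE X).map a b) l2
    have l3 := congrArg ((E.ten x.1.len).map (fun i => E.sub (fun j => X.homs (z i j).1)) ≫ ·)
      (E.map_seqIncl_mult hE X x w _ (fun i => X.homs_concat (SeqFrom.fits (y i).1 (z i))))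
    have r1 := congrArg ((E.ten x.1.len).map (fun i => E.inclSeq X (y i).1 (z i)) ≫ · ≫
      (E.gammaMultMap hE X).map a b) (E.inclSeq_mult hE (E.gammaObj X) x y)
    have r2 := congrArg (· ≫ E.seqIncl (E.gammaObj X) _ (x.concat y) rfl
      ((E.gammaObj X).homs_concat (SeqFrom.fits x.1 y)) ≫ (E.gammaMultMap hE X).map a b)
      (E.sub_naturality (fun i j => E.incl X (z i j)))
    have r3 := (E.map_mult hE X (x.concat y) z' _
      ((E.gammaObj X).homs_concat (SeqFrom.fits x.1 y))
      (fun l => E.incl X (z (split l).1 (split l).2))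
      (fun l => E.incl_cast X (hz l).1 (hz l).2 _))
    have m1 := congrArg (· ≫ E.seqIncl X _ (x.concat w) rfl (fun l =>
      (X.homs_concat (SeqFrom.fits (y _).1 (z _)) _).trans
        (X.homs_concat (SeqFrom.fits x.1 w) l))) (E.sub_sub (fun i j => X.homs (z i j).1))
    let S₁ := E.sub (fun i j => (E.ten (z i j).1.len).obj (X.homs (z i j).1))
    let S₂ := E.sub (k := ∑ i, (y i).1.len) (n := fun l => (z (split l).1 (split l).2).1.len)
      (fun l => X.homs (z (split l).1 (split l).2).1)
    have m2 := congrArg (fun t => S₁ ≫ S₂ ≫ t) (E.seqCast_seqIncl X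
      (sum_split fun i j => (z i j).1.len) (flat_flat fun i j => X.homs (z i j).1) rfl rfl
      ((x.concat y).concat z') (x.concat w)
      (ObjSeq.concat_concat x.1 (fun i => (y i).1) (fun i j => (z i j).1)) rfl
      (X.homs_concat (SeqFrom.fits _ z')) rfl (fun l =>
      (X.homs_concat (SeqFrom.fits (y _).1 (z _)) _).trans
        (X.homs_concat (SeqFrom.fits x.1 w) l)))
    have left := (congrArg (_ ≫ ·) (congrArg (_ ≫ ·) (Category.assoc _ _ _).symm)).trans (l1.trans
      ((congrArg (_ ≫ ·) (congrArg (_ ≫ ·) (Category.assoc _ _ _))).trans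
      ((congrArg (_ ≫ ·) (Category.assoc _ _ _).symm).trans
      ((Category.assoc _ _ _).symm.trans (l2'.trans
      ((Category.assoc _ _ _).trans (l3.trans (Category.assoc _ _ _).symm)))))))
    have right := (congrArg (_ ≫ ·) ((congrArg (_ ≫ ·) (Category.assoc _ _ _).symm).trans
      (Category.assoc _ _ _).symm)).trans (r1.trans
      ((congrArg (_ ≫ ·) (Category.assoc _ _ _)).trans ((Category.assoc _ _ _).symm.trans
      (r2.trans ((Category.assoc _ _ _).trans (congrArg (S₁ ≫ ·) r3))))))
    have middle := m1.symm.trans ((Category.assoc _ _ _).trans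
      ((congrArg (S₁ ≫ ·) (Category.assoc _ _ _)).trans
      (m2.trans (congrArg (fun t => S₁ ≫ S₂ ≫ t) (Category.comp_id _)))))
    exact left.trans (middle.trans right.symm)

end Multitensor

end

section

variable {V : Type u} [Category.{v} V] [HasCoproducts.{v} V]

/-- The natural transformation `Γε : ΓE ⟶ ΓF` of a morphism of multitensors `ε : E ⟶ F`. -/
noncomputable def Multitensor.Hom.gammaMap {E F : Multitensor V} (ε : Multitensor.Hom E F) :
    E.gammaFunctor ⟶ F.gammaFunctor where
  app X := ⟨id, fun a b => Sigma.desc fun x : SeqFrom a b =>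
    (ε.app x.1.len).app (X.homs x.1) ≫ F.incl X x⟩
  naturality X Y f := by
    refine VGraph.hom_ext (fun _ => rfl) fun a b => (Category.comp_id _).trans ?_
    refine Multitensor.gammaObj_hom_ext (E := E) (X := X) (a := a) (b := b) fun x => ?_
    refine (Category.assoc _ _ _).symm.trans ?_
    refine (congrArg (· ≫ _) (E.incl_map f x)).trans ((Category.assoc _ _ _).trans ?_)
    have h (Z : VGraph V) {a b : Z.Obj} (x : SeqFrom a b) :
        E.incl Z x ≫ (Sigma.desc fun x : SeqFrom a b =>
          (ε.app x.1.len).app (Z.homs x.1) ≫ F.incl Z x) =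
        (ε.app x.1.len).app (Z.homs x.1) ≫ F.incl Z x := Sigma.ι_desc _ x
    refine (congrArg ((E.ten x.1.len).map (VGraph.homsMap f x.1) ≫ ·)
      (h Y (x.map f.obj))).trans ?_
    refine Eq.trans ?_ (Category.assoc _ _ _)
    refine Eq.trans ?_ (congrArg (· ≫ _) (h X x).symm)
    refine Eq.trans ?_ (Category.assoc _ _ _).symm
    refine Eq.trans ?_ (congrArg (_ ≫ ·) (F.incl_map f x).symm)
    refine (Category.assoc _ _ _).symm.trans (Eq.trans ?_ (Category.assoc _ _ _))
    exact congrArg (· ≫ F.incl Y (x.map f.obj))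
      ((ε.app x.1.len).naturality (VGraph.homsMap f x.1))

variable {W : Type u'} [Category.{v} W] [HasCoproducts.{v} W]

/-- The natural transformation `Γψ` of a lax monoidal functor `(H, ψ) : (V, E) ⟶ (W, F)`: its
components are identities on objects and on homs they are the composites
`∐ F_i H X(x_{i-1}, x_i) ⟶ ∐ H E_i X(x_{i-1}, x_i) ⟶ H ∐ E_i X(x_{i-1}, x_i)`. -/
noncomputable def LaxMonFunctor.gammaMap {E : Multitensor V} {F : Multitensor W}
    (H : LaxMonFunctor E F) : VGraph.mapFunctor H.functor ⋙ F.gammaFunctor ⟶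
      E.gammaFunctor ⋙ VGraph.mapFunctor H.functor where
  app X := ⟨id, fun a b =>
    (Limits.Sigma.map fun x : SeqFrom (S := X.Obj) a b => H.coh (X.homs x.1)) ≫
      sigmaComparison H.functor fun x : SeqFrom (S := X.Obj) a b =>
        (E.ten x.1.len).obj (X.homs x.1)⟩
  naturality X Y f := by
    refine VGraph.hom_ext (fun _ => rfl) fun a b => (Category.comp_id _).trans ?_
    refine Multitensor.gammaObj_hom_ext (E := F)
      (X := (VGraph.mapFunctor H.functor).obj X) (a := a) (b := b) fun x => ?_
    have key (Z : VGraph V) {a b : Z.Obj} (y : SeqFrom a b) :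
        F.incl ((VGraph.mapFunctor H.functor).obj Z) y ≫
          (Limits.Sigma.map fun x : SeqFrom (S := Z.Obj) a b => H.coh (Z.homs x.1)) ≫
            sigmaComparison H.functor (fun x : SeqFrom (S := Z.Obj) a b =>
              (E.ten x.1.len).obj (Z.homs x.1)) = H.coh (Z.homs y.1) ≫ H.functor.map (E.incl Z y) := by
      have h1 := Sigma.ι_map (fun x : SeqFrom (S := Z.Obj) a b => H.coh (Z.homs x.1)) y
      have h2 := ι_comp_sigmaComparison H.functor (fun x : SeqFrom (S := Z.Obj) a b =>
        (E.ten x.1.len).obj (Z.homs x.1)) y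
      refine (Category.assoc _ _ _).symm.trans ((congrArg (· ≫ _) h1).trans ?_)
      exact (Category.assoc _ _ _).trans (congrArg (_ ≫ ·) h2)
    refine (Category.assoc _ _ _).symm.trans ?_
    refine (congrArg (· ≫ _) (F.incl_map ((VGraph.mapFunctor H.functor).map f) x)).trans
      ((Category.assoc _ _ _).trans ?_)
    refine (congrArg (_ ≫ ·) (key Y (x.map f.obj))).trans ?_
    refine Eq.trans ?_ (Category.assoc _ _ _)
    refine Eq.trans ?_ (congrArg (· ≫ H.functor.map _) (key X x).symm)
    refine (Category.assoc _ _ _).symm.trans ?_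
    refine (congrArg (· ≫ _) (H.coh_naturality (VGraph.homsMap f x.1))).trans ?_
    refine (Category.assoc _ _ _).trans (Eq.trans ?_ (Category.assoc _ _ _).symm)
    refine congrArg (H.coh (X.homs x.1) ≫ ·) ?_
    refine (H.functor.map_comp _ _).symm.trans (Eq.trans ?_ (H.functor.map_comp _ _))
    exact congrArg H.functor.map (E.incl_map f x).symm

end

/-! ### The multitensor `T^×` -/

section

variable {V : Type u} [Category.{v} V] [HasFiniteProducts V]

/-- The functor `(Z_1, …, Z_n) ↦ T Z_1 × ⋯ × T Z_n`. -/
noncomputable def timesFunctor (T : V ⥤ V) (n : ℕ) : (Fin n → V) ⥤ V where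
  obj Z := ∏ᶜ fun i => T.obj (Z i)
  map f := Limits.Pi.map fun i => T.map (f i)
  map_id Z := by
    refine Limits.Pi.hom_ext _ _ fun i => ?_
    simp
  map_comp f g := by
    refine Limits.Pi.hom_ext _ _ fun i => ?_
    simp

/-- The projections of `T Z_1 × ⋯ × T Z_n`. -/
noncomputable def timesProj (T : V ⥤ V) {n : ℕ} (Z : Fin n → V) (i : Fin n) :
    (timesFunctor T n).obj Z ⟶ T.obj (Z i) :=
  Pi.π (fun i => T.obj (Z i)) i

/-- The morphism to `T Z_1 × ⋯ × T Z_n` with the given components. -/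
noncomputable def timesLift (T : V ⥤ V) {n : ℕ} (Z : Fin n → V) {A : V}
    (f : ∀ i, A ⟶ T.obj (Z i)) : A ⟶ (timesFunctor T n).obj Z :=
  Pi.lift f

variable (T : V ⥤ V)

lemma times_hom_ext {n : ℕ} {Z : Fin n → V} {A : V} {f g : A ⟶ (timesFunctor T n).obj Z}
    (h : ∀ i, f ≫ timesProj T Z i = g ≫ timesProj T Z i) : f = g :=
  Limits.Pi.hom_ext _ _ h

lemma timesLift_proj {n : ℕ} (Z : Fin n → V) {A : V} (f : ∀ i, A ⟶ T.obj (Z i)) (i : Fin n) :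
    timesLift T Z f ≫ timesProj T Z i = f i :=
  limit.lift_π _ _

lemma timesMap_proj {n : ℕ} {Z Z' : Fin n → V} (f : Z ⟶ Z') (i : Fin n) :
    (timesFunctor T n).map f ≫ timesProj T Z' i = timesProj T Z i ≫ T.map (f i) :=
  Pi.map_π (fun i => T.map (f i)) i

lemma seqCast_proj {n m : ℕ} {Z : Fin n → V} {W : Fin m → V}
    (h : n = m) (h' : ∀ i, Z i = W (Fin.cast h i)) (i : Fin m) (j : Fin n)
    (e : j = Fin.cast h.symm i) (e' : Z j = W i) :
    seqCast (timesFunctor T) h h' ≫ timesProj T W i = timesProj T Z j ≫ T.map (eqToHom e') := by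
  subst h e
  obtain rfl : Z = W := funext h'
  refine Eq.trans ?_ (congrArg (_ ≫ ·) (T.map_id _).symm)
  exact (Category.id_comp _).trans (Category.comp_id _).symm

variable (T : Monad V)

/-- The projection of `∏ T (∏ T Z_{ij})` to `T Z_{ij}`. -/
noncomputable def timesProjTwo {k : ℕ} {n : Fin k → ℕ} (Z : ∀ i, Fin (n i) → V)
    (x : (i : Fin k) × Fin (n i)) :
    (timesFunctor T.toFunctor k).obj (fun i => (timesFunctor T.toFunctor (n i)).obj (Z i)) ⟶
      T.obj (Z x.1 x.2) :=
  timesProj T.toFunctor _ x.1 ≫ T.map (timesProj T.toFunctor (Z x.1) x.2) ≫ T.μ.app (Z x.1 x.2)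

lemma timesProjTwo_congr {k : ℕ} {n : Fin k → ℕ} (Z : ∀ i, Fin (n i) → V)
    {x y : (i : Fin k) × Fin (n i)} (h : x = y) (e : Z x.1 x.2 = Z y.1 y.2) :
    timesProjTwo T Z x ≫ T.map (eqToHom e) = timesProjTwo T Z y := by
  subst h
  rw [eqToHom_refl, T.map_id, Category.comp_id]

/-- The substitution of `T^×`. -/
noncomputable def timesSub {k : ℕ} {n : Fin k → ℕ} (Z : ∀ i, Fin (n i) → V) :
    (timesFunctor T.toFunctor k).obj (fun i => (timesFunctor T.toFunctor (n i)).obj (Z i)) ⟶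
      (timesFunctor T.toFunctor (∑ i, n i)).obj (flat Z) :=
  timesLift T.toFunctor (flat Z) fun l => timesProjTwo T Z (split l)

lemma timesSub_proj {k : ℕ} {n : Fin k → ℕ} (Z : ∀ i, Fin (n i) → V) (l : Fin (∑ i, n i)) :
    timesSub T Z ≫ timesProj T.toFunctor (flat Z) l = timesProjTwo T Z (split l) :=
  timesLift_proj _ _ _ l

lemma timesSub_proj_two {k : ℕ} {n : Fin k → ℕ} (Z : ∀ i, Fin (n i) → V) {A : V}
    (f : A ⟶ _) (l : Fin (∑ i, n i)) (x : (i : Fin k) × Fin (n i)) (h : x = split l) (e) :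
    (f ≫ timesSub T Z) ≫ timesProj T.toFunctor (flat Z) l =
      f ≫ timesProjTwo T Z x ≫ T.map (eqToHom e) := by
  rw [Category.assoc, timesSub_proj, timesProjTwo_congr T Z h e]

lemma split_cast_one {n : ℕ} (i : Fin n) :
    (⟨0, i⟩ : (_ : Fin 1) × Fin n) = split (Fin.cast (sum_one_len n) i) := by
  rw [← strictMono_val (sum_one_len n) (fun j => join (k := 1) (n := fun _ => n) 0 j)
    (fun a b h => join_lt_join (Or.inr ⟨rfl, h⟩)) i, split_join]

lemma split_cast_ones {n : ℕ} (i : Fin n) :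
    (⟨i, 0⟩ : (_ : Fin n) × Fin 1) = split (Fin.cast (sum_len_one n) i) := by
  rw [← strictMono_val (sum_len_one n) (fun j => join (k := n) (n := fun _ => 1) j 0)
    (fun a b h => join_lt_join (Or.inl h)) i, split_join]

/-- The multitensor `T^×` of a monad `T` on a category with finite products, with tensor products
`(Z_1, …, Z_n) ↦ T Z_1 × ⋯ × T Z_n`. -/
noncomputable def times : Multitensor V where
  ten := timesFunctor T.toFunctor
  unit Z := timesLift T.toFunctor (fun _ => Z) fun _ => T.η.app Z
  sub := timesSub T
  unit_naturality {Z Z'} f := times_hom_ext _ fun i => by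
    rw [Category.assoc, Category.assoc, timesLift_proj, timesMap_proj, ← Category.assoc,
      timesLift_proj]
    exact T.η.naturality f
  sub_naturality {k n Z Z'} f := times_hom_ext _ fun l => by
    rw [Category.assoc, Category.assoc, timesSub_proj, timesMap_proj, ← Category.assoc,
      timesSub_proj, timesProjTwo, timesProjTwo, ← Category.assoc, timesMap_proj,
      Category.assoc, Category.assoc, Category.assoc]
    congr 1
    rw [← Category.assoc, ← T.map_comp, timesMap_proj, T.map_comp, Category.assoc]
    congr 1
    exact T.μ.naturality _
  unit_sub {n} Z := times_hom_ext _ fun l => by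
    have e := split_cast_one (Fin.cast (sum_one_len n).symm l)
    rw [seqCast_proj T.toFunctor (sum_one_len n) _ l _ rfl (flat_one Z _),
      timesSub_proj_two T _ _ l _ e (flat_one Z _), timesProjTwo]
    simp only [← Category.assoc]
    rw [timesLift_proj]
    congr 1
    have := T.η.naturality (timesProj T.toFunctor Z (Fin.cast (sum_one_len n).symm l))
    have h2 := T.left_unit (Z (Fin.cast (sum_one_len n).symm l))
    refine (congrArg (· ≫ T.μ.app _) this.symm).trans ?_
    exact (Category.assoc _ _ _).trans ((congrArg (_ ≫ ·) h2).trans (Category.comp_id _))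
  map_unit_sub {n} Z := times_hom_ext _ fun l => by
    have e := split_cast_ones (Fin.cast (sum_len_one n).symm l)
    rw [seqCast_proj T.toFunctor (sum_len_one n) _ l _ rfl (flat_ones Z _),
      timesSub_proj_two T _ _ l _ e (flat_ones Z _), timesProjTwo]
    simp only [← Category.assoc]
    rw [timesMap_proj]
    congr 1
    rw [Category.assoc, Category.assoc, ← T.map_comp_assoc, timesLift_proj]
    exact (congrArg (_ ≫ ·) (T.right_unit _)).trans (Category.comp_id _)
  sub_sub {k n p} Z := times_hom_ext _ fun l => by
    obtain ⟨l, rfl⟩ : ∃ l', Fin.cast (sum_split p) l' = l := ⟨Fin.cast (sum_split p).symm l, rfl⟩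
    have e := split_split p l
    have e' := (split_join (n := p (split (split l).1).1) (split (split l).1).2 (split l).2).symm
    have eL := flat_flat Z l
    have eR : flat (fun i => flat (Z i)) (Fin.cast (sum_split p) l) =
        flat (Z (split (split l).1).1) (join (split (split l).1).2 (split l).2) := by
      rw [flat, e]
    have eM : Z (split (split l).1).1 (split (split l).1).2 (split l).2 =
        flat (Z (split (split l).1).1) (join (split (split l).1).2 (split l).2) := by
      rw [← eR, ← eL]
    rw [timesSub_proj_two T (fun i => flat (Z i)) _ (Fin.cast (sum_split p) l) _ e.symm eR.symm]
    rw [Category.assoc, Category.assoc, seqCast_proj T.toFunctor (sum_split p) _ _ l rfl eL]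
    have h1 := T.μ.naturality (timesProj T.toFunctor
      (Z (split (split l).1).1 (split (split l).1).2) (split l).2)
    have h2 := T.assoc (Z (split (split l).1).1 (split (split l).1).2 (split l).2)
    have h3 := T.μ.naturality (eqToHom eM)
    have hL : timesSub T (fun i j => (timesFunctor T.toFunctor (p i j)).obj (Z i j)) ≫
        timesSub T (n := fun l => p (split l).1 (split l).2) (fun l => Z (split l).1 (split l).2) ≫
          timesProj T.toFunctor _ l = timesProj T.toFunctor _ (split (split l).1).1 ≫
        T.map (timesProj T.toFunctor _ (split (split l).1).2) ≫
        T.map (T.map (timesProj T.toFunctor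
          (Z (split (split l).1).1 (split (split l).1).2) (split l).2)) ≫
        T.map (T.μ.app _) ≫ T.μ.app _ := by
      rw [timesSub_proj, timesProjTwo]
      refine (Category.assoc _ _ _).symm.trans ((congrArg (· ≫ _) (timesSub_proj _ _ _)).trans ?_)
      rw [timesProjTwo]
      refine (Category.assoc _ _ _).trans (congrArg (_ ≫ ·) ?_)
      refine (Category.assoc _ _ _).trans (congrArg (_ ≫ ·) ?_)
      refine (Category.assoc _ _ _).symm.trans ((congrArg (· ≫ _) h1.symm).trans ?_)
      exact (Category.assoc _ _ _).trans (congrArg (_ ≫ ·) h2.symm)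
    have hR : (timesFunctor T.toFunctor k).map (fun i => timesSub T (Z i)) ≫
        timesProjTwo T (fun i => flat (Z i))
          ⟨(split (split l).1).1, join (split (split l).1).2 (split l).2⟩ =
        timesProj T.toFunctor _ (split (split l).1).1 ≫
        T.map (timesProj T.toFunctor _ (split (split l).1).2) ≫
        T.map (T.map (timesProj T.toFunctor
          (Z (split (split l).1).1 (split (split l).1).2) (split l).2)) ≫
        T.map (T.μ.app _) ≫ T.μ.app _ ≫ T.map (eqToHom eM) := by
      rw [timesProjTwo, ← Category.assoc, timesMap_proj, Category.assoc]
      refine congrArg (_ ≫ ·) ?_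
      rw [← T.map_comp_assoc, timesSub_proj, ← timesProjTwo_congr T _ e' eM, timesProjTwo]
      simp only [Functor.map_comp, Category.assoc]
      exact congrArg (fun t => _ ≫ _ ≫ _ ≫ t) h3
    have hL' := congrArg (· ≫ T.map (eqToHom eL)) hL
    have hR' := congrArg (· ≫ T.map (eqToHom eR.symm)) hR
    simp only [Category.assoc] at hL' hR'
    refine hL'.trans (Eq.trans ?_ hR'.symm)
    rw [← T.map_comp, eqToHom_trans]

end

/-! ### Coproducts and products of graphs -/

section

variable {V : Type u} [Category.{v} V]

lemma IsCoprod.isIso {J : Type v} {A : J → V} {Z Z' : V} {c : ∀ j, A j ⟶ Z} (h : IsCoprod c)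
    (f : Z ⟶ Z') (h' : IsCoprod fun j => c j ≫ f) : IsIso f := by
  obtain ⟨e, he⟩ := h.exists_iso h'
  rw [← h.hom_ext he]
  infer_instance

lemma IsCoprod.of_iso {J : Type v} {A A' : J → V} {Z Z' : V} {c : ∀ j, A j ⟶ Z}
    {c' : ∀ j, A' j ⟶ Z'} (h : IsCoprod c) (e : ∀ j, A j ⟶ A' j) [∀ j, IsIso (e j)]
    (f : Z ⟶ Z') [IsIso f] (w : ∀ j, c j ≫ f = e j ≫ c' j) : IsCoprod c' :=
  of_existsUnique (fun W g => ⟨inv f ≫ h.desc fun j => e j ≫ g j, fun j => by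
      rw [← cancel_epi (e j), ← Category.assoc, ← w, Category.assoc, IsIso.hom_inv_id_assoc,
        h.fac]⟩)
    (fun W g g' H => by
      rw [← cancel_epi f]
      exact h.hom_ext fun j => by
        rw [← Category.assoc, ← Category.assoc, w, Category.assoc, Category.assoc, H])

lemma IsCoprod.isInitial {J : Type v} {A : J → V} {Z : V} {c : ∀ j, A j ⟶ Z} (h : IsCoprod c)
    (hA : ∀ j, Nonempty (IsInitial (A j))) : Nonempty (IsInitial Z) :=
  ⟨IsInitial.ofUniqueHom (fun W => h.desc fun j => (hA j).some.to W)
    (fun _ _ => h.hom_ext fun j => (hA j).some.hom_ext _ _)⟩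

lemma IsCoprod.of_isInitial {A : PEmpty.{v + 1} → V} {Z : V} (c : ∀ j, A j ⟶ Z)
    (h : Nonempty (IsInitial Z)) : IsCoprod c :=
  of_existsUnique (fun W _ => ⟨h.some.to W, fun j => j.elim⟩) (fun _ _ _ _ => h.some.hom_ext _ _)

/-- A functor which preserves coproducts in one variable (the other ones being fixed) sends a
sequence with an initial entry to an initial object. -/
lemma isInitial_seq {n : ℕ} (F : (Fin n → V) ⥤ V)
    (hF : ∀ (i : Fin n) (J : Type v) (A : J → Fin n → V) (Z : Fin n → V) (c : ∀ j, A j ⟶ Z),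
      (∀ j i', i' ≠ i → IsIso (c j i')) → IsCoprod (fun j => c j i) →
        IsCoprod (fun j => F.map (c j)))
    (Z : Fin n → V) (i : Fin n) (h : Nonempty (IsInitial (Z i))) :
    Nonempty (IsInitial (F.obj Z)) :=
  (hF i PEmpty (fun _ => Z) Z (fun j => j.elim) (fun j => j.elim)
    (IsCoprod.of_isInitial _ h)).isInitial (fun j => j.elim)

/-- A functor preserves coproducts. -/
def PreservesCoprods {W : Type u'} [Category.{v} W] (F : V ⥤ W) : Prop :=
  ∀ (J : Type v) (A : J → V) (Z : V) (c : ∀ j, A j ⟶ Z), IsCoprod c → IsCoprod fun j => F.map (c j)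

/-- Finite products preserve coproducts in each variable. -/
def IsDistCat (V : Type u) [Category.{v} V] [HasFiniteProducts V] : Prop :=
  ∀ (n : ℕ) (i : Fin n) (J : Type v) (A : J → Fin n → V) (Z : Fin n → V) (c : ∀ j, A j ⟶ Z),
    (∀ j i', i' ≠ i → IsIso (c j i')) → IsCoprod (fun j => c j i) →
      IsCoprod (fun j => (timesFunctor (𝟭 V) n).map (c j))

lemma times_isDistributive [HasFiniteProducts V] (hV : IsDistCat V) (T : Monad V)
    (hT : PreservesCoprods T.toFunctor) : (times T).IsDistributive :=
  fun n i J _ _ c h h' => hV n i J _ _ (fun j i => T.map (c j i))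
    (fun j i' hi => by have := h j i' hi; infer_instance) (hT J _ _ _ h')

namespace VGraph

/-- The family `c` exhibits the objects of `Z` as a disjoint union, such that the homs of `Z`
are the homs of its parts, respectively initial. -/
structure Decomp {J : Type v} {A : J → VGraph V} {Z : VGraph V} (c : ∀ j, A j ⟶ Z) : Prop where
  bij : Function.Bijective fun x : (j : J) × (A j).Obj => (c x.1).obj x.2
  iso : ∀ j a b, IsIso ((c j).map a b)
  init : ∀ j j' a b, j ≠ j' → Nonempty (IsInitial (Z.hom ((c j).obj a) ((c j').obj b)))

variable {J : Type v} {A : J → VGraph V} {Z : VGraph V} {c : ∀ j, A j ⟶ Z}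

lemma Decomp.inj (h : Decomp c) {j j' : J} {a : (A j).Obj} {a' : (A j').Obj}
    (e : (c j).obj a = (c j').obj a') : (⟨j, a⟩ : (j : J) × (A j).Obj) = ⟨j', a'⟩ :=
  h.bij.1 e

lemma Decomp.isCoprod (h : Decomp c) : IsCoprod c := by
  refine IsCoprod.of_existsUnique (fun W f => ?_) (fun W f g H => ?_)
  · obtain ⟨g₀, hg₀⟩ : ∃ g₀ : Z.Obj → W.Obj, ∀ j a, g₀ ((c j).obj a) = (f j).obj a :=
      ⟨fun z => (f _).obj ((Equiv.ofBijective _ h.bij).symm z).2, fun j a => by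
        have := (Equiv.ofBijective _ h.bij).symm_apply_apply ⟨j, a⟩
        exact congrArg (fun x : (j : J) × (A j).Obj => (f x.1).obj x.2) this⟩
    have key (z z' : Z.Obj) : ∃ m : Z.hom z z' ⟶ W.hom (g₀ z) (g₀ z'),
        ∀ j a b (ha : (c j).obj a = z) (hb : (c j).obj b = z'),
          (c j).map a b ≫ Z.cast ha hb ≫ m =
            (f j).map a b ≫ W.cast (by rw [← ha, hg₀]) (by rw [← hb, hg₀]) := by
      obtain ⟨⟨j, a⟩, rfl⟩ := h.bij.2 z
      obtain ⟨⟨j', b⟩, rfl⟩ := h.bij.2 z'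
      by_cases hj : j = j'
      · subst hj
        have := h.iso j a b
        refine ⟨inv ((c j).map a b) ≫ (f j).map a b ≫ W.cast (hg₀ j a).symm (hg₀ j b).symm,
          fun j' a' b' ha hb => ?_⟩
        obtain ⟨rfl, ha'⟩ := Sigma.mk.inj (h.inj ha)
        obtain rfl := eq_of_heq ha'
        obtain rfl := eq_of_heq (Sigma.mk.inj (h.inj hb)).2
        rw [cast_rfl, Category.id_comp, IsIso.hom_inv_id_assoc]
      · refine ⟨(h.init j j' a b hj).some.to _, fun j'' a' b' ha hb => ?_⟩
        exact absurd ((Sigma.mk.inj (h.inj ha)).1.symm.trans (Sigma.mk.inj (h.inj hb)).1) hj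
    choose m hm using key
    refine ⟨⟨g₀, m⟩, fun j => hom_ext (hg₀ j) fun a b => ?_⟩
    have := hm _ _ j a b rfl rfl
    rw [cast_rfl, Category.id_comp] at this
    refine (congrArg (· ≫ _) this).trans ?_
    rw [Category.assoc, cast_trans, cast_rfl, Category.comp_id]
  · have h0 : f.obj = g.obj := by
      funext z
      obtain ⟨⟨j, a⟩, rfl⟩ := h.bij.2 z
      exact congrFun (congrArg Hom.obj (H j)) a
    refine hom_ext (fun z => congrFun h0 z) fun z z' => ?_
    obtain ⟨⟨j, a⟩, rfl⟩ := h.bij.2 z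
    obtain ⟨⟨j', b⟩, rfl⟩ := h.bij.2 z'
    by_cases hj : j = j'
    · subst hj
      have := h.iso j a b
      rw [← cancel_epi ((c j).map a b)]
      exact (Category.assoc _ _ _).symm.trans (map_congr (H j) a b)
    · exact (h.init j j' a b hj).some.hom_ext _ _

instance isIso_map {X Y : VGraph V} (f : X ⟶ Y) [IsIso f] (a b : X.Obj) : IsIso (f.map a b) := by
  have h1 := map_congr (IsIso.hom_inv_id f) a b
  have h2 (a b : Y.Obj) := map_congr (IsIso.inv_hom_id f) a b
  have h0 (a : X.Obj) : (inv f).obj (f.obj a) = a := congrFun (congrArg Hom.obj (IsIso.hom_inv_id f)) a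
  refine ⟨(inv f).map _ _ ≫ X.cast (h0 a) (h0 b), (Category.assoc _ _ _).symm.trans h1, ?_⟩
  rw [Category.assoc, cast_map, ← Category.assoc]
  exact h2 _ _

lemma bijective_obj {X Y : VGraph V} (f : X ⟶ Y) [IsIso f] : Function.Bijective f.obj :=
  Function.bijective_iff_has_inverse.mpr ⟨(inv f).obj,
    congrFun (congrArg Hom.obj (IsIso.hom_inv_id f)), congrFun (congrArg Hom.obj (IsIso.inv_hom_id f))⟩

lemma Decomp.comp_iso (h : Decomp c) {Z' : VGraph V} (e : Z ⟶ Z') [IsIso e] :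
    Decomp fun j => c j ≫ e where
  bij := (bijective_obj e).comp h.bij
  iso j a b := by
    have := h.iso j a b
    rw [comp_map]
    infer_instance
  init j j' a b hj := ⟨(h.init j j' a b hj).some.ofIso (asIso (e.map _ _))⟩

open Classical in
lemma exists_decomp [HasInitial V] (A : J → VGraph V) :
    ∃ (Z : VGraph V) (c : ∀ j, A j ⟶ Z), Decomp c := by
  let Z : VGraph V := ⟨(j : J) × (A j).Obj, fun x y =>
    if h : x.1 = y.1 then (A y.1).hom (h ▸ x.2) y.2 else ⊥_ V⟩
  have hZ (j : J) (a b : (A j).Obj) : (A j).hom a b = Z.hom ⟨j, a⟩ ⟨j, b⟩ :=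
    Eq.symm (dif_pos (c := j = j) rfl)
  let c (j : J) : A j ⟶ Z := ⟨fun a => ⟨j, a⟩, fun a b => eqToHom (hZ j a b)⟩
  refine ⟨Z, c, Function.bijective_id, fun j a b => inferInstanceAs (IsIso (eqToHom (hZ j a b))),
    fun j j' a b hj => ?_⟩
  have : Z.hom ((c j).obj a) ((c j').obj b) = ⊥_ V := dif_neg hj
  rw [this]
  exact ⟨initialIsInitial⟩

lemma isCoprod_iff_decomp [HasInitial V] : IsCoprod c ↔ Decomp c := by
  refine ⟨fun h => ?_, Decomp.isCoprod⟩
  obtain ⟨Z', c', h'⟩ := exists_decomp A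
  obtain ⟨e, he⟩ := h'.isCoprod.exists_iso h
  rw [show c = fun j => c' j ≫ e.hom from funext fun j => (he j).symm]
  exact h'.comp_iso e.hom

instance [HasInitial V] : HasCoproducts.{v} (VGraph V) := fun J =>
  ⟨fun F => by
    obtain ⟨Z, c, h⟩ := exists_decomp fun j => F.obj ⟨j⟩
    have : HasColimit (Discrete.functor (F.obj ∘ Discrete.mk)) := ⟨⟨⟨_, h.isCoprod.some⟩⟩⟩
    exact hasColimit_of_iso Discrete.natIsoFunctor⟩

section

variable [HasFiniteProducts V] {n : ℕ}

/-- The product of graphs. -/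
noncomputable def prod (F : Fin n → VGraph V) : VGraph V :=
  ⟨∀ i, (F i).Obj, fun a b => (timesFunctor (𝟭 V) n).obj fun i => (F i).hom (a i) (b i)⟩

noncomputable def prodProj (F : Fin n → VGraph V) (i : Fin n) : prod F ⟶ F i :=
  ⟨fun a => a i, fun a b => timesProj (𝟭 V) (fun i => (F i).hom (a i) (b i)) i⟩

lemma prod_hom_ext {F : Fin n → VGraph V} {X : VGraph V} {f g : X ⟶ prod F}
    (h : ∀ i, f ≫ prodProj F i = g ≫ prodProj F i) : f = g := by
  have h0 (a) : f.obj a = g.obj a := funext fun i => congrFun (congrArg Hom.obj (h i)) a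
  refine hom_ext h0 fun a b => times_hom_ext (𝟭 V) fun i => ?_
  refine Eq.trans ?_ (map_congr (h i) a b)
  refine (Category.assoc _ _ _).trans (Eq.trans ?_ (Category.assoc _ _ _).symm)
  exact congrArg (_ ≫ ·) (cast_map (prodProj F i) (h0 a) (h0 b))

noncomputable def prodIsLimit (F : Fin n → VGraph V) : IsLimit (Fan.mk (prod F) (prodProj F)) :=
  Fan.IsLimit.mk _ (fun s => ⟨fun a i => (s.proj i).obj a,
      fun a b => timesLift (𝟭 V) _ fun i => (s.proj i).map a b⟩)
    (fun _ i => hom_ext (fun _ => rfl) fun _ _ => (Category.comp_id _).trans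
      (timesLift_proj (𝟭 V) _ _ i))
    (fun _ _ hm => prod_hom_ext fun i => (hm i).trans (Eq.symm (hom_ext (fun _ => rfl)
      fun _ _ => (Category.comp_id _).trans (timesLift_proj (𝟭 V) _ _ i))))

instance : HasFiniteProducts (VGraph V) := ⟨fun n => ⟨fun F => by
  have : HasLimit (Discrete.functor (F.obj ∘ Discrete.mk)) := ⟨⟨⟨_, prodIsLimit fun j => F.obj ⟨j⟩⟩⟩⟩
  exact hasLimit_of_iso Discrete.natIsoFunctor.symm⟩⟩

/-- The product of morphisms of graphs. -/
noncomputable def prodMap {F G : Fin n → VGraph V} (f : F ⟶ G) : prod F ⟶ prod G :=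
  ⟨fun a i => (f i).obj (a i), fun a b =>
    (timesFunctor (𝟭 V) n).map (X := fun i => (F i).hom (a i) (b i)) fun i => (f i).map (a i) (b i)⟩

lemma isDistCat [HasInitial V] (hV : IsDistCat V) : IsDistCat (VGraph V) := by
  intro n i J A Z c hc hi
  rw [isCoprod_iff_decomp] at hi
  have hiso (j : J) (i' : Fin n) (a b) : IsIso ((c j i').map a b) := by
    by_cases h : i' = i
    · subst h; exact hi.iso j a b
    · have := hc j i' h; infer_instance
  have hinj (j : J) (i' : Fin n) : Function.Injective (c j i').obj := by
    by_cases h : i' = i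
    · subst h
      exact fun a b e => eq_of_heq (Sigma.mk.inj (hi.inj e)).2
    · have := hc j i' h
      exact (bijective_obj (c j i')).1
  have key : Decomp fun j => prodMap (c j) := by
    refine ⟨⟨fun x y e => ?_, fun z => ?_⟩, fun j a b => ?_, fun j j' a b hj => ?_⟩
    · obtain ⟨j, a⟩ := x
      obtain ⟨j', b⟩ := y
      obtain rfl : j = j' := (Sigma.mk.inj (hi.inj (congrFun e i))).1
      rw [show a = b from funext fun i' => hinj j i' (congrFun e i')]
    · obtain ⟨⟨j, a⟩, ha⟩ := hi.bij.2 (z i)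
      have (i' : Fin n) : ∃ a, (c j i').obj a = z i' := by
        by_cases h : i' = i
        · subst h; exact ⟨a, ha⟩
        · have := hc j i' h
          exact (bijective_obj (c j i')).2 _
      choose a ha using this
      exact ⟨⟨j, a⟩, funext ha⟩
    · have := isIso_seq (A := fun i => (A j i).hom (a i) (b i))
        (Z := fun i => (Z i).hom ((c j i).obj (a i)) ((c j i).obj (b i)))
        (fun i' => (c j i').map (a i') (b i')) fun i' => hiso j i' _ _
      exact Functor.map_isIso (timesFunctor (𝟭 V) n) (X := fun i => (A j i).hom (a i) (b i))
        (Y := fun i => (Z i).hom ((c j i).obj (a i)) ((c j i).obj (b i)))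
        fun i' => (c j i').map (a i') (b i')
    · exact isInitial_seq _ (hV n) _ i (hi.init j j' (a i) (b i) hj)
  let e (F : Fin n → VGraph V) : prod F ≅ (timesFunctor (𝟭 (VGraph V)) n).obj F :=
    (prodIsLimit F).conePointUniqueUpToIso (limit.isLimit (Discrete.functor F))
  have he (F : Fin n → VGraph V) (i : Fin n) :
      (e F).hom ≫ timesProj (𝟭 (VGraph V)) F i = prodProj F i :=
    (prodIsLimit F).conePointUniqueUpToIso_hom_comp (limit.isLimit (Discrete.functor F)) ⟨i⟩
  refine key.isCoprod.of_iso (fun j => (e (A j)).hom) (e Z).hom fun j => ?_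
  refine times_hom_ext _ fun i' => ?_
  rw [Category.assoc, Category.assoc, timesMap_proj, he, ← Category.assoc, he]
  exact hom_ext (fun _ => rfl) fun a b => (Category.comp_id _).trans
    (timesMap_proj (𝟭 V) (Z := fun i => (A j i).hom (a i) (b i)) (fun i => (c j i).map (a i) (b i)) i')

end

lemma gamma_preserves [HasCoproducts.{v} V] [HasInitial V] (E : Multitensor V)
    (hE : E.IsDistributive) : PreservesCoprods E.gammaFunctor := by
  intro J A Z c hc
  rw [isCoprod_iff_decomp] at hc ⊢
  have hinj (j : J) : Function.Injective (c j).obj :=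
    fun a b e => eq_of_heq (Sigma.mk.inj (hc.inj e)).2
  have comp : ∃ p : Z.Obj → J, ∀ j a, p ((c j).obj a) = j :=
    ⟨fun z => ((Equiv.ofBijective _ hc.bij).symm z).1, fun j a =>
      congrArg Sigma.fst ((Equiv.ofBijective _ hc.bij).symm_apply_apply ⟨j, a⟩)⟩
  obtain ⟨p, hp⟩ := comp
  have dich (x : ObjSeq Z.Obj) : (∀ l, p (x.pt l) = p (x.pt 0)) ∨
      Nonempty (IsInitial ((E.ten x.len).obj (Z.homs x))) := by
    by_cases h : ∀ i : Fin x.len, p (x.pt i.castSucc) = p (x.pt i.succ)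
    · refine Or.inl fun l => Fin.induction rfl (fun i hi => (h i).symm.trans hi) l
    · push Not at h
      obtain ⟨i, hi⟩ := h
      refine Or.inr (isInitial_seq _ (hE _) _ i ?_)
      unfold homs
      obtain ⟨⟨j, a⟩, ha⟩ := hc.bij.2 (x.pt i.castSucc)
      obtain ⟨⟨j', b⟩, hb⟩ := hc.bij.2 (x.pt i.succ)
      rw [← ha, ← hb] at hi ⊢
      exact hc.init j j' a b (by rwa [hp, hp] at hi)
  refine ⟨hc.bij, fun j (a b : (A j).Obj) => ?_, fun j j' a b hj => ?_⟩
  · change IsIso ((E.gammaMor (c j)).map a b)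
    refine (E.isCoprod_incl (A j) a b).isIso _ ?_
    have hiso (x : SeqFrom a b) : IsIso ((E.ten x.1.len).map (homsMap (c j) x.1)) := by
      have := isIso_seq (homsMap (c j) x.1) fun i => hc.iso j _ _
      exact Functor.map_isIso (E.ten x.1.len) (homsMap (c j) x.1)
    have hmap (x y : SeqFrom a b) (e : x.map (c j).obj = y.map (c j).obj) : x = y := by
      obtain ⟨⟨n, x⟩, hx⟩ := x
      obtain ⟨⟨m, y⟩, hy⟩ := y
      obtain ⟨rfl, h⟩ := ObjSeq.mk.inj (Subtype.mk.inj e)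
      have : x = y := funext fun l => hinj j (congrFun (eq_of_heq h) l)
      subst this
      rfl
    have dich' (y : SeqFrom ((c j).obj a) ((c j).obj b)) : (∃ x : SeqFrom a b, x.map (c j).obj = y) ∨
        Nonempty (IsInitial ((E.ten y.1.len).obj (Z.homs y.1))) := by
      refine (dich y.1).imp_left fun h => ?_
      have (l : Fin (y.1.len + 1)) : ∃ a', (c j).obj a' = y.1.pt l := by
        obtain ⟨⟨j', a'⟩, ha'⟩ := hc.bij.2 (y.1.pt l)
        have := h l
        rw [y.2.1, hp, ← ha'] at this
        obtain rfl := (hp j' a').symm.trans this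
        exact ⟨a', ha'⟩
      choose q hq using this
      refine ⟨⟨⟨y.1.len, q⟩, hinj j ((hq _).trans y.2.1), hinj j ((hq _).trans y.2.2)⟩, ?_⟩
      exact Subtype.ext (congrArg (ObjSeq.mk _) (funext hq))
    refine IsCoprod.of_existsUnique (fun W f => ?_) (fun W f g H => ?_)
    · have key (y : SeqFrom ((c j).obj a) ((c j).obj b)) :
          ∃ m : (E.ten y.1.len).obj (Z.homs y.1) ⟶ W, ∀ (x : SeqFrom a b)
            (e : x.map (c j).obj = y), (E.ten x.1.len).map (homsMap (c j) x.1) ≫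
              eqToHom (congrArg (fun y : SeqFrom _ _ => (E.ten y.1.len).obj (Z.homs y.1)) e) ≫ m =
                f x := by
        by_cases h : ∃ x : SeqFrom a b, x.map (c j).obj = y
        · obtain ⟨x, rfl⟩ := h
          obtain ⟨i, hi, _⟩ := hiso x
          refine ⟨i ≫ f x, fun x' e => ?_⟩
          obtain rfl := hmap _ _ e
          refine (congrArg (_ ≫ ·) (Category.id_comp _)).trans ?_
          exact (Category.assoc _ _ _).symm.trans ((congrArg (· ≫ _) hi).trans (Category.id_comp _))
        · exact ⟨((dich' y).resolve_left h).some.to W, fun x e => absurd ⟨x, e⟩ h⟩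
      choose m hm using key
      refine ⟨(E.isCoprod_incl Z _ _).desc m, fun x => ?_⟩
      refine (congrArg (· ≫ _) (E.incl_map (c j) x)).trans ((Category.assoc _ _ _).trans ?_)
      refine (congrArg ((E.ten x.1.len).map (homsMap (c j) x.1) ≫ ·)
        ((E.isCoprod_incl Z _ _).fac m (x.map (c j).obj))).trans ?_
      exact (congrArg (_ ≫ ·) (Category.id_comp _).symm).trans (hm _ x rfl)
    · refine (E.isCoprod_incl Z _ _).hom_ext fun y => ?_
      rcases dich' y with ⟨x, rfl⟩ | h
      · have := hiso x
        refine (cancel_epi ((E.ten x.1.len).map (homsMap (c j) x.1))).mp ?_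
        have h1 (f : (E.gammaObj Z).hom ((c j).obj a) ((c j).obj b) ⟶ W) :=
          (congrArg (· ≫ f) (E.incl_map (c j) x)).trans (Category.assoc _ _ _)
        exact (h1 f).symm.trans ((H x).trans (h1 g))
      · exact h.some.hom_ext _ _
  · refine (E.isCoprod_incl Z _ _).isInitial fun x => ((dich x.1).resolve_left fun h => hj ?_)
    have := h (Fin.last _)
    rw [x.2.1, x.2.2] at this
    exact ((hp j' b).symm.trans (this.trans (hp j a))).symm

end VGraph

end

/-! ### The strict `n`-category monads -/

section

lemma isCoprod_type_of_bijective {J : Type v} {A : J → Type v} {Z : Type v} {c : ∀ j, A j ⟶ Z}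
    (h : Function.Bijective fun x : (j : J) × A j => c x.1 x.2) : IsCoprod c := by
  refine IsCoprod.of_existsUnique (fun W f => ⟨↾fun z => f _ ((Equiv.ofBijective _ h).symm z).2,
    fun j => ?_⟩) (fun W f g H => ?_)
  · ext a
    exact congrArg (fun x : (j : J) × A j => f x.1 x.2)
      ((Equiv.ofBijective _ h).symm_apply_apply ⟨j, a⟩)
  · ext z
    obtain ⟨⟨j, a⟩, rfl⟩ := h.2 z
    exact ConcreteCategory.congr_hom (H j) a

lemma isCoprod_type_iff {J : Type v} {A : J → Type v} {Z : Type v} {c : ∀ j, A j ⟶ Z} :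
    IsCoprod c ↔ Function.Bijective fun x : (j : J) × A j => c x.1 x.2 := by
  refine ⟨fun h => ?_, isCoprod_type_of_bijective⟩
  have h' : IsCoprod (Z := (j : J) × A j) fun j => ↾fun a : A j => (⟨j, a⟩ : (j : J) × A j) :=
    isCoprod_type_of_bijective Function.bijective_id
  obtain ⟨e, he⟩ := h'.exists_iso h
  have := (isIso_iff_bijective e.hom).mp inferInstance
  convert this using 2 with x
  rw [← he]
  rfl

lemma isDistCat_type : IsDistCat (Type v) := by
  intro n i J A Z c hc hi
  rw [isCoprod_type_iff] at hi
  have hinj (j : J) (i' : Fin n) : Function.Injective (c j i') := by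
    by_cases h : i' = i
    · subst h
      exact fun a b e => eq_of_heq (Sigma.mk.inj (hi.1 (a₁ := ⟨j, a⟩) (a₂ := ⟨j, b⟩) e)).2
    · exact ((isIso_iff_bijective (c j i')).mp (hc j i' h)).1
  let p (F : Fin n → Type v) : (timesFunctor (𝟭 (Type v)) n).obj F ≅ ∀ i, F i := Types.productIso F
  have hp (F : Fin n → Type v) (i : Fin n) :
      (p F).hom ≫ (↾fun f : ∀ i, F i => f i) = timesProj (𝟭 (Type v)) F i :=
    Types.productIso_hom_comp_eval F i
  let m (j : J) : (∀ i, A j i) ⟶ ∀ i, Z i := ↾fun a i => c j i (a i)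
  have key : IsCoprod m := by
    rw [isCoprod_type_iff]
    refine ⟨fun x y e => ?_, fun z => ?_⟩
    · obtain ⟨j, a⟩ := x
      obtain ⟨j', b⟩ := y
      obtain rfl : j = j' :=
        (Sigma.mk.inj (hi.1 (a₁ := ⟨j, a i⟩) (a₂ := ⟨j', b i⟩) (congrFun e i))).1
      rw [show a = b from funext fun i' => hinj j i' (congrFun e i')]
    · obtain ⟨⟨j, a⟩, ha⟩ := hi.2 (z i)
      have (i' : Fin n) : ∃ a, c j i' a = z i' := by
        by_cases h : i' = i
        · subst h; exact ⟨a, ha⟩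
        · exact ((isIso_iff_bijective (c j i')).mp (hc j i' h)).2 _
      choose a ha using this
      exact ⟨⟨j, a⟩, funext ha⟩
  refine key.of_iso (fun j => (p (A j)).inv) (p Z).inv fun j => ?_
  rw [Iso.comp_inv_eq, Category.assoc, Iso.eq_inv_comp]
  ext a i
  have h1 := ConcreteCategory.congr_hom (hp (A j) i) a
  have h2 := ConcreteCategory.congr_hom (hp Z i) ((timesFunctor (𝟭 (Type v)) n).map (c j) a)
  have h3 := ConcreteCategory.congr_hom (timesMap_proj (𝟭 (Type v)) (c j) i) a
  exact (congrArg (c j i) h1).trans (h3.symm.trans h2.symm)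

instance {V : Type u} [Category.{v} V] [HasCoproducts.{v} V] : HasInitial V :=
  hasColimitsOfShape_of_equivalence (Discrete.equivalence (Equiv.equivPEmpty PEmpty.{1}).symm).symm

/-- A coproduct preserving monad `T` on a category with coproducts and finite products, the
finite products preserving coproducts in each variable. -/
structure Stage : Type (v + 2) where
  C : Type (v + 1)
  cat : Category.{v} C
  coproducts : HasCoproducts.{v} C
  products : HasFiniteProducts C
  dist : IsDistCat C
  T : Monad C
  preserves : PreservesCoprods T.toFunctor

attribute [instance] Stage.cat Stage.coproducts Stage.products

/-- The identity monad on the category of sets. -/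
def Stage.zero : Stage.{v} where
  C := Type v
  cat := inferInstance
  coproducts := inferInstance
  products := inferInstance
  dist := isDistCat_type
  T := Monad.id (Type v)
  preserves := fun _ _ _ _ h => h

/-- The monad `ΓT^×` on `𝒢C`, for a monad `T` on `C`. -/
noncomputable def Stage.next (S : Stage.{v}) : Stage.{v} where
  C := VGraph S.C
  cat := inferInstance
  coproducts := inferInstance
  products := inferInstance
  dist := VGraph.isDistCat S.dist
  T := (times S.T).gamma (times_isDistributive S.dist S.T S.preserves)
  preserves := VGraph.gamma_preserves _ (times_isDistributive S.dist S.T S.preserves)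

/-- The inductively defined sequence of monads `𝒯_{≤n}` on `𝒢ⁿSet`. -/
noncomputable def stage : ℕ → Stage.{v}
  | 0 => Stage.zero
  | n + 1 => (stage n).next

/-- The category `𝒢ⁿSet` of `n`-globular sets. -/
abbrev NGlob (n : ℕ) : Type (v + 1) := (stage.{v} n).C

/-- The monad `𝒯_{≤n}` on `𝒢ⁿSet`, whose algebras are the strict `n`-categories. -/
noncomputable abbrev strictMonad (n : ℕ) : Monad (NGlob.{v} n) := (stage.{v} n).T

end

/-! ### Trivial fibrations, extensive categories, connected objects -/

section

/-- A natural transformation is a trivial `I`-fibration when its components are, i.e. when they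
have the right lifting property with respect to all the maps in `I`. -/
def IsTrivialFibration {C : Type*} [Category* C] {D : Type*} [Category* D]
    (I : MorphismProperty D) {F G : C ⥤ D} (φ : F ⟶ G) : Prop :=
  ∀ X, I.rlp (φ.app X)

variable {V : Type u} [Category.{v} V]

namespace VGraph

/-- The empty graph. -/
def empty (V : Type u) [Category.{v} V] : VGraph V := ⟨PEmpty, fun a _ => a.elim⟩

variable [HasInitial V]

/-- The graph `0`, with one object whose only hom is initial. -/
noncomputable def point (V : Type u) [Category.{v} V] [HasInitial V] : VGraph V :=
  ⟨PUnit, fun _ _ => ⊥_ V⟩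

def emptyTo (X : VGraph V) : empty V ⟶ X := ⟨fun a => a.elim, fun a _ => a.elim⟩

/-- The homs of the graph `(S)`. -/
noncomputable def suspHom (S : V) : Bool → Bool → V
  | false, true => S
  | _, _ => ⊥_ V

noncomputable def suspHomMap {S B : V} (i : S ⟶ B) : ∀ a b, suspHom S a b ⟶ suspHom B a b
  | false, true => i
  | false, false => 𝟙 _
  | true, false => 𝟙 _
  | true, true => 𝟙 _

/-- The graph `(S)` with two objects, `S` as hom from the first to the second one and all other
homs initial. -/
noncomputable def susp (S : V) : VGraph V := ⟨ULift Bool, fun a b => suspHom S a.down b.down⟩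

/-- The map `(i) : (S) ⟶ (B)`. -/
noncomputable def suspMap {S B : V} (i : S ⟶ B) : susp S ⟶ susp B :=
  ⟨id, fun a b => suspHomMap i a.down b.down⟩

/-- The class `I⁺` of maps of graphs, consisting of `∅ ⟶ 0` and of `(i) : (S) ⟶ (B)` for `i ∈ I`. -/
inductive plus (I : MorphismProperty V) : MorphismProperty (VGraph V)
  | point : plus I (emptyTo (point V))
  | susp {S B : V} (i : S ⟶ B) (hi : I i) : plus I (suspMap i)

end VGraph

/-- The class `I_{≤0}` of maps of sets, consisting of `∅ ⟶ 1` and `1 + 1 ⟶ 1`. -/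
inductive setGen : MorphismProperty (Type v)
  | point : setGen (↾fun a : PEmpty => (a.elim : PUnit))
  | fold : setGen (↾fun _ : PUnit.{v + 1} ⊕ PUnit.{v + 1} => PUnit.unit.{v + 1})

/-- The classes `I_{≤n}` of maps of `n`-globular sets. -/
noncomputable def genLE : ∀ n : ℕ, MorphismProperty (NGlob.{v} n)
  | 0 => setGen
  | n + 1 => VGraph.plus (genLE n)

/-- The functor which sends a family of morphisms `f_j : Y_j ⟶ X_j` to `∐ f_j : ∐ Y_j ⟶ ∐ X_j`. -/
noncomputable def coprodOver [HasCoproducts.{v} V] {J : Type v} (X : J → V) :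
    (∀ j, Over (X j)) ⥤ Over (∐ X) where
  obj f := Over.mk (Limits.Sigma.map fun j => (f j).hom)
  map g := Over.homMk (Limits.Sigma.map fun j => (g j).left)
  map_id f := by
    ext
    simp
  map_comp f g := by
    ext
    refine Limits.Sigma.hom_ext _ _ fun j => ?_
    simp

/-- A category with coproducts is extensive when the functors `∏ V/X_j ⥤ V/∐X_j` given by
coproducts are equivalences for all families of objects. -/
def IsExtensive (V : Type u) [Category.{v} V] [HasCoproducts.{v} V] : Prop :=
  ∀ (J : Type v) (X : J → V), (coprodOver X).IsEquivalence

/-- An object `B` is connected when the functor `V(B, -)` preserves coproducts. -/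
def IsConnectedObj (B : V) : Prop := PreservesCoprods (coyoneda.obj (Opposite.op B))

/-- A morphism of monads `α : A ⟶ T` on `𝒢V` is a `T`-operad over `Set`: it is a cartesian
transformation, and its components are bijective on objects. -/
structure IsOperadOverSet {T A : Monad (VGraph V)} (α : A ⟶ T) : Prop where
  cartesian : NatTrans.Equifibered α.toNatTrans
  bijective : ∀ X : VGraph V, Function.Bijective (α.app X).obj

/-- The `ΓF`-operad `α : A ⟶ ΓF` corresponds to the `F`-multitensor `ε : E ⟶ F`: up to an
isomorphism of monads, `α` is `Γε : ΓE ⟶ ΓF`. -/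
def Corresponds [HasCoproducts.{v} V] {E F : Multitensor V} {hF : F.IsDistributive}
    {A : Monad (VGraph V)} (α : A ⟶ F.gamma hF) (ε : Multitensor.Hom E F) : Prop :=
  ∃ (hE : E.IsDistributive) (θ : E.gamma hE ≅ A),
    ∀ X, θ.hom.app X ≫ α.app X = ε.gammaMap.app X

end

/-! ### Globular sets and strict `ω`-categories -/

/-- The category `𝔾` of globes. Its objects are the natural numbers. -/
@[ext] structure Globe where
  dim : ℕ

namespace Globe

/-- Besides the identities there are two morphisms `k ⟶ n` for each `k < n`, the cosource
(`some false`) and the cotarget (`some true`); the identities are represented by `none`. -/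
def Hom (k n : Globe) : Type :=
  {o : Option Bool // (o = none ∧ k = n) ∨ (o ≠ none ∧ k.dim < n.dim)}

lemma hom_comp_aux {k m n : Globe} (f : Hom k m) (g : Hom m n) :
    (f.1.or g.1 = none ∧ k = n) ∨ (f.1.or g.1 ≠ none ∧ k.dim < n.dim) := by
  obtain ⟨f, ⟨rfl, rfl⟩ | ⟨hf, hf'⟩⟩ := f
  · simpa using g.2
  · obtain ⟨b, rfl⟩ := Option.ne_none_iff_exists'.mp hf
    refine Or.inr ⟨by simp, lt_of_lt_of_le hf' ?_⟩
    rcases g.2 with ⟨_, h⟩ | ⟨_, h⟩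
    · exact le_of_eq (by rw [h])
    · exact h.le

instance : SmallCategory Globe where
  Hom := Hom
  id n := ⟨none, Or.inl ⟨rfl, rfl⟩⟩
  comp f g := ⟨f.1.or g.1, hom_comp_aux f g⟩
  id_comp f := Subtype.ext (by simp)
  comp_id f := Subtype.ext (by simp)
  assoc f g h := Subtype.ext (by simp [Option.or_assoc])

/-- The cosource (`b = false`) and the cotarget (`b = true`). -/
def face (b : Bool) {k n : Globe} (h : k.dim < n.dim) : k ⟶ n :=
  ⟨some b, Or.inr ⟨by simp, h⟩⟩

lemma face_face (b b' : Bool) {k m n : Globe} (h : k.dim < m.dim) (h' : m.dim < n.dim) :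
    face b h ≫ face b' h' = face b (h.trans h') := rfl

lemma hom_cases {k n : Globe} (f : k ⟶ n) :
    (∃ e : k = n, f = eqToHom e) ∨ ∃ (b : Bool) (h : k.dim < n.dim), f = face b h := by
  obtain ⟨o, ⟨rfl, rfl⟩ | ⟨h, h'⟩⟩ := f
  · exact Or.inl ⟨rfl, rfl⟩
  · obtain ⟨b, rfl⟩ := Option.ne_none_iff_exists'.mp h
    exact Or.inr ⟨b, h', rfl⟩

end Globe

/-- The category of globular sets. -/
abbrev Glob : Type (v + 1) := Globeᵒᵖ ⥤ Type v

namespace Glob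

/-- The set of `n`-cells. -/
abbrev cell (X : Glob.{v}) (n : Globe) : Type v := X.obj (Opposite.op n)

/-- The `k`-dimensional source (`b = false`) and target (`b = true`) of an `n`-cell. -/
def bd {X : Glob.{v}} (b : Bool) {k n : Globe} (h : k.dim < n.dim) (x : X.cell n) : X.cell k :=
  X.map (Globe.face b h).op x

lemma bd_bd {X : Glob.{v}} (b b' : Bool) {k m n : Globe} (h : k.dim < m.dim) (h' : m.dim < n.dim)
    (x : X.cell n) : bd b h (bd b' h' x) = bd b (h.trans h') x := by
  unfold bd
  rw [← Globe.face_face b b' h h', op_comp, X.map_comp]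
  rfl

lemma app_bd {X Y : Glob.{v}} (f : X ⟶ Y) (b : Bool) {k n : Globe} (h : k.dim < n.dim)
    (x : X.cell n) : f.app _ (bd b h x) = bd b h (f.app _ x) :=
  ConcreteCategory.congr_hom (f.naturality (Globe.face b h).op) x

end Glob

open Glob in
/-- The structure of a strict `ω`-category on a globular set. -/
structure OmegaStr (X : Glob.{v}) where
  /-- the identity `n`-cell of a `k`-cell -/
  idn {k n : Globe} (h : k.dim < n.dim) : X.cell k → X.cell n
  /-- the composite of `n`-cells along a common boundary `k`-cell -/
  comp {k n : Globe} (h : k.dim < n.dim) (x y : X.cell n) (e : bd true h x = bd false h y) : X.cell n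
  bd_idn (b) {k n : Globe} (h : k.dim < n.dim) (x) : bd b h (idn h x) = x
  idn_idn {k m n : Globe} (h : k.dim < m.dim) (h' : m.dim < n.dim) (x) :
    idn h' (idn h x) = idn (h.trans h') x
  src_comp {k n : Globe} (h : k.dim < n.dim) (x y e) : bd false h (comp h x y e) = bd false h x
  tgt_comp {k n : Globe} (h : k.dim < n.dim) (x y e) : bd true h (comp h x y e) = bd true h y
  bd_comp (b) {k m n : Globe} (h : k.dim < m.dim) (h' : m.dim < n.dim) (x y e e') :
    bd b h' (comp (h.trans h') x y e) = comp h (bd b h' x) (bd b h' y) e'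
  id_comp {k n : Globe} (h : k.dim < n.dim) (x e) : comp h (idn h (bd false h x)) x e = x
  comp_id {k n : Globe} (h : k.dim < n.dim) (x e) : comp h x (idn h (bd true h x)) e = x
  assoc {k n : Globe} (h : k.dim < n.dim) (x y z e e₁ e₂ e₃) :
    comp h (comp h x y e) z e₁ = comp h x (comp h y z e₂) e₃
  interchange {k m n : Globe} (h : k.dim < m.dim) (h' : m.dim < n.dim)
    (x y x' y' e₁ e₂ e₃ e₄ e₅ e₆) :
    comp (h.trans h') (comp h' x y e₁) (comp h' x' y' e₂) e₃ =
      comp h' (comp (h.trans h') x x' e₄) (comp (h.trans h') y y' e₅) e₆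
  idn_comp {k m n : Globe} (h : k.dim < m.dim) (h' : m.dim < n.dim) (x y e e') :
    idn h' (comp h x y e) = comp (h.trans h') (idn h' x) (idn h' y) e'

/-- A strict `ω`-category. -/
structure OmegaCat : Type (v + 1) where
  X : Glob.{v}
  str : OmegaStr X

namespace OmegaCat

open Glob

/-- A strict `ω`-functor. -/
structure Hom (C D : OmegaCat.{v}) : Type v where
  map : C.X ⟶ D.X
  map_idn {k n : Globe} (h : k.dim < n.dim) (x) :
    map.app _ (C.str.idn h x) = D.str.idn h (map.app _ x)
  map_comp {k n : Globe} (h : k.dim < n.dim) (x y e e') :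
    map.app _ (C.str.comp h x y e) = D.str.comp h (map.app _ x) (map.app _ y) e'

@[ext] lemma Hom.ext {C D : OmegaCat.{v}} {f g : Hom C D} (h : f.map = g.map) : f = g := by
  cases f; cases g; cases h; rfl

instance : Category.{v} OmegaCat.{v} where
  Hom := Hom
  id C := ⟨𝟙 _, fun _ _ => rfl, fun _ _ _ _ _ => rfl⟩
  comp f g := ⟨f.map ≫ g.map,
    fun h x => (congrArg (g.map.app _) (f.map_idn h x)).trans (g.map_idn h _),
    fun h x y e e' => by
      have e'' := (app_bd f.map true h x).symm.trans
        ((congrArg (f.map.app _) e).trans (app_bd f.map false h y))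
      exact (congrArg (g.map.app _) (f.map_comp h x y e e'')).trans (g.map_comp h _ _ e'' e')⟩

/-- The underlying globular set of a strict `ω`-category. -/
def forget : OmegaCat.{v} ⥤ Glob.{v} where
  obj C := C.X
  map f := f.map

/-! The free strict `ω`-category on a globular set `X` consists of the families of cells, indexed by
all morphisms from `X` to strict `ω`-categories, which are generated by the cells of `X`. -/

variable (X : Glob.{v})

/-- The morphisms from `X` to strict `ω`-categories. -/
abbrev Idx : Type (v + 1) := (C : OmegaCat.{v}) × (X ⟶ C.X)

abbrev Fam (n : Globe) : Type (v + 1) := ∀ i : Idx X, i.1.X.cell n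

variable {X}

/-- The families generated by the cells of `X`. -/
inductive Gen : ∀ {n : Globe}, Fam X n → Prop
  | cell {n : Globe} (x : X.cell n) : Gen fun i => i.2.app _ x
  | idn {k n : Globe} (h : k.dim < n.dim) (p : Fam X k) (hp : Gen p) :
      Gen fun i => i.1.str.idn h (p i)
  | comp {k n : Globe} (h : k.dim < n.dim) (p q : Fam X n)
      (e : ∀ i, bd true h (p i) = bd false h (q i)) (hp : Gen p) (hq : Gen q) :
      Gen fun i => i.1.str.comp h (p i) (q i) (e i)

lemma Gen.bd {n : Globe} {p : Fam X n} (hp : Gen p) (b : Bool) {m : Globe} (h : m.dim < n.dim) :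
    Gen fun i => bd b h (p i) := by
  induction hp with
  | cell x =>
    have := Gen.cell (Glob.bd b h x)
    simpa only [app_bd] using this
  | @idn k n h' p hp ih =>
    rcases lt_trichotomy m.dim k.dim with hm | hm | hm
    · have : (fun i : Idx X => Glob.bd b h (i.1.str.idn h' (p i))) = fun i => Glob.bd b hm (p i) := by
        funext i
        rw [← bd_bd b b hm h', i.1.str.bd_idn]
      rw [this]
      exact ih hm
    · obtain rfl : m = k := Globe.ext hm
      simpa only [OmegaStr.bd_idn] using hp
    · have : (fun i : Idx X => Glob.bd b h (i.1.str.idn h' (p i))) = fun i => i.1.str.idn hm (p i) := by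
        funext i
        rw [← i.1.str.idn_idn hm h, i.1.str.bd_idn]
      rw [this]
      exact Gen.idn hm p hp
  | @comp k n h' p q e hp hq ihp ihq =>
    rcases lt_trichotomy m.dim k.dim with hm | hm | hm
    · have : (fun i : Idx X => Glob.bd b h (i.1.str.comp h' (p i) (q i) (e i))) =
          fun i => Glob.bd b h (p i) := by
        funext i
        rw [← bd_bd b false hm h', i.1.str.src_comp, bd_bd]
      rw [this]
      exact ihp h
    · obtain rfl : m = k := Globe.ext hm
      cases b
      · simpa only [OmegaStr.src_comp] using ihp h
      · simpa only [OmegaStr.tgt_comp] using ihq h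
    · have e' (i : Idx X) : Glob.bd true hm (Glob.bd b h (p i)) =
          Glob.bd false hm (Glob.bd b h (q i)) := by
        rw [bd_bd, bd_bd]
        exact e i
      have : (fun i : Idx X => Glob.bd b h (i.1.str.comp h' (p i) (q i) (e i))) =
          fun i => i.1.str.comp hm (Glob.bd b h (p i)) (Glob.bd b h (q i)) (e' i) := by
        funext i
        exact i.1.str.bd_comp b hm h _ _ _ _
      rw [this]
      exact Gen.comp hm _ _ e' (ihp h) (ihq h)

lemma Gen.map {n : Globe} {p : Fam X n} (hp : Gen p) {m : Globe} (f : m ⟶ n) :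
    Gen (n := m) fun i => i.1.X.map f.op (p i) := by
  rcases Globe.hom_cases f with ⟨rfl, rfl⟩ | ⟨b, h, rfl⟩
  · have : (fun i : Idx X => i.1.X.map (eqToHom (Eq.refl m)).op (p i)) = p := by
      funext i
      exact ConcreteCategory.congr_hom (i.1.X.map_id _) (p i)
    rwa [this]
  · exact hp.bd b h

variable (X) in
/-- Formal composites of cells of `X`. -/
inductive Raw : Globe → Type v
  | cell {n : Globe} (x : X.cell n) : Raw n
  | idn {k n : Globe} (h : k.dim < n.dim) (r : Raw k) : Raw n
  | comp {k n : Globe} (h : k.dim < n.dim) (r r' : Raw n) : Raw n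

open Classical in
noncomputable def Raw.eval : ∀ {n : Globe}, Raw X n → Fam X n
  | _, cell x => fun i => i.2.app _ x
  | _, idn h r => fun i => i.1.str.idn h (r.eval i)
  | _, comp h r r' =>
    if e : ∀ i, bd true h (r.eval i) = bd false h (r'.eval i) then
      fun i => i.1.str.comp h (r.eval i) (r'.eval i) (e i)
    else r.eval

lemma Gen.exists_raw {n : Globe} {p : Fam X n} (hp : Gen p) : ∃ r : Raw X n, r.eval = p := by
  induction hp with
  | cell x => exact ⟨.cell x, rfl⟩
  | idn h p hp ih =>
    obtain ⟨r, rfl⟩ := ih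
    exact ⟨.idn h r, rfl⟩
  | comp h p q e hp hq ihp ihq =>
    obtain ⟨r, rfl⟩ := ihp
    obtain ⟨r', rfl⟩ := ihq
    exact ⟨.comp h r r', dif_pos e⟩

instance (n : Globe) : Small.{v} {p : Fam X n // Gen p} :=
  small_of_injective (β := Raw X n) (f := fun p => p.2.exists_raw.choose) fun p q e =>
    Subtype.ext (p.2.exists_raw.choose_spec.symm.trans
      ((congrArg Raw.eval e).trans q.2.exists_raw.choose_spec))

variable (X) in
/-- The underlying globular set of the free strict `ω`-category on `X`. -/
noncomputable def freeGlob : Glob.{v} where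
  obj n := Shrink.{v} {p : Fam X n.unop // Gen p}
  map f := ↾fun x => equivShrink _ ⟨fun i => i.1.X.map f (((equivShrink _).symm x).1 i),
    ((equivShrink _).symm x).2.map f.unop⟩
  map_id n := by
    ext x
    simp
  map_comp f g := by
    ext x
    simp

noncomputable def val {n : Globe} (x : (freeGlob X).cell n) : Fam X n :=
  ((equivShrink {p : Fam X n // Gen p}).symm x).1

noncomputable def ofFam {n : Globe} (p : Fam X n) (hp : Gen p) : (freeGlob X).cell n :=
  equivShrink {p : Fam X n // Gen p} ⟨p, hp⟩

lemma val_ofFam {n : Globe} (p : Fam X n) (hp : Gen p) : val (ofFam p hp) = p := by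
  simp [val, ofFam]

lemma gen_val {n : Globe} (x : (freeGlob X).cell n) : Gen (val x) :=
  ((equivShrink {p : Fam X n // Gen p}).symm x).2

lemma val_inj {n : Globe} {x y : (freeGlob X).cell n} (h : ∀ i, val x i = val y i) : x = y :=
  (equivShrink {p : Fam X n // Gen p}).symm.injective (Subtype.ext (funext h))

lemma val_bd (b : Bool) {k n : Globe} (h : k.dim < n.dim) (x : (freeGlob X).cell n) (i : Idx X) :
    val (bd b h x) i = bd b h (val x i) :=
  congrFun (val_ofFam _ _) i

lemma val_match {k n : Globe} {h : k.dim < n.dim} {x y : (freeGlob X).cell n}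
    (e : bd true h x = bd false h y) (i : Idx X) : bd true h (val x i) = bd false h (val y i) := by
  rw [← val_bd, e, val_bd]

variable (X) in
/-- The free strict `ω`-category on `X`. -/
noncomputable def free : OmegaCat.{v} where
  X := freeGlob X
  str :=
    { idn := fun h x => ofFam (fun i => i.1.str.idn h (val x i)) (Gen.idn h _ (gen_val x))
      comp := fun h x y e => ofFam (fun i => i.1.str.comp h (val x i) (val y i) (val_match e i))
        (Gen.comp h _ _ _ (gen_val x) (gen_val y))
      bd_idn := fun b _ _ h x => val_inj fun i => by
        simp only [val_bd, val_ofFam, OmegaStr.bd_idn]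
      idn_idn := fun h h' x => val_inj fun i => by
        simp only [val_ofFam, OmegaStr.idn_idn]
      src_comp := fun h x y e => val_inj fun i => by
        simp only [val_bd, val_ofFam, OmegaStr.src_comp]
      tgt_comp := fun h x y e => val_inj fun i => by
        simp only [val_bd, val_ofFam, OmegaStr.tgt_comp]
      bd_comp := fun b _ _ _ h h' x y e e' => val_inj fun i => by
        simp only [val_bd, val_ofFam]
        exact i.1.str.bd_comp b h h' _ _ _ _
      id_comp := fun h x e => val_inj fun i => by
        simp only [val_bd, val_ofFam, OmegaStr.id_comp]
      comp_id := fun h x e => val_inj fun i => by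
        simp only [val_bd, val_ofFam, OmegaStr.comp_id]
      assoc := fun h x y z e e₁ e₂ e₃ => val_inj fun i => by
        simp only [val_ofFam]
        exact i.1.str.assoc h _ _ _ _ _ _ _
      interchange := fun h h' x y x' y' e₁ e₂ e₃ e₄ e₅ e₆ => val_inj fun i => by
        simp only [val_ofFam]
        exact i.1.str.interchange h h' _ _ _ _ _ _ _ _ _ _
      idn_comp := fun h h' x y e e' => val_inj fun i => by
        simp only [val_ofFam]
        exact i.1.str.idn_comp h h' _ _ _ _ }

lemma val_map {m n : Globe} (f : m ⟶ n) (x : (freeGlob X).cell n) (i : Idx X) :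
    val (n := m) ((freeGlob X).map f.op x) i = i.1.X.map f.op (val x i) :=
  congrFun (val_ofFam (n := m) (fun i => i.1.X.map f.op (val x i)) ((gen_val x).map f)) i

/-- The inclusion of generators. -/
noncomputable def unit (X : Glob.{v}) : X ⟶ (free X).X where
  app n := ↾fun x => ofFam (n := n.unop) (fun i => i.2.app _ x) (Gen.cell x)
  naturality m n f := by
    ext x
    refine val_inj (n := n.unop) fun i => ?_
    refine Eq.trans ?_ (val_map f.unop (ofFam (n := m.unop) (fun i => i.2.app _ x) (Gen.cell x)) i).symm
    refine (congrFun (val_ofFam (n := n.unop) _ _) i).trans ?_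
    refine Eq.trans ?_ (congrArg (i.1.X.map f) (congrFun (val_ofFam (n := m.unop) _ _) i).symm)
    exact ConcreteCategory.congr_hom (i.2.naturality f) x

/-- The extension of a morphism to the free strict `ω`-category. -/
noncomputable def extend {C : OmegaCat.{v}} (f : X ⟶ C.X) : free X ⟶ C where
  map :=
    { app := fun n => ↾fun x => val (n := n.unop) x ⟨C, f⟩
      naturality := fun m n g => by
        ext x
        exact val_map (n := m.unop) g.unop x ⟨C, f⟩ }
  map_idn h x := congrFun (val_ofFam _ _) _
  map_comp h x y e e' := congrFun (val_ofFam _ _) _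

lemma val_unit {n : Globe} (x : X.cell n) (i : Idx X) :
    val ((unit X).app _ x) i = i.2.app _ x :=
  congrFun (val_ofFam _ (Gen.cell x)) i

lemma free_hom_eq {C : OmegaCat.{v}} (g : free X ⟶ C) {n : Globe} (p : Fam X n) (hp : Gen p) :
    g.map.app _ (ofFam p hp) = p ⟨C, unit X ≫ g.map⟩ := by
  induction hp with
  | cell x => rfl
  | idn h p hp ih =>
    have h1 : ofFam _ (Gen.idn h p hp) = (free X).str.idn h (ofFam p hp) :=
      val_inj fun i => by
        refine (congrFun (val_ofFam _ _) i).trans (Eq.trans ?_ (congrFun (val_ofFam _ _) i).symm)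
        rw [val_ofFam]
    rw [h1]
    exact (g.map_idn h _).trans (congrArg _ ih)
  | comp h p q e hp hq ihp ihq =>
    have e' : bd true h (ofFam p hp) = bd false h (ofFam q hq) := val_inj fun i => by
      rw [val_bd, val_bd, val_ofFam, val_ofFam, e]
    have h1 : ofFam _ (Gen.comp h p q e hp hq) = (free X).str.comp h (ofFam p hp) (ofFam q hq) e' :=
      val_inj fun i => by
        refine (congrFun (val_ofFam _ _) i).trans (Eq.trans ?_ (congrFun (val_ofFam _ _) i).symm)
        simp only [val_ofFam]
    rw [h1]
    have e'' := (app_bd g.map true h (ofFam p hp)).symm.trans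
      ((congrArg (g.map.app _) e').trans (app_bd g.map false h (ofFam q hq)))
    refine (g.map_comp h _ _ e' e'').trans ?_
    simp only [ihp, ihq]

/-- Strict `ω`-functors out of the free strict `ω`-category. -/
noncomputable def freeEquiv (X : Glob.{v}) (C : OmegaCat.{v}) : (free X ⟶ C) ≃ (X ⟶ forget.obj C) where
  toFun g := unit X ≫ g.map
  invFun f := extend f
  left_inv g := by
    refine Hom.ext ?_
    ext n x
    have h1 := free_hom_eq g (n := n.unop) _ (gen_val x)
    have h2 : ofFam (n := n.unop) _ (gen_val x) = x := val_inj (n := n.unop) fun i => by rw [val_ofFam]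
    rw [h2] at h1
    exact h1.symm
  right_inv f := by
    ext n x
    exact val_unit (n := n.unop) x ⟨C, f⟩

/-- The monad on globular sets whose algebras are strict `ω`-categories. -/
noncomputable def monad : Monad Glob.{v} :=
  (Adjunction.adjunctionOfEquivLeft (G := forget) freeEquiv fun _ _ _ _ _ => rfl).toMonad

end OmegaCat

/-! ### Operads and multitensors in the case `n = ∞` -/

section

namespace Globe

lemma hom_ne {m n : ℕ} (f : (⟨m⟩ : Globe) ⟶ ⟨n⟩) (h : n < m) : False := by
  rcases f.2 with ⟨_, h'⟩ | ⟨_, h'⟩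
  · have := congrArg dim h'
    simp only at this
    omega
  · simp only at h'
    omega

lemma hom_eq_none {m : ℕ} (f : (⟨m⟩ : Globe) ⟶ ⟨m⟩) : f.1 = none := by
  rcases f.2 with ⟨h, _⟩ | ⟨_, h'⟩
  · exact h
  · exact absurd h' (lt_irrefl _)

lemma hom_ne_none {m n : ℕ} (f : (⟨m⟩ : Globe) ⟶ ⟨n⟩) (h : m < n) : f.1 ≠ none := by
  rcases f.2 with ⟨_, h'⟩ | ⟨h', _⟩
  · have := congrArg dim h'
    simp only at this
    omega
  · exact h'

lemma dim_le {m n : Globe} (f : m ⟶ n) : m.dim ≤ n.dim := by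
  rcases f.2 with ⟨_, h⟩ | ⟨_, h⟩
  · exact le_of_eq (congrArg dim h)
  · exact h.le

/-- The morphism `m ⟶ n` of the same kind as a given morphism `m + 1 ⟶ n + 1`. -/
def unshift {m n : ℕ} (f : (⟨m + 1⟩ : Globe) ⟶ ⟨n + 1⟩) : (⟨m⟩ : Globe) ⟶ ⟨n⟩ :=
  ⟨f.1, f.2.imp (fun h => ⟨h.1, Globe.ext (Nat.succ_injective (congrArg dim h.2))⟩)
    (fun h => ⟨h.1, Nat.lt_of_succ_lt_succ h.2⟩)⟩

end Globe

namespace Glob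

/-- The `n`-cells of a graph `X` enriched in globular sets, regarded as a globular set. -/
def graphCell (X : VGraph Glob.{v}) : ℕ → Type v
  | 0 => X.Obj
  | n + 1 => (a : X.Obj) × (b : X.Obj) × (X.hom a b).cell ⟨n⟩

/-- The boundaries of the `n`-cells of a graph enriched in globular sets. -/
def graphBd (X : VGraph Glob.{v}) : ∀ {m n : ℕ}, ((⟨m⟩ : Globe) ⟶ ⟨n⟩) → graphCell X n → graphCell X m
  | 0, 0, _, x => x
  | 0, _ + 1, f, x => if f.1 = some true then x.2.1 else x.1
  | _ + 1, _ + 1, f, x => ⟨x.1, x.2.1, (X.hom x.1 x.2.1).map (Globe.unshift f).op x.2.2⟩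
  | _ + 1, 0, f, _ => (Globe.hom_ne f (Nat.succ_pos _)).elim

lemma graphBd_id (X : VGraph Glob.{v}) (n : ℕ) (x : graphCell X n) :
    graphBd X (𝟙 (⟨n⟩ : Globe)) x = x := by
  cases n with
  | zero => rfl
  | succ n =>
    obtain ⟨a, b, x⟩ := x
    exact congrArg (fun y => (⟨a, b, y⟩ : graphCell X (n + 1)))
      (ConcreteCategory.congr_hom ((X.hom a b).map_id (Opposite.op (⟨n⟩ : Globe))) x)

lemma graphBd_comp (X : VGraph Glob.{v}) {l m n : ℕ} (f : (⟨l⟩ : Globe) ⟶ ⟨m⟩)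
    (g : (⟨m⟩ : Globe) ⟶ ⟨n⟩) (x : graphCell X n) :
    graphBd X (f ≫ g) x = graphBd X f (graphBd X g x) := by
  have hfg : (f ≫ g).1 = f.1.or g.1 := rfl
  rcases l with _ | l <;> rcases m with _ | m <;> rcases n with _ | n
  · rfl
  · simp only [graphBd, hfg, Globe.hom_eq_none f, Option.none_or]
  · exact (Globe.hom_ne g (Nat.succ_pos _)).elim
  · obtain ⟨b, hb⟩ := Option.ne_none_iff_exists'.mp (Globe.hom_ne_none f (Nat.succ_pos _))
    simp only [graphBd, hfg, hb, Option.some_or]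
  · exact (Globe.hom_ne f (Nat.succ_pos _)).elim
  · exact (Globe.hom_ne f (Nat.succ_pos _)).elim
  · exact (Globe.hom_ne g (Nat.succ_pos _)).elim
  · obtain ⟨a, b, x⟩ := x
    exact congrArg (fun y => (⟨a, b, y⟩ : graphCell X (l + 1))) (ConcreteCategory.congr_hom
      ((X.hom a b).map_comp (Globe.unshift g).op (Globe.unshift f).op) x)

/-- A graph enriched in globular sets, regarded as a globular set. -/
def ofGraph (X : VGraph Glob.{v}) : Glob.{v} where
  obj n := graphCell X n.unop.dim
  map f := ↾(graphBd X f.unop)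
  map_id n := by
    ext x
    exact graphBd_id X n.unop.dim x
  map_comp f g := by
    ext x
    exact graphBd_comp X g.unop f.unop x

/-- The action on cells of a morphism of graphs enriched in globular sets. -/
def graphMap {X Y : VGraph Glob.{v}} (f : X ⟶ Y) : ∀ n, graphCell X n → graphCell Y n
  | 0, x => f.obj x
  | _ + 1, x => ⟨f.obj x.1, f.obj x.2.1, (f.map x.1 x.2.1).app _ x.2.2⟩

lemma graphMap_bd {X Y : VGraph Glob.{v}} (f : X ⟶ Y) {m n : ℕ} (g : (⟨m⟩ : Globe) ⟶ ⟨n⟩)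
    (x : graphCell X n) : graphMap f m (graphBd X g x) = graphBd Y g (graphMap f n x) := by
  rcases m with _ | m <;> rcases n with _ | n
  · rfl
  · exact apply_ite f.obj _ _ _
  · exact (Globe.hom_ne g (Nat.succ_pos _)).elim
  · obtain ⟨a, b, x⟩ := x
    exact congrArg (fun y => (⟨f.obj a, f.obj b, y⟩ : graphCell Y (m + 1)))
      (ConcreteCategory.congr_hom ((f.map a b).naturality (Globe.unshift g).op) x)

/-- The identification of graphs enriched in globular sets with globular sets. -/
def fromGraph : VGraph Glob.{v} ⥤ Glob.{v} where
  obj := ofGraph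
  map f :=
    { app := fun n => ↾(graphMap f n.unop.dim)
      naturality := fun m n g => by
        ext x
        exact graphMap_bd f (m := n.unop.dim) (n := m.unop.dim) g.unop x }
  map_id X := by
    ext ⟨⟨n⟩⟩ x
    cases n <;> rfl
  map_comp f g := by
    ext ⟨⟨n⟩⟩ x
    cases n <;> rfl

/-- The `k`-globe, i.e. the representable globular set. -/
def globe (k : Globe) : Glob.{v} where
  obj n := ULift (n.unop ⟶ k)
  map f := ↾fun x => ⟨f.unop ≫ x.down⟩

/-- The `k`-globe with its unique `k`-cell removed. -/
def globeBoundary (k : Globe) : Glob.{v} where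
  obj n := ULift {_f : n.unop ⟶ k // n.unop.dim < k.dim}
  map f := ↾fun x => ⟨f.unop ≫ x.down.1, lt_of_le_of_lt (Globe.dim_le f.unop) x.down.2⟩

/-- The inclusion `∂k ↪ k`. -/
def globeIncl (k : Globe) : globeBoundary.{v} k ⟶ globe k where
  app n := ↾fun x => ⟨x.down.1⟩

/-- The class `I_{≤∞}` of maps of globular sets. -/
inductive genInf : MorphismProperty Glob.{v}
  | mk (k : Globe) : genInf (globeIncl k)

end Glob

/-- A natural isomorphism `κ : Φ S ≅ T Φ` compatible with the structures of monads `S` on `C` and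
`T` on `D`. If `Φ` is an equivalence, it identifies the monads `S` and `T`. -/
structure MonadIsoAlong {C : Type*} [Category* C] {D : Type*} [Category* D] (Φ : C ⥤ D)
    (S : Monad C) (T : Monad D) where
  iso : S.toFunctor ⋙ Φ ≅ Φ ⋙ T.toFunctor
  unit : ∀ X, Φ.map (S.η.app X) ≫ iso.hom.app X = T.η.app (Φ.obj X)
  mult : ∀ X, Φ.map (S.μ.app X) ≫ iso.hom.app X =
    iso.hom.app (S.obj X) ≫ T.map (iso.hom.app X) ≫ T.μ.app (Φ.obj X)

/-- The monad `𝒯_{≤∞}` on globular sets, whose algebras are the strict `ω`-categories. -/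
noncomputable abbrev omegaMonad : Monad Glob.{v} := OmegaCat.monad

/-- A morphism of monads `α : A ⟶ 𝒯_{≤∞}` is an operad over `Set`: it is a cartesian
transformation, and its components are bijective on `0`-cells. -/
structure Glob.IsOperadOverSet {T A : Monad Glob.{v}} (α : A ⟶ T) : Prop where
  cartesian : NatTrans.Equifibered α.toNatTrans
  bijective : ∀ X, Function.Bijective ((α.app X).app (Opposite.op ⟨0⟩))

/-- The operad `α : A ⟶ 𝒯_{≤∞}` corresponds to the `𝒯_{≤∞}^×`-multitensor `ε : E ⟶ 𝒯_{≤∞}^×`: under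
the identification of graphs enriched in globular sets with globular sets, which identifies
`Γ(𝒯_{≤∞}^×)` with `𝒯_{≤∞}`, `α` is `Γε : ΓE ⟶ Γ(𝒯_{≤∞}^×)` up to an isomorphism of monads. -/
def CorrespondsInf {A : Monad Glob.{v}} (α : A ⟶ omegaMonad) {E : Multitensor Glob.{v}}
    (ε : Multitensor.Hom E (times omegaMonad)) : Prop :=
  ∃ (hE : E.IsDistributive) (hT : (times omegaMonad.{v}).IsDistributive)
    (κ : MonadIsoAlong Glob.fromGraph ((times omegaMonad.{v}).gamma hT) omegaMonad)
    (θ : MonadIsoAlong Glob.fromGraph (E.gamma hE) A),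
    ∀ X, θ.iso.hom.app X ≫ α.app (Glob.fromGraph.obj X) =
      Glob.fromGraph.map (ε.gammaMap.app X) ≫ κ.iso.hom.app X

end

/-!
Pullbacks along a coproduct inclusion of `W` decompose coproducts, and a map out of a connected
object into a coproduct factors uniquely through a summand. A lifting problem of `i : S ⟶ B` in `I`
against a map `∐ⱼ Aⱼ ⟶ ∐ⱼ Bⱼ` over the index set is therefore a lifting problem against a single
`Aⱼ ⟶ Bⱼ`, so that the map of coproducts is a trivial `I`-fibration if and only if all its summands
are. A map of graphs is a trivial `I⁺`-fibration if and only if it is surjective on objects and a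
trivial `I`-fibration on homs. For `Γψ` the former is automatic, and the latter concerns the maps
`ψ` at the sequences of homs along all sequences of objects of a graph; every sequence of objects
of `V` arises in this way from a path graph.

For `n = ∞`, the equivalence between graphs enriched in globular sets and globular sets takes
`∅ ⟶ 0` to `∂0 ↪ 0` and `(∂k ↪ k)` to `∂(k + 1) ↪ k + 1`: the codomains corepresent the cells of
dimension `0` and `k + 1`, and the inclusions are those of the cells of lower dimension.
-/

section

variable {V : Type u} [Category.{v} V]

/-- A category has coproduct pullbacks when, for all families `f j : A j ⟶ B j`, the squares from
`f j` to the coproduct of the family are pullbacks. This is the part of extensivity that lifting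
against connected objects depends on; unlike extensivity it asks for no coproducts. -/
def HasCoprodPullbacks (V : Type u) [Category.{v} V] : Prop :=
  ∀ ⦃J : Type v⦄ ⦃A B : J → V⦄ ⦃X Y : V⦄ (a : ∀ j, A j ⟶ X) (b : ∀ j, B j ⟶ Y)
    (f : ∀ j, A j ⟶ B j) (g : X ⟶ Y), IsCoprod a → IsCoprod b →
      (∀ j, a j ≫ g = f j ≫ b j) → ∀ j, IsPullback (a j) (f j) g (b j)

lemma IsConnectedObj.exists_fac {B : V} (hB : IsConnectedObj B) {J : Type v} {A : J → V} {Z : V}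
    {c : ∀ j, A j ⟶ Z} (hc : IsCoprod c) (f : B ⟶ Z) : ∃ j, ∃ g : B ⟶ A j, g ≫ c j = f := by
  obtain ⟨⟨j, g⟩, h⟩ := (isCoprod_type_iff.mp (hB J A Z c hc)).2 f
  exact ⟨j, g, h⟩

lemma rlp_coprod_iff (hV : HasCoprodPullbacks V) {I : MorphismProperty V}
    (hI : ∀ ⦃S B : V⦄ (i : S ⟶ B), I i → IsConnectedObj B) {J : Type v} {A B : J → V} {X Y : V}
    {a : ∀ j, A j ⟶ X} {b : ∀ j, B j ⟶ Y} (ha : IsCoprod a) (hb : IsCoprod b)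
    (f : ∀ j, A j ⟶ B j) (g : X ⟶ Y) (w : ∀ j, a j ≫ g = f j ≫ b j) :
    I.rlp g ↔ ∀ j, I.rlp (f j) := by
  have pullback := hV a b f g ha hb w
  refine ⟨fun hg j => MorphismProperty.of_isPullback (pullback j) hg,
    fun hf S T i hi => ⟨fun {s t} sq => ?_⟩⟩
  obtain ⟨j, t', rfl⟩ := (hI i hi).exists_fac hb t
  have := hf j i hi
  have sq' : CommSq ((pullback j).lift s (i ≫ t') (by simp [sq.w])) i (f j) t' :=
    ⟨(pullback j).lift_snd _ _ _⟩
  exact CommSq.HasLift.mk' ⟨sq'.lift ≫ a j, by simp, by simp [w]⟩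

lemma isPullback_of_mono {A B X Y : V} {a : A ⟶ X} {f : A ⟶ B} {g : X ⟶ Y} {b : B ⟶ Y}
    [Mono a] [Mono b] (w : a ≫ g = f ≫ b)
    (h : ∀ (S : V) (s : S ⟶ X) (t : S ⟶ B), s ≫ g = t ≫ b → ∃ l : S ⟶ A, l ≫ a = s) :
    IsPullback a f g b := by
  choose l hl using h
  refine ⟨⟨w⟩, ⟨PullbackCone.IsLimit.mk w (fun s => l _ _ _ s.condition)
    (fun s => hl _ _ _ s.condition) (fun s => ?_) fun s m hm _ => ?_⟩⟩
  · rw [← cancel_mono b, Category.assoc, ← w, ← Category.assoc, hl, s.condition]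
  · rw [← cancel_mono a, hm, hl]

namespace VGraph

variable {J : Type v} {A : J → VGraph V} {Z : VGraph V} {c : ∀ j, A j ⟶ Z}

lemma Decomp.mono (hc : Decomp c) (j : J) : Mono (c j) where
  right_cancellation {S} p q h := by
    have obj_eq (x : S.Obj) : p.obj x = q.obj x :=
      eq_of_heq (Sigma.mk.inj (hc.inj (congrFun (congrArg Hom.obj h) x))).2
    refine hom_ext obj_eq fun x y => ?_
    have := hc.iso j (q.obj x) (q.obj y)
    rw [← cancel_mono ((c j).map _ _), Category.assoc, cast_map, ← Category.assoc]
    exact map_congr h x y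

lemma Decomp.exists_fac (hc : Decomp c) {j : J} {S : VGraph V} (s : S ⟶ Z)
    (h : ∀ x, s.obj x ∈ Set.range (c j).obj) : ∃ l : S ⟶ A j, l ≫ c j = s := by
  choose l hl using h
  have := hc.iso j
  refine ⟨⟨l, fun x y => s.map x y ≫ Z.cast (hl x).symm (hl y).symm ≫
    inv ((c j).map (l x) (l y))⟩, hom_ext hl fun x y => by simp⟩

lemma hasCoprodPullbacks [HasInitial V] : HasCoprodPullbacks (VGraph V) := by
  intro J A B X Y a b f g ha hb w j
  rw [isCoprod_iff_decomp] at ha hb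
  have := ha.mono j
  have := hb.mono j
  refine isPullback_of_mono (w j) fun S s t h => ha.exists_fac s fun x => ?_
  obtain ⟨⟨k, y⟩, hy⟩ := ha.bij.2 (s.obj x)
  have image_eq : (b k).obj ((f k).obj y) = (b j).obj (t.obj x) :=
    calc (b k).obj ((f k).obj y) = g.obj ((a k).obj y) :=
          (congrFun (congrArg Hom.obj (w k)) y).symm
      _ = g.obj (s.obj x) := congrArg g.obj hy
      _ = (b j).obj (t.obj x) := congrFun (congrArg Hom.obj h) x
  obtain rfl := (Sigma.mk.inj (hb.inj image_eq)).1
  exact ⟨y, hy⟩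

end VGraph

lemma hasCoprodPullbacks_type : HasCoprodPullbacks (Type v) := by
  intro J A B X Y a b f g ha hb w j
  rw [isCoprod_type_iff] at ha hb
  have b_f (k : J) (z : A k) : b k (f k z) = g (a k z) :=
    (ConcreteCategory.congr_hom (w k) z).symm
  refine (Types.isPullback_iff _ _ _ _).mpr ⟨w j, fun x y h => ?_, fun x y h => ?_⟩
  · exact eq_of_heq (Sigma.mk.inj (ha.1 (a₁ := ⟨j, x⟩) (a₂ := ⟨j, y⟩) h.1)).2
  · obtain ⟨⟨k, z⟩, rfl⟩ := ha.2 x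
    obtain ⟨rfl, hz⟩ := Sigma.mk.inj
      (hb.1 (a₁ := ⟨k, f k z⟩) (a₂ := ⟨j, y⟩) ((b_f k z).trans h))
    exact ⟨z, rfl, eq_of_heq hz⟩

universe w w'

lemma HasCoprodPullbacks.functorCategory {C : Type u} [Category.{max w v} C]
    [HasCoproducts.{max w v} C] (hC : HasCoprodPullbacks C) (K : Type w) [Category.{w'} K] :
    HasCoprodPullbacks (K ⥤ C) :=
  fun _ _ _ _ _ _ _ f g ha hb h j => IsPullback.of_forall_isPullback_app fun k =>
    hC _ _ (fun j => (f j).app k) (g.app k) (ha.map ((evaluation K C).obj k))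
      (hb.map ((evaluation K C).obj k)) (fun j => NatTrans.congr_app (h j) k) j

lemma Glob.hasCoprodPullbacks : HasCoprodPullbacks Glob.{v} :=
  hasCoprodPullbacks_type.functorCategory.{v} Globeᵒᵖ

lemma NGlob.hasCoprodPullbacks : ∀ n, HasCoprodPullbacks (NGlob.{v} n)
  | 0 => hasCoprodPullbacks_type
  | n + 1 => VGraph.hasCoprodPullbacks (V := NGlob.{v} n)

end

namespace IsExtensive

variable {V : Type u} [Category.{v} V] [HasCoproducts.{v} V] {J : Type v} {B : J → V} {j : J}
  {T : Over (B j)} {F : ∀ k, Over (B k)}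

/-- The family of objects over the `B k` which is `T` at `j` and initial elsewhere. It is encoded
by copowers of `T` with the truth value of `j = k`, which avoids deciding equality in `J`. -/
noncomputable def concentrated (j : J) (T : Over (B j)) (k : J) : Over (B k) :=
  Over.mk (Sigma.desc fun h : ULift.{v} (PLift (j = k)) =>
    T.hom ≫ eqToHom (congrArg B h.down.down))

/-- The inclusion of `T` into the value at `j` of the family concentrated at `j`. -/
noncomputable def toConcentrated (j : J) (T : Over (B j)) : T ⟶ concentrated j T j :=
  Over.homMk (Sigma.ι (fun _ : ULift.{v} (PLift (j = j)) => T.left) ⟨⟨rfl⟩⟩)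
    ((Sigma.ι_desc _ _).trans (Category.comp_id _))

lemma bijective_toConcentrated_comp :
    Function.Bijective fun φ : concentrated j T ⟶ F => toConcentrated j T ≫ φ j := by
  refine ⟨fun φ ψ h => ?_, fun l => ⟨fun k => Over.homMk (Sigma.desc fun h =>
    l.left ≫ eqToHom (congrArg (fun k => (F k).left) h.down.down)) ?_, ?_⟩⟩
  · funext k
    refine Over.OverMorphism.ext (Limits.Sigma.hom_ext _ _ ?_)
    rintro ⟨⟨rfl⟩⟩
    exact congrArg Over.Hom.left h
  · refine Limits.Sigma.hom_ext _ _ ?_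
    rintro ⟨⟨rfl⟩⟩
    simp [concentrated]
  · exact Over.OverMorphism.ext ((Sigma.ι_desc _ _).trans (Category.comp_id _))

/-- The inclusion of `T` into the coproduct of the family concentrated at `j`. -/
noncomputable def inclConcentrated (j : J) (T : Over (B j)) :
    T.left ⟶ ∐ fun k => (concentrated j T k).left :=
  (toConcentrated j T).left ≫ Sigma.ι (fun k => (concentrated j T k).left) j

lemma inclConcentrated_comp_map_hom :
    inclConcentrated j T ≫ Limits.Sigma.map (fun k => (concentrated j T k).hom) =
      T.hom ≫ Sigma.ι B j := by
  rw [inclConcentrated, Category.assoc, Sigma.ι_map, Over.w_assoc]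

lemma inclConcentrated_comp_map_left (φ : concentrated j T ⟶ F) :
    inclConcentrated j T ≫ Limits.Sigma.map (fun k => (φ k).left) =
      (toConcentrated j T ≫ φ j).left ≫ Sigma.ι (fun k => (F k).left) j := by
  rw [inclConcentrated, Category.assoc, Sigma.ι_map, Over.comp_left, Category.assoc]

instance epi_inclConcentrated : Epi (inclConcentrated j T) where
  left_cancellation p q h := by
    refine Limits.Sigma.hom_ext _ _ fun k => Limits.Sigma.hom_ext _ _ ?_
    rintro ⟨⟨rfl⟩⟩
    exact (Category.assoc _ _ _).symm.trans (h.trans (Category.assoc _ _ _))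

instance isIso_inclConcentrated : IsIso (inclConcentrated j T) := by
  let retraction (k : J) : (concentrated j T k).left ⟶ T.left := Sigma.desc fun _ => 𝟙 T.left
  have : IsSplitMono (inclConcentrated j T) := ⟨⟨Sigma.desc retraction, by
    rw [inclConcentrated, Category.assoc, Sigma.ι_desc]
    exact Sigma.ι_desc _ _⟩⟩
  exact isIso_of_epi_of_isSplitMono _

lemma existsUnique_comp_ι [(coprodOver B).Full] [(coprodOver B).Faithful]
    (s : T.left ⟶ ∐ fun k => (F k).left)
    (hs : s ≫ Limits.Sigma.map (fun k => (F k).hom) = T.hom ≫ Sigma.ι B j) :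
    ∃! l : T ⟶ F j, l.left ≫ Sigma.ι (fun k => (F k).left) j = s := by
  have hs' : (inv (inclConcentrated j T) ≫ s) ≫ Limits.Sigma.map (fun k => (F k).hom) =
      Limits.Sigma.map (fun k => (concentrated j T k).hom) := by
    rw [Category.assoc, hs, IsIso.inv_comp_eq, inclConcentrated_comp_map_hom]
  have existsUnique_map : ∃! φ : concentrated j T ⟶ F,
      inclConcentrated j T ≫ Limits.Sigma.map (fun k => (φ k).left) = s := by
    obtain ⟨φ, hφ⟩ := (coprodOver B).map_surjective (Over.homMk _ hs')
    refine ⟨φ, ?_, fun ψ hψ => ?_⟩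
    · exact (IsIso.eq_inv_comp _).mp (congrArg Over.Hom.left hφ)
    · refine (coprodOver B).map_injective (Eq.trans (Over.OverMorphism.ext ?_) hφ.symm)
      exact (IsIso.eq_inv_comp (inclConcentrated j T)).mpr hψ
  simp only [inclConcentrated_comp_map_left] at existsUnique_map
  exact (bijective_toConcentrated_comp.existsUnique_iff
    (p := fun l => l.left ≫ Sigma.ι (fun k => (F k).left) j = s)).mpr existsUnique_map

lemma hasCoprodPullbacks (hV : IsExtensive V) : HasCoprodPullbacks V := by
  suffices isPullback_sigma : ∀ (J : Type v) (A B : J → V) (f : ∀ j, A j ⟶ B j) (j : J),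
      IsPullback (Sigma.ι A j) (f j) (Limits.Sigma.map f) (Sigma.ι B j) by
    intro J A B X Y a b f g ha hb w j
    obtain ⟨e, he⟩ := ha.exists_iso (IsCoprod.sigma A)
    obtain ⟨e', he'⟩ := hb.exists_iso (IsCoprod.sigma B)
    refine (isPullback_sigma J A B f j).of_iso (Iso.refl _) e.symm (Iso.refl _) e'.symm
      (by simp [← he]) (by simp) ?_ (by simp [← he'])
    rw [Iso.symm_hom, Iso.symm_hom, Iso.comp_inv_eq, Category.assoc, Iso.eq_inv_comp]
    exact ha.hom_ext fun k => by simp [reassoc_of% he, reassoc_of% w, he']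
  intro J A B f j
  have := hV J B
  have existsUnique_lift {S : V} (s : S ⟶ ∐ A) (t : S ⟶ B j)
      (w : s ≫ Limits.Sigma.map f = t ≫ Sigma.ι B j) :
      ∃! l : Over.mk t ⟶ Over.mk (f j), l.left ≫ Sigma.ι A j = s :=
    existsUnique_comp_ι (T := Over.mk t) (F := fun k => Over.mk (f k)) s w
  refine ⟨⟨Sigma.ι_map f j⟩, ⟨PullbackCone.IsLimit.mk _
    (fun s => (existsUnique_lift _ _ s.condition).choose.left)
    (fun s => (existsUnique_lift _ _ s.condition).choose_spec.1)
    (fun s => Over.w (existsUnique_lift _ _ s.condition).choose) fun s m hm hm' => ?_⟩⟩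
  exact congrArg Over.Hom.left <|
    (existsUnique_lift _ _ s.condition).choose_spec.2 (Over.homMk m hm') hm

end IsExtensive

/-! ### Connected objects -/

section

variable {V : Type u} [Category.{v} V]

lemma IsConnectedObj.of_corepresentableBy {F : V ⥤ Type v} {B : V} (h : F.CorepresentableBy B)
    (hF : PreservesCoprods F) : IsConnectedObj B := fun J A Z c hc =>
  (hF J A Z c hc).of_iso (fun j => h.toIso.inv.app (A j)) (h.toIso.inv.app Z) fun j =>
    h.toIso.inv.naturality (c j)

lemma IsConnectedObj.isEmpty_hom {B : V} (hB : IsConnectedObj B) {Z : V} (hZ : IsInitial Z) :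
    IsEmpty (B ⟶ Z) where
  false f :=
    have empty_coprod : IsCoprod fun j : PEmpty.{v + 1} => j.elim (C := j.elim ⟶ Z) :=
      .of_isInitial _ ⟨hZ⟩
    (hB.exists_fac empty_coprod f).choose.elim

lemma isConnectedObj_punit : IsConnectedObj PUnit.{v + 1} :=
  .of_corepresentableBy .id fun _ _ _ _ hc => hc

lemma isConnectedObj_of_setGen ⦃S B : Type v⦄ (i : S ⟶ B) (hi : setGen i) : IsConnectedObj B := by
  cases hi <;> exact isConnectedObj_punit

lemma hasLiftingProperty_iff_surjective_of_isInitial {F : V ⥤ Type v} {A B X Y : V}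
    (hA : IsInitial A) (hB : F.CorepresentableBy B) (i : A ⟶ B) (f : X ⟶ Y) :
    HasLiftingProperty i f ↔ Function.Surjective (F.map f) := by
  refine ⟨fun h y => ?_, fun h => ⟨fun {s t} _ => ?_⟩⟩
  · have sq : CommSq (hA.to X) i f (hB.homEquiv.symm y) := ⟨hA.hom_ext _ _⟩
    exact ⟨hB.homEquiv sq.lift, by rw [← hB.homEquiv_comp, sq.fac_right, Equiv.apply_symm_apply]⟩
  · obtain ⟨x, hx⟩ := h (hB.homEquiv t)
    refine CommSq.HasLift.mk' ⟨hB.homEquiv.symm x, hA.hom_ext _ _, ?_⟩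
    rw [hB.homEquiv_symm_comp, hx, Equiv.symm_apply_apply]

end

/-! ### Graphs -/

namespace VGraph

variable {V : Type u} [Category.{v} V]

/-- The functor which sends a graph to its set of objects. -/
@[simps]
def objFunctor (V : Type u) [Category.{v} V] : VGraph V ⥤ Type v where
  obj := Obj
  map f := ↾f.obj

/-- The functor which sends a graph to the set of all morphisms from `S` to its homs. -/
@[simps]
def arrowFunctor (S : V) : VGraph V ⥤ Type v where
  obj X := (a : X.Obj) × (b : X.Obj) × (S ⟶ X.hom a b)
  map f := ↾fun x => ⟨f.obj x.1, f.obj x.2.1, x.2.2 ≫ f.map x.1 x.2.1⟩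

/-- The graph without objects is initial. -/
def isInitialEmpty : IsInitial (empty V) :=
  .ofUniqueHom emptyTo fun _ _ => hom_ext (fun a => a.elim) fun a _ => a.elim

variable [HasInitial V]

lemma preservesCoprods_objFunctor : PreservesCoprods (objFunctor V) := fun _ _ _ _ hc =>
  isCoprod_type_iff.mpr (isCoprod_iff_decomp.mp hc).bij

lemma preservesCoprods_arrowFunctor {S : V} (hS : IsConnectedObj S) :
    PreservesCoprods (arrowFunctor S) := by
  intro J A Z c hc
  rw [isCoprod_iff_decomp] at hc
  refine isCoprod_type_iff.mpr ⟨?_, ?_⟩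
  · rintro ⟨j, a, b, s⟩ ⟨k, a', b', s'⟩ h
    obtain ⟨ha, hbs⟩ := Sigma.mk.inj h
    obtain ⟨rfl, ha⟩ := Sigma.mk.inj (hc.inj ha)
    cases ha
    obtain ⟨hb, hs⟩ := Sigma.mk.inj (eq_of_heq hbs)
    obtain ⟨_, hb⟩ := Sigma.mk.inj (hc.inj hb)
    cases hb
    have := hc.iso j a b
    exact congrArg _ (congrArg _ (congrArg _ ((cancel_mono _).mp (eq_of_heq hs))))
  · rintro ⟨a, b, s⟩
    obtain ⟨⟨j, a⟩, rfl⟩ := hc.bij.2 a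
    obtain ⟨⟨k, b⟩, rfl⟩ := hc.bij.2 b
    obtain rfl | hjk := eq_or_ne j k
    · have := hc.iso j a b
      exact ⟨⟨j, a, b, s ≫ inv ((c j).map a b)⟩,
        congrArg _ (congrArg _ ((Category.assoc _ _ _).trans (by simp)))⟩
    · exact ((hS.isEmpty_hom (hc.init j k a b hjk).some).false s).elim

/-- Morphisms from the graph with one object are objects. -/
noncomputable def pointCorepresentableBy : (objFunctor V).CorepresentableBy (point V) where
  homEquiv {_} :=
    { toFun f := f.obj ⟨⟩
      invFun a := ⟨fun _ => a, fun _ _ => initial.to _⟩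
      left_inv _ := hom_ext (fun _ => rfl) fun _ _ => initialIsInitial.hom_ext _ _
      right_inv _ := rfl }
  homEquiv_comp _ _ := rfl

/-- The morphism out of `(S)` which picks a morphism from `S` to a hom. -/
noncomputable def suspDesc {X : VGraph V} {S : V} {a b : X.Obj} (s : S ⟶ X.hom a b) :
    susp S ⟶ X where
  obj z := cond z.down b a
  map
    | ⟨false⟩, ⟨true⟩ => s
    | ⟨false⟩, ⟨false⟩ => initial.to _
    | ⟨true⟩, ⟨false⟩ => initial.to _
    | ⟨true⟩, ⟨true⟩ => initial.to _

/-- Morphisms from the graph `(S)` are morphisms from `S` to a hom. -/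
noncomputable def suspCorepresentableBy (S : V) : (arrowFunctor S).CorepresentableBy (susp S) where
  homEquiv {_} :=
    { toFun f := ⟨_, _, f.map ⟨false⟩ ⟨true⟩⟩
      invFun s := suspDesc s.2.2
      left_inv _ := by
        refine hom_ext (by rintro ⟨_ | _⟩ <;> rfl) ?_
        rintro ⟨_ | _⟩ ⟨_ | _⟩
        case false.true => exact Category.comp_id _
        all_goals exact initialIsInitial.hom_ext _ _
      right_inv _ := rfl }
  homEquiv_comp _ _ := rfl

lemma exists_eq_suspDesc {X : VGraph V} {S : V} (f : susp S ⟶ X) :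
    ∃ (a b : X.Obj) (s : S ⟶ X.hom a b), f = suspDesc s :=
  ⟨_, _, _, ((suspCorepresentableBy S).homEquiv.symm_apply_apply f).symm⟩

lemma suspDesc_eq_iff {X : VGraph V} {S : V} {a b a' b' : X.Obj} {s : S ⟶ X.hom a b}
    {s' : S ⟶ X.hom a' b'} :
    suspDesc s = suspDesc s' ↔ (⟨a, b, s⟩ : (a : X.Obj) × (b : X.Obj) × (S ⟶ X.hom a b)) =
      ⟨a', b', s'⟩ :=
  ((suspCorepresentableBy S).homEquiv (Y := X)).symm.injective.eq_iff (a := ⟨a, b, s⟩)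
    (b := ⟨a', b', s'⟩)

lemma hasLiftingProperty_emptyTo_point_iff {X Y : VGraph V} (f : X ⟶ Y) :
    HasLiftingProperty (emptyTo (point V)) f ↔ Function.Surjective f.obj :=
  hasLiftingProperty_iff_surjective_of_isInitial isInitialEmpty pointCorepresentableBy _ f

lemma suspDesc_comp {X Y : VGraph V} {S : V} {a b : X.Obj} (s : S ⟶ X.hom a b) (f : X ⟶ Y) :
    suspDesc s ≫ f = suspDesc (s ≫ f.map a b) :=
  (suspCorepresentableBy S).homEquiv.injective rfl

lemma suspMap_comp_suspDesc {X : VGraph V} {S B : V} (i : S ⟶ B) {a b : X.Obj}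
    (t : B ⟶ X.hom a b) : suspMap i ≫ suspDesc t = suspDesc (i ≫ t) :=
  (suspCorepresentableBy S).homEquiv.injective rfl

lemma hasLiftingProperty_suspMap_iff {X Y : VGraph V} (f : X ⟶ Y) {S B : V} (i : S ⟶ B) :
    HasLiftingProperty (suspMap i) f ↔ ∀ a b, HasLiftingProperty i (f.map a b) := by
  refine ⟨fun h a b => ⟨fun {s t} sq => ?_⟩, fun h => ⟨fun {s t} sq => ?_⟩⟩
  · have sq_desc : CommSq (suspDesc s) (suspMap i) f (suspDesc t) :=
      ⟨by rw [suspDesc_comp, suspMap_comp_suspDesc, sq.w]⟩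
    obtain ⟨l, fac_left, fac_right⟩ :
        ∃ l, suspMap i ≫ l = suspDesc s ∧ l ≫ f = suspDesc t :=
      ⟨sq_desc.lift, sq_desc.fac_left, sq_desc.fac_right⟩
    obtain ⟨a', b', l, rfl⟩ := exists_eq_suspDesc l
    rw [suspMap_comp_suspDesc, suspDesc_eq_iff] at fac_left
    rw [suspDesc_comp, suspDesc_eq_iff] at fac_right
    cases fac_left
    exact CommSq.HasLift.mk' ⟨l, rfl, by simpa using fac_right⟩
  · obtain ⟨a, b, s, rfl⟩ := exists_eq_suspDesc s
    obtain ⟨a', b', t, rfl⟩ := exists_eq_suspDesc t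
    have w := sq.w
    rw [suspDesc_comp, suspMap_comp_suspDesc, suspDesc_eq_iff] at w
    obtain ⟨rfl, w⟩ := Sigma.mk.inj w
    obtain ⟨rfl, w⟩ := Sigma.mk.inj (eq_of_heq w)
    have := h a b
    have sq_map : CommSq s i (f.map a b) t := ⟨eq_of_heq w⟩
    exact CommSq.HasLift.mk' ⟨suspDesc sq_map.lift,
      by rw [suspMap_comp_suspDesc, sq_map.fac_left],
      by rw [suspDesc_comp, sq_map.fac_right]⟩

lemma rlp_plus_iff (I : MorphismProperty V) {X Y : VGraph V} (f : X ⟶ Y) :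
    (plus I).rlp f ↔ Function.Surjective f.obj ∧ ∀ a b, I.rlp (f.map a b) := by
  refine ⟨fun h => ⟨(hasLiftingProperty_emptyTo_point_iff f).mp (h _ .point), fun a b S B i hi =>
    (hasLiftingProperty_suspMap_iff f i).mp (h _ (.susp i hi)) a b⟩, ?_⟩
  rintro ⟨surjective_obj, rlp_map⟩ _ _ _ (_ | ⟨i, hi⟩)
  · exact (hasLiftingProperty_emptyTo_point_iff f).mpr surjective_obj
  · exact (hasLiftingProperty_suspMap_iff f i).mpr fun a b => rlp_map a b i hi

lemma isConnectedObj_point : IsConnectedObj (point V) :=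
  .of_corepresentableBy pointCorepresentableBy preservesCoprods_objFunctor

lemma isConnectedObj_susp {B : V} (hB : IsConnectedObj B) : IsConnectedObj (susp B) :=
  .of_corepresentableBy (suspCorepresentableBy B) (preservesCoprods_arrowFunctor hB)

lemma isConnectedObj_of_plus {I : MorphismProperty V}
    (hI : ∀ ⦃S B : V⦄ (i : S ⟶ B), I i → IsConnectedObj B) ⦃S B : VGraph V⦄ (i : S ⟶ B)
    (hi : plus I i) : IsConnectedObj B := by
  cases hi with
  | point => exact isConnectedObj_point
  | susp i hi => exact isConnectedObj_susp (hI i hi)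

/-- The graph with objects `0, ..., n` in which the hom from `i` to `i + 1` is `Z i` and all other
homs are initial. -/
noncomputable def pathGraph {n : ℕ} (Z : Fin n → V) : VGraph V where
  Obj := ULift (Fin (n + 1))
  hom a b := if h : a.down.val + 1 = b.down.val then Z ⟨a.down.val, by omega⟩ else ⊥_ V

/-- The sequence of all objects of `pathGraph Z`. -/
def path {n : ℕ} (Z : Fin n → V) : ObjSeq (pathGraph Z).Obj := ⟨n, ULift.up⟩

lemma homs_path {n : ℕ} (Z : Fin n → V) : (pathGraph Z).homs (path Z) = Z :=
  funext fun _ => dif_pos rfl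

end VGraph

lemma NGlob.isConnectedObj_of_genLE :
    ∀ (n : ℕ) ⦃S B : NGlob.{v} n⦄ (i : S ⟶ B), genLE n i → IsConnectedObj B
  | 0 => isConnectedObj_of_setGen
  | n + 1 => VGraph.isConnectedObj_of_plus (V := NGlob.{v} n) (isConnectedObj_of_genLE n)

/-! ### Trivial fibrations of the form `Γψ` -/

section

variable {V : Type u} [Category.{v} V]

namespace VGraph

lemma forall_homs_iff {P : ∀ n, (Fin n → V) → Prop} [HasInitial V] :
    (∀ (X : VGraph V) (a b : X.Obj) (x : SeqFrom a b), P x.1.len (X.homs x.1)) ↔ ∀ n Z, P n Z := by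
  refine ⟨fun h n Z => ?_, fun h _ _ _ _ => h _ _⟩
  have := h (pathGraph Z) _ _ ⟨path Z, rfl, rfl⟩
  rwa [homs_path] at this

lemma rlp_plus_iff_of_isCoprod [HasInitial V] (hV : HasCoprodPullbacks V) {I : MorphismProperty V}
    (hI : ∀ ⦃S B : V⦄ (i : S ⟶ B), I i → IsConnectedObj B) {X Y : VGraph V} {f : X ⟶ Y}
    (surjective_obj : Function.Surjective f.obj) {J : X.Obj → X.Obj → Type v}
    {A B : ∀ a b, J a b → V} {p : ∀ a b j, A a b j ⟶ X.hom a b}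
    {q : ∀ a b j, B a b j ⟶ Y.hom (f.obj a) (f.obj b)} (hp : ∀ a b, IsCoprod (p a b))
    (hq : ∀ a b, IsCoprod (q a b)) (g : ∀ a b j, A a b j ⟶ B a b j)
    (w : ∀ a b j, p a b j ≫ f.map a b = g a b j ≫ q a b j) :
    (plus I).rlp f ↔ ∀ a b j, I.rlp (g a b j) := by
  rw [rlp_plus_iff, and_iff_right surjective_obj]
  exact forall₂_congr fun a b => rlp_coprod_iff hV hI (hp a b) (hq a b) _ _ (w a b)

end VGraph

variable [HasCoproducts.{v} V]

lemma Multitensor.Hom.isTrivialFibration_gammaMap_iff (hV : HasCoprodPullbacks V)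
    {E F : Multitensor V} (ε : Multitensor.Hom E F) {I : MorphismProperty V}
    (hI : ∀ ⦃S B : V⦄ (i : S ⟶ B), I i → IsConnectedObj B) :
    IsTrivialFibration (VGraph.plus I) ε.gammaMap ↔ ∀ n, IsTrivialFibration I (ε.app n) := by
  refine Iff.trans (forall_congr' fun X => ?_)
    (VGraph.forall_homs_iff (P := fun n Z => I.rlp ((ε.app n).app Z)))
  exact VGraph.rlp_plus_iff_of_isCoprod hV hI (f := ε.gammaMap.app X) Function.surjective_id
    (E.isCoprod_incl X) (F.isCoprod_incl X)
    (fun _ _ (x : SeqFrom _ _) => (ε.app x.1.len).app (X.homs x.1)) fun _ _ _ => Sigma.ι_desc _ _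

variable {W : Type u'} [Category.{v} W] [HasCoproducts.{v} W]

lemma LaxMonFunctor.incl_comp_gammaMap {E : Multitensor V} {F : Multitensor W}
    (H : LaxMonFunctor E F) (X : VGraph V) (a b : X.Obj) (x : SeqFrom a b) :
    F.incl ((VGraph.mapFunctor H.functor).obj X) x ≫ (H.gammaMap.app X).map a b =
      H.coh (X.homs x.1) ≫ H.functor.map (E.incl X x) := by
  have h1 := Sigma.ι_map (fun x : SeqFrom (S := X.Obj) a b => H.coh (X.homs x.1)) x
  have h2 := ι_comp_sigmaComparison H.functor (fun x : SeqFrom (S := X.Obj) a b =>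
    (E.ten x.1.len).obj (X.homs x.1)) x
  refine (Category.assoc _ _ _).symm.trans ((congrArg (· ≫ _) h1).trans ?_)
  exact (Category.assoc _ _ _).trans (congrArg (_ ≫ ·) h2)

lemma LaxMonFunctor.isTrivialFibration_gammaMap_iff (hW : HasCoprodPullbacks W)
    {E : Multitensor V} {F : Multitensor W} (H : LaxMonFunctor E F)
    (hH : PreservesCoprods H.functor) {I : MorphismProperty W}
    (hI : ∀ ⦃S B : W⦄ (i : S ⟶ B), I i → IsConnectedObj B) :
    IsTrivialFibration (VGraph.plus I) H.gammaMap ↔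
      ∀ (n : ℕ) (X : Fin n → V), I.rlp (H.coh X) := by
  refine Iff.trans (forall_congr' fun X => ?_)
    (VGraph.forall_homs_iff (P := fun n Z => I.rlp (H.coh Z)))
  exact VGraph.rlp_plus_iff_of_isCoprod hW hI (f := H.gammaMap.app X) Function.surjective_id
    (F.isCoprod_incl ((VGraph.mapFunctor H.functor).obj X))
    (fun a b => hH _ _ _ _ (E.isCoprod_incl X a b)) _ (H.incl_comp_gammaMap X)

lemma Corresponds.isTrivialFibration_iff {E F : Multitensor V} {hF : F.IsDistributive}
    {A : Monad (VGraph V)} {α : A ⟶ F.gamma hF} {ε : Multitensor.Hom E F} (h : Corresponds α ε)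
    (I : MorphismProperty (VGraph V)) :
    IsTrivialFibration I α.toNatTrans ↔ IsTrivialFibration I ε.gammaMap := by
  obtain ⟨hE, θ, hθ⟩ := h
  refine forall_congr' fun X => ?_
  rw [← MorphismProperty.cancel_left_of_respectsIso I.rlp ((MonadIso.toNatIso θ).app X).hom]
  exact iff_of_eq (congrArg (I.rlp (X := (E.gamma hE).obj X) (Y := (F.gamma hF).obj X)) (hθ X))

end

/-! ### Globular sets as graphs enriched in globular sets -/

namespace Globe

/-- The endofunctor of the category of globes which raises the dimension by one. -/
def shift : Globe ⥤ Globe where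
  obj n := ⟨n.dim + 1⟩
  map f := ⟨f.1, f.2.imp (fun h => ⟨h.1, Globe.ext (congrArg (·.dim + 1) h.2)⟩)
    (fun h => ⟨h.1, Nat.succ_lt_succ h.2⟩)⟩

lemma hom_eq_face {n : ℕ} (f : (⟨0⟩ : Globe) ⟶ ⟨n + 1⟩) :
    f = face (f.1.getD false) n.succ_pos := by
  obtain ⟨b, hb⟩ := Option.ne_none_iff_exists'.mp (hom_ne_none f n.succ_pos)
  exact Subtype.ext (by rw [hb]; rfl)

end Globe

/-- An equivalence `G` identifies an object which corepresents `G ⋙ F` with one which corepresents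
`F`. -/
noncomputable def isoOfCorepresentableBy {C : Type u} {D : Type u'} [Category.{v} C]
    [Category.{v} D] (G : C ⥤ D) [G.IsEquivalence] {F : D ⥤ Type v} {K : D} {X : C}
    (hK : F.CorepresentableBy K) (hX : (G ⋙ F).CorepresentableBy X) : K ≅ G.obj X :=
  (G.asEquivalence.counitIso.app K).symm ≪≫ G.mapIso
    (((G.asEquivalence.symm.toAdjunction.corepresentableBy K).ofIso
      (Functor.isoWhiskerLeft G hK.toIso)).uniqueUpToIso hX)

namespace Glob

lemma isIso_of_bijective {X Y : Glob.{v}} (f : X ⟶ Y)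
    (h : ∀ n : ℕ, Function.Bijective (f.app (Opposite.op ⟨n⟩))) : IsIso f := by
  rw [NatTrans.isIso_iff_isIso_app]
  exact fun n => (isIso_iff_bijective _).mpr (h n.unop.dim)

lemma hom_naturality {X Y : Glob.{v}} (f : X ⟶ Y) {m n : Globe} (g : m ⟶ n) (x : X.cell n) :
    f.app _ (X.map g.op x) = Y.map g.op (f.app _ x) :=
  ConcreteCategory.congr_hom (f.naturality g.op) x

instance : fromGraph.{v}.Faithful where
  map_injective {X Y f g} h := by
    have h_cell (n : ℕ) (x : graphCell X n) : graphMap f n x = graphMap g n x :=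
      ConcreteCategory.congr_hom (NatTrans.congr_app h (Opposite.op ⟨n⟩)) x
    obtain ⟨f₀, f₁⟩ := f
    obtain ⟨g₀, g₁⟩ := g
    obtain rfl : f₀ = g₀ := funext (h_cell 0)
    refine VGraph.hom_ext' fun a b => ?_
    ext ⟨⟨n⟩⟩ x
    exact eq_of_heq (Sigma.mk.inj (eq_of_heq (Sigma.mk.inj (h_cell (n + 1) ⟨a, b, x⟩)).2)).2

lemma exists_app_succ_eq {X Y : VGraph Glob.{v}} (g : fromGraph.obj X ⟶ fromGraph.obj Y)
    {a b : X.Obj} {n : ℕ} (x : (X.hom a b).cell ⟨n⟩) :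
    ∃ y : (Y.hom (g.app (Opposite.op ⟨0⟩) a) (g.app (Opposite.op ⟨0⟩) b)).cell ⟨n⟩,
      g.app (Opposite.op ⟨n + 1⟩) (⟨a, b, x⟩ : graphCell X (n + 1)) =
        (⟨_, _, y⟩ : graphCell Y (n + 1)) := by
  let z : graphCell Y (n + 1) := g.app (Opposite.op ⟨n + 1⟩) (⟨a, b, x⟩ : graphCell X (n + 1))
  have source : g.app (Opposite.op ⟨0⟩) a = z.1 :=
    hom_naturality g (Globe.face false n.succ_pos) (⟨a, b, x⟩ : graphCell X (n + 1))
  have target : g.app (Opposite.op ⟨0⟩) b = z.2.1 :=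
    hom_naturality g (Globe.face true n.succ_pos) (⟨a, b, x⟩ : graphCell X (n + 1))
  rw [source, target]
  exact ⟨z.2.2, rfl⟩

instance : fromGraph.{v}.Full where
  map_surjective {X Y} g := by
    choose y hy using @exists_app_succ_eq _ _ g
    refine ⟨⟨g.app (Opposite.op ⟨0⟩), fun a b => ⟨fun n => ↾fun x => y x, fun m n f => ?_⟩⟩, ?_⟩
    · ext x
      have h := hom_naturality g (Globe.shift.map f.unop)
        (⟨a, b, x⟩ : graphCell X (m.unop.dim + 1))
      have h' := ((hy ((X.hom a b).map f x)).symm.trans h).trans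
        (congrArg (graphBd Y (m := n.unop.dim + 1) (Globe.shift.map f.unop)) (hy x))
      exact eq_of_heq (Sigma.mk.inj (eq_of_heq (Sigma.mk.inj h').2)).2
    · ext ⟨⟨_ | n⟩⟩ x
      · rfl
      · exact (hy x.2.2).symm

/-- The globular set of the cells of positive dimension of `Z` with `0`-dimensional source `a` and
target `b`, the dimensions being lowered by one. -/
def cellsBetween (Z : Glob.{v}) (a b : Z.cell ⟨0⟩) : Subfunctor (Globe.shift.op ⋙ Z) where
  obj n := {x | bd (k := ⟨0⟩) (n := ⟨n.unop.dim + 1⟩) false (Nat.succ_pos _) x = a ∧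
    bd (k := ⟨0⟩) (n := ⟨n.unop.dim + 1⟩) true (Nat.succ_pos _) x = b}
  map _ x hx :=
    ⟨(ConcreteCategory.congr_hom (Z.map_comp _ _) x).symm.trans hx.1,
      (ConcreteCategory.congr_hom (Z.map_comp _ _) x).symm.trans hx.2⟩

/-- The graph enriched in globular sets which corresponds to a globular set. -/
def toGraph (Z : Glob.{v}) : VGraph Glob.{v} where
  Obj := Z.cell ⟨0⟩
  hom a b := (cellsBetween Z a b).toFunctor

/-- The cell of `Z` given by a cell of `toGraph Z`. -/
def ofToGraphCell (Z : Glob.{v}) : ∀ n : ℕ, graphCell (toGraph Z) n → Z.cell ⟨n⟩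
  | 0, x => x
  | _ + 1, x => x.2.2.1

lemma ofToGraphCell_bijective (Z : Glob.{v}) (n : ℕ) :
    Function.Bijective (ofToGraphCell Z n) := by
  cases n with
  | zero => exact Function.bijective_id
  | succ n =>
    refine ⟨?_, fun x => ⟨⟨_, _, x, rfl, rfl⟩, rfl⟩⟩
    rintro ⟨a, b, x, rfl, rfl⟩ ⟨a', b', x', rfl, rfl⟩ (rfl : x = x')
    rfl

lemma ofToGraphCell_graphBd (Z : Glob.{v}) {m n : ℕ} (f : (⟨m⟩ : Globe) ⟶ ⟨n⟩)
    (x : graphCell (toGraph Z) n) :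
    ofToGraphCell Z m (graphBd (toGraph Z) f x) = Z.map f.op (ofToGraphCell Z n x) := by
  rcases m with _ | m <;> rcases n with _ | n
  · obtain rfl : f = 𝟙 _ := Subtype.ext (Globe.hom_eq_none f)
    exact (ConcreteCategory.congr_hom (Z.map_id _) x).symm
  · obtain ⟨a, b, x, hx, hx'⟩ := x
    rw [Globe.hom_eq_face f]
    cases f.1.getD false
    · exact hx.symm
    · exact hx'.symm
  · exact (Globe.hom_ne f (Nat.succ_pos _)).elim
  · rfl

/-- The morphism which shows that `toGraph` is a section of `fromGraph` up to isomorphism. -/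
def fromGraphToGraph (Z : Glob.{v}) : fromGraph.obj (toGraph Z) ⟶ Z where
  app n := ↾(ofToGraphCell Z n.unop.dim)
  naturality _ _ f := by
    ext x
    exact ofToGraphCell_graphBd Z f.unop x

instance (Z : Glob.{v}) : IsIso (fromGraphToGraph Z) :=
  isIso_of_bijective _ (ofToGraphCell_bijective Z)

instance : fromGraph.{v}.EssSurj where
  mem_essImage Z := ⟨toGraph Z, ⟨asIso (fromGraphToGraph Z)⟩⟩

instance : fromGraph.{v}.IsEquivalence where

/-! ### Globes -/

/-- Morphisms from the `k`-globe are `k`-cells. -/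
def globeCorepresentableBy (k : Globe) :
    ((evaluation Globeᵒᵖ (Type v)).obj (Opposite.op k)).CorepresentableBy (globe k) where
  homEquiv {_} := uliftYonedaEquiv
  homEquiv_comp _ _ := rfl

lemma isConnectedObj_globe (k : Globe) : IsConnectedObj (globe.{v} k) :=
  .of_corepresentableBy (globeCorepresentableBy k) fun _ _ _ _ hc => hc.map _

lemma isConnectedObj_of_genInf ⦃S B : Glob.{v}⦄ (i : S ⟶ B) (hi : genInf i) :
    IsConnectedObj B := by
  cases hi
  exact isConnectedObj_globe _

/-- The functor which sends a globular set to its globular subset of all cells of dimension less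
than `d`. -/
def skeleton (d : ℕ) : Glob.{v} ⥤ Glob.{v} where
  obj X :=
    { obj n := {_x : X.obj n // n.unop.dim < d}
      map f := ↾fun x => ⟨X.map f x.1, (Globe.dim_le f.unop).trans_lt x.2⟩ }
  map f := { app n := ↾fun x => ⟨f.app n x.1, x.2⟩ }

/-- The inclusion of the cells of dimension less than `d`. -/
def skeletonIncl (d : ℕ) : skeleton.{v} d ⟶ 𝟭 _ where
  app X := { app n := ↾fun x => x.1 }

/-- A morphism which is, up to isomorphism, the inclusion of all cells of dimension less than
`d`. -/
structure IsSkeletonInclusion (d : ℕ) {A X : Glob.{v}} (i : A ⟶ X) : Prop where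
  bijective (n : ℕ) (hn : n < d) : Function.Bijective (i.app (Opposite.op ⟨n⟩))
  isEmpty (n : ℕ) (hn : d ≤ n) : IsEmpty (A.cell ⟨n⟩)

namespace IsSkeletonInclusion

variable {d : ℕ} {A B X Y : Glob.{v}} {i : A ⟶ X} {j : B ⟶ Y}

lemma nonempty_arrowIso_skeletonIncl (hi : IsSkeletonInclusion d i) :
    Nonempty (Arrow.mk i ≅ Arrow.mk ((skeletonIncl d).app X)) := by
  have dim_lt (n : Globeᵒᵖ) (x : A.obj n) : n.unop.dim < d :=
    not_le.mp fun h => (hi.isEmpty _ h).false x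
  let lift : A ⟶ (skeleton d).obj X :=
    { app n := ↾fun x => ⟨i.app n x, dim_lt n x⟩
      naturality m n f := by
        ext x
        exact Subtype.ext (hom_naturality i f.unop x) }
  have : IsIso lift := isIso_of_bijective lift fun n => by
    refine ⟨fun x y h => (hi.bijective n (dim_lt _ x)).1 (congrArg Subtype.val h), fun x => ?_⟩
    obtain ⟨y, hy⟩ := (hi.bijective n x.2).2 x.1
    exact ⟨y, Subtype.ext hy⟩
  exact ⟨Arrow.isoMk (asIso lift) (Iso.refl X) rfl⟩

lemma nonempty_arrowIso (hi : IsSkeletonInclusion d i) (hj : IsSkeletonInclusion d j)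
    (e : X ≅ Y) : Nonempty (Arrow.mk i ≅ Arrow.mk j) := by
  obtain ⟨ei⟩ := hi.nonempty_arrowIso_skeletonIncl
  obtain ⟨ej⟩ := hj.nonempty_arrowIso_skeletonIncl
  exact ⟨ei ≪≫ Arrow.isoMk' _ _ ((skeleton d).mapIso e) e
    ((skeletonIncl d).naturality e.hom).symm ≪≫ ej.symm⟩

end IsSkeletonInclusion

lemma isEmpty_initial (n : Globeᵒᵖ) : IsEmpty ((⊥_ Glob.{v}).obj n) :=
  ⟨fun x => ((initial.to ((Functor.const _).obj PEmpty : Glob.{v})).app n x).elim⟩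

lemma isSkeletonInclusion_globeIncl (k : Globe) :
    IsSkeletonInclusion k.dim (globeIncl.{v} k) where
  bijective _ hn := ⟨fun _ _ h => ULift.ext _ _ (Subtype.ext (congrArg ULift.down h)),
    fun x => ⟨⟨x.down, hn⟩, rfl⟩⟩
  isEmpty _ hn := ⟨fun x => hn.not_gt x.down.2⟩

lemma isSkeletonInclusion_emptyTo (X : VGraph Glob.{v}) :
    IsSkeletonInclusion 0 (fromGraph.map (VGraph.emptyTo X)) where
  bijective _ hn := absurd hn (Nat.not_lt_zero _)
  isEmpty
    | 0, _ => inferInstanceAs (IsEmpty PEmpty)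
    | _ + 1, _ => ⟨fun x => PEmpty.elim x.1⟩

lemma isSkeletonInclusion_suspMap {d : ℕ} {S B : Glob.{v}} {i : S ⟶ B}
    (hi : IsSkeletonInclusion d i) :
    IsSkeletonInclusion (d + 1) (fromGraph.map (VGraph.suspMap i)) where
  bijective
    | 0, _ => Function.bijective_id
    | n + 1, hn => by
      have bijective_hom (a b : Bool) :
          Function.Bijective ((VGraph.suspHomMap i a b).app (Opposite.op ⟨n⟩)) :=
        match a, b with
        | false, true => hi.bijective n (Nat.lt_of_succ_lt_succ hn)
        | false, false | true, false | true, true => Function.bijective_id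
      exact (Equiv.sigmaCongrRight fun a => Equiv.sigmaCongrRight fun b =>
        Equiv.ofBijective _ (bijective_hom (ULift.down a) (ULift.down b))).bijective
  isEmpty
    | n + 1, hn => by
      have isEmpty_hom (a b : Bool) : IsEmpty ((VGraph.suspHom S a b).cell ⟨n⟩) :=
        match a, b with
        | false, true => hi.isEmpty n (Nat.le_of_succ_le_succ hn)
        | false, false | true, false | true, true => isEmpty_initial _
      exact ⟨fun x => (isEmpty_hom _ _).false x.2.2⟩

/-- The `(k + 1)`-cells of the globular set of a graph are the morphisms from the `k`-globe to the
homs of the graph. -/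
def arrowFunctorGlobeIso (k : ℕ) : VGraph.arrowFunctor (globe.{v} ⟨k⟩) ≅
    fromGraph.{v} ⋙ (evaluation _ _).obj (Opposite.op ⟨k + 1⟩) :=
  NatIso.ofComponents fun X => (Equiv.sigmaCongrRight fun a => Equiv.sigmaCongrRight fun b =>
    (globeCorepresentableBy ⟨k⟩).homEquiv).toIso

lemma nonempty_globeIncl_zero_iso : Nonempty (Arrow.mk (globeIncl.{v} ⟨0⟩) ≅
    Arrow.mk (fromGraph.map (VGraph.emptyTo (VGraph.point Glob.{v})))) :=
  (isSkeletonInclusion_globeIncl _).nonempty_arrowIso (isSkeletonInclusion_emptyTo _)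
    (isoOfCorepresentableBy fromGraph (globeCorepresentableBy _) VGraph.pointCorepresentableBy)

lemma nonempty_globeIncl_succ_iso (k : ℕ) : Nonempty (Arrow.mk (globeIncl.{v} ⟨k + 1⟩) ≅
    Arrow.mk (fromGraph.map (VGraph.suspMap (globeIncl.{v} ⟨k⟩)))) :=
  (isSkeletonInclusion_globeIncl _).nonempty_arrowIso
    (isSkeletonInclusion_suspMap (isSkeletonInclusion_globeIncl _))
    (isoOfCorepresentableBy fromGraph (globeCorepresentableBy _)
      ((VGraph.suspCorepresentableBy _).ofIso (arrowFunctorGlobeIso k)))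

lemma rlp_fromGraph_map_iff {X Y : VGraph Glob.{v}} (f : X ⟶ Y) :
    genInf.rlp (fromGraph.map f) ↔ (VGraph.plus genInf).rlp f := by
  have lift_zero : HasLiftingProperty (globeIncl.{v} ⟨0⟩) (fromGraph.map f) ↔
      HasLiftingProperty (VGraph.emptyTo (VGraph.point Glob.{v})) f :=
    (HasLiftingProperty.iff_of_arrow_iso_left nonempty_globeIncl_zero_iso.some _).trans
      (fromGraph.hasLiftingProperty_iff_of_isEquivalence _ _)
  have lift_succ (k : ℕ) : HasLiftingProperty (globeIncl.{v} ⟨k + 1⟩) (fromGraph.map f) ↔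
      HasLiftingProperty (VGraph.suspMap (globeIncl.{v} ⟨k⟩)) f :=
    (HasLiftingProperty.iff_of_arrow_iso_left (nonempty_globeIncl_succ_iso k).some _).trans
      (fromGraph.hasLiftingProperty_iff_of_isEquivalence _ _)
  constructor
  · rintro h _ _ _ (_ | ⟨_, ⟨⟨k⟩⟩⟩)
    · exact lift_zero.mp (h _ (.mk _))
    · exact (lift_succ k).mp (h _ (.mk _))
  · rintro h _ _ _ ⟨⟨_ | k⟩⟩
    · exact lift_zero.mpr (h _ .point)
    · exact (lift_succ k).mpr (h _ (.susp _ (.mk _)))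

end Glob

lemma CorrespondsInf.isTrivialFibration_iff {A : Monad Glob.{v}} {α : A ⟶ omegaMonad}
    {E : Multitensor Glob.{v}} {ε : Multitensor.Hom E (times omegaMonad)}
    (h : CorrespondsInf α ε) : IsTrivialFibration Glob.genInf α.toNatTrans ↔
      IsTrivialFibration (VGraph.plus Glob.genInf) ε.gammaMap := by
  obtain ⟨hE, hT, κ, θ, hθ⟩ := h
  have rlp_app_fromGraph (X : VGraph Glob.{v}) :
      Glob.genInf.rlp (α.app (Glob.fromGraph.obj X)) ↔
        (VGraph.plus Glob.genInf).rlp (ε.gammaMap.app X) :=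
    (Glob.genInf.rlp.arrow_mk_iso_iff
      (Arrow.isoMk' _ _ (θ.iso.app X) (κ.iso.app X) (hθ X))).symm.trans
      (Glob.rlp_fromGraph_map_iff _)
  refine ⟨fun h X => (rlp_app_fromGraph X).mp (h _), fun h Z => ?_⟩
  let e := Glob.fromGraph.objObjPreimageIso Z
  exact (Glob.genInf.rlp.arrow_mk_iso_iff
    (Arrow.isoMk' _ _ (A.mapIso e) (omegaMonad.mapIso e) (α.naturality e.hom))).mp
    ((rlp_app_fromGraph _).mpr (h _))

theorem mainTheorem7_general :
    (∀ (V : Type u) [Category.{v} V] [HasCoproducts.{v} V]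
        (W : Type u') [Category.{v} W] [HasCoproducts.{v} W]
        (E : Multitensor V) (F : Multitensor W) (H : LaxMonFunctor E F) (I : MorphismProperty W),
        HasCoprodPullbacks W → PreservesCoprods H.functor →
        (∀ ⦃S B : W⦄ (i : S ⟶ B), I i → IsConnectedObj B) →
          ((∀ (n : ℕ) (X : Fin n → V), I.rlp (H.coh X)) ↔
            IsTrivialFibration (VGraph.plus I) H.gammaMap)) ∧
    (∀ (V : Type u) [Category.{v} V] [HasCoproducts.{v} V] (I : MorphismProperty V),
        HasCoprodPullbacks V → (∀ ⦃S B : V⦄ (i : S ⟶ B), I i → IsConnectedObj B) →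
        ∀ (E F : Multitensor V) (hF : F.IsDistributive) (A : Monad (VGraph V))
          (α : A ⟶ F.gamma hF) (ε : Multitensor.Hom E F), Corresponds α ε →
          (IsTrivialFibration (VGraph.plus I) α.toNatTrans ↔
            ∀ m, IsTrivialFibration I (ε.app m))) ∧
    (∀ (A : Monad Glob.{v}) (α : A ⟶ omegaMonad) (E : Multitensor Glob.{v})
        (ε : Multitensor.Hom E (times omegaMonad)), CorrespondsInf α ε →
        (IsTrivialFibration Glob.genInf α.toNatTrans ↔
          ∀ m, IsTrivialFibration Glob.genInf (ε.app m))) := by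
  refine ⟨?_, ?_, ?_⟩
  · intro V _ _ W _ _ E F H I hW hH hI
    exact (H.isTrivialFibration_gammaMap_iff hW hH hI).symm
  · intro V _ _ I hV hI E F hF A α ε h
    exact (h.isTrivialFibration_iff _).trans (ε.isTrivialFibration_gammaMap_iff hV hI)
  · intro A α E ε h
    exact h.isTrivialFibration_iff.trans
      (ε.isTrivialFibration_gammaMap_iff Glob.hasCoprodPullbacks Glob.isConnectedObj_of_genInf)

theorem mainTheorem7 :
    -- the proposition on lax monoidal functors
    (∀ (V : Type u) [Category.{v} V] [HasCoproducts.{v} V]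
        (W : Type u') [Category.{v} W] [HasCoproducts.{v} W]
        (E : Multitensor V) (_ : E.IsDistributive) (F : Multitensor W) (_ : F.IsDistributive)
        (H : LaxMonFunctor E F) (I : MorphismProperty W),
        IsExtensive W → PreservesCoprods H.functor →
        (∀ ⦃S B : W⦄ (i : S ⟶ B), I i → IsConnectedObj B) →
          ((∀ (n : ℕ) (X : Fin n → V), I.rlp (H.coh X)) ↔
            IsTrivialFibration (VGraph.plus I) H.gammaMap)) ∧
    -- the corollary on operads over sets, for finite `n`
    (∀ (n : ℕ) (A : Monad (NGlob.{v} (n + 1))) (α : A ⟶ strictMonad (n + 1))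
        (_ : IsOperadOverSet (V := NGlob.{v} n) α)
        (E : Multitensor (NGlob.{v} n)) (ε : Multitensor.Hom E (times (strictMonad n)))
        (_ : ε.IsCartesian) (_ : Corresponds (V := NGlob.{v} n) α ε),
        IsTrivialFibration (genLE (n + 1)) α.toNatTrans ↔
          ∀ m, IsTrivialFibration (genLE n) (ε.app m)) ∧
    -- the corollary on operads over sets, for `n = ∞`
    (∀ (A : Monad Glob.{v}) (α : A ⟶ omegaMonad) (_ : Glob.IsOperadOverSet α)
        (E : Multitensor Glob.{v}) (ε : Multitensor.Hom E (times omegaMonad))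
        (_ : ε.IsCartesian) (_ : CorrespondsInf α ε),
        IsTrivialFibration Glob.genInf α.toNatTrans ↔
          ∀ m, IsTrivialFibration Glob.genInf (ε.app m)) := by
  refine ⟨?_, ?_, ?_⟩
  · intro V _ _ W _ _ E _ F _ H I hW
    exact mainTheorem7_general.1 V W E F H I hW.hasCoprodPullbacks
  · intro n A α _ E ε _
    exact mainTheorem7_general.{v, v + 1, u'}.2.1 (NGlob n) (genLE n) (NGlob.hasCoprodPullbacks n)
      (NGlob.isConnectedObj_of_genLE n) E _ _ A α ε
  · intro A α _ E ε _
    exact mainTheorem7_general.{v, u, u'}.2.2 A α E ε
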